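/- Let $G_k$ ($k=1,2,3,\dots$) be finite connected graphs, in which parallel edges and self-edges are allowed, each with a distinguished vertex $v_k$. Write $\deg_*(x)$ for the number of edges incident to $x$ that are not self-edges, and assume that $$\max_{x\in G_k}\Bigl|\frac{\deg_*(x)}{k}-1\Bigr|\longrightarrow 0\qquad (k\to\infty).$$ For oriented edges $e=\vec{xy}$ and $f=\vec{zw}$ of $G_k$, let the transfer impedance be $M(e,f)=\phi(z)-\phi(w)$, where $\phi$ is the voltage function (unique up to an additive constant) when every edge is a one-ohm resistor and a unit current enters at $x$ and leaves at $y$, that is, the sum of $\phi(a)-\phi(b)$ over all edges joining $a$ to another vertex $b$ equals $\mathbf 1_{a=x}-\mathbf 1_{a=y}$ for every vertex $a$. Assume that $$M(e,f)=k^{-1}\bigl(|e\cap f|+o(1)\bigr)\qquad (k\to\infty)$$ uniformly over all pairs of edges $e,f$ of $G_k$ that are not self-edges, where $|e\cap f|$ is the number of common endpoints of $e$ and $f$, and where $e=\vec{xy}$ and $f=\vec{zw}$ are oriented compatibly, meaning $x\ne w$ and $y\ne z$ (reversing one of two edges changes the sign of $M(e,f)$). Let $\mathbf T_k$ be a uniformly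 random spanning tree of $G_k$, rooted at $v_k$. Let $\mathcal P_1$ be the random tree obtained from an infinite path $x_0,x_1,x_2,\dots$, rooted at $x_0$, by attaching to each $x_i$ the family tree of a Galton–Watson branching process with Poisson$(1)$ offspring distribution, started from $x_i$, the branching processes being independent (this is also described as the Poisson$(1)$ Galton–Watson tree conditioned to survive forever). For a rooted tree $\mathbf T$ and an integer $r\ge 0$, let $\mathbf T\wedge r$ be the subtree of the vertices at distance at most $r$ from the root. Then $\mathbf T_k$ converges locally in distribution to $\mathcal P_1$: for every $r\ge 0$ and every finite rooted tree $t$ of height at most $r$, $$\mathbf P(\mathbf T_k\wedge r\cong t)\longrightarrow \mathbf P(\mathcal P_1\wedge r\cong t)\qquad (k\to\infty),$$ where $\cong$ denotes isomorphism of rooted trees. -/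

import Mathlib

open Filter Topology MeasureTheory ProbabilityTheory
open scoped Graph

namespace USTLimit

/-! ### Finite multigraphs

`Graph α β` is Mathlib's type of multigraphs with vertices in `α` and edges in `β`; parallel edges
and self-edges are allowed. -/

section Multigraph

variable {α β : Type*}

/-- The graph `G` is connected (in particular it has a vertex). -/
def IsConnected (G : Graph α β) : Prop := G.toSimpleGraph.Connected

/-- `deg_*(x)`: the number of edges incident to `x` that are not self-edges. -/
noncomputable def degStar (G : Graph α β) (x : α) : ℕ := {e | G.IsNonloopAt e x}.ncard

/-- The number of edges connecting `x` to `y`. -/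
noncomputable def mult (G : Graph α β) (x y : α) : ℕ := {e | G.IsLink e x y}.ncard

open Classical in
/-- `φ` gives the voltages when every edge of `G` is a one-ohm resistor and a unit current
enters at `x` and leaves at `y`: at every vertex `z` the net current out of `z` along the edges
of `G` is `1_{z = x} - 1_{z = y}`. -/
def IsVoltage [Fintype α] (G : Graph α β) (x y : α) (φ : α → ℝ) : Prop :=
  ∀ z ∈ V(G), ∑ w, (mult G z w : ℝ) * (φ z - φ w) =
    (if z = x then 1 else 0) - (if z = y then 1 else 0)

open Classical in
/-- The transfer impedance `M(e, f)` of the oriented edges `e = (x, y)` and `f = (z, w)`: the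
voltage drop along `f` when a unit current runs from `x` to `y`. On a finite connected graph the
voltage exists and is unique up to an additive constant (`exists_isVoltage`,
`transferImpedance_eq`), and it is `D⁻¹ g` for the Green function `(I - A) g = δ_x - δ_y` of
simple random walk on any `D`-regular graph obtained by adding self-edges
(`isVoltage_iff_green`). -/
noncomputable def transferImpedance [Fintype α] (G : Graph α β) (x y z w : α) : ℝ :=
  if h : ∃ φ, IsVoltage G x y φ then h.choose z - h.choose w else 0

/-- The averaging operator `A` of simple random walk on the `D`-regular graph obtained from `G`
by giving every vertex `x` exactly `D - deg_*(x)` self-edges. -/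
noncomputable def averaging [Fintype α] (G : Graph α β) (D : ℕ) (f : α → ℝ) (x : α) : ℝ :=
  open Classical in
  (D : ℝ)⁻¹ * (∑ y ∈ Finset.univ.erase x, (mult G x y : ℝ) * f y
    + ((D : ℝ) - degStar G x) * f x)

/-- The set of (edge sets of) spanning trees of `G`. A set `T` of edges is a spanning tree if the
graph formed by all vertices of `G` and the edges in `T` has no self-edges, no parallel edges,
and is a tree. -/
def spanningTrees (G : Graph α β) : Set (Set β) :=
  {T | T ⊆ E(G) ∧ (G.restrict T).Simple ∧ (G.restrict T).toSimpleGraph.IsTree}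

/-- The probability that the uniform random spanning tree of `G` has the property `A`. -/
noncomputable def ustProb (G : Graph α β) (A : Set (Set β)) : ℝ :=
  ((spanningTrees G ∩ A).ncard : ℝ) / ((spanningTrees G).ncard : ℝ)

end Multigraph

/-! ### Truncations of rooted trees -/

/-- For a graph `H` rooted at `v`, the subgraph `H ∧ r` of the vertices connected to the root by a
path of length at most `r` is isomorphic to `t`, by an isomorphism that takes `v` to the
root `o` of `t`. -/
def TruncIso {W U : Type*} (H : SimpleGraph W) (v : W) (r : ℕ) (t : SimpleGraph U) (o : U) :
    Prop :=
  ∃ φ : H.induce {x | H.edist v x ≤ r} ≃g t, ((φ.symm o : {x | H.edist v x ≤ r}) : W) = v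

/-! ### The limit tree

The vertex `(i, u)` stands for the individual with address `u` in the branching process that
is attached to the vertex `x_i = (i, [])` of the infinite path; the children of `(i, u)` are
`(i, 0 :: u), (i, 1 :: u), …`. The number of children of `(i, u)` in the branching process is
`ξ (i, u)`. -/

/-- The individual with the given address is born in the `i`-th branching process. -/
def Born (ξ : ℕ × List ℕ → ℕ) (i : ℕ) : List ℕ → Prop
  | [] => True
  | j :: u => Born ξ i u ∧ j < ξ (i, u)

/-- The path and parent-child relations: `x_i` is joined to `x_{i+1}`, and every individual
to its children. -/
def Step (p q : ℕ × List ℕ) : Prop :=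
  (p.2 = [] ∧ q = (p.1 + 1, [])) ∨ ∃ j, q = (p.1, j :: p.2)

/-- The tree obtained from the path `x_0, x_1, …` by adding at each `x_i` the family tree of
the `i`-th branching process. -/
def sinTree (ξ : ℕ × List ℕ → ℕ) : SimpleGraph {p : ℕ × List ℕ // Born ξ p.1 p.2} :=
  SimpleGraph.fromRel fun p q => Step p.1 q.1

/-- The vertex `x_0`. -/
def sinRoot (ξ : ℕ × List ℕ → ℕ) : {p : ℕ × List ℕ // Born ξ p.1 p.2} := ⟨(0, []), trivial⟩

/-- All numbers of children are independent and Poisson with mean `1`. With this law of `ξ`, the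
tree `sinTree ξ` rooted at `sinRoot ξ` is the random tree `𝒫₁`. -/
noncomputable def offspringLaw : Measure (ℕ × List ℕ → ℕ) :=
  Measure.infinitePi fun _ => poissonMeasure 1

/-! ### The transfer impedance is well defined -/

section WellDefined

variable {α β : Type*}

theorem mult_comm (G : Graph α β) (x y : α) : mult G x y = mult G y x := by
  unfold mult
  congr 1
  ext e
  exact Graph.isLink_comm

theorem mult_eq_zero_of_left (G : Graph α β) {z : α} (hz : z ∉ V(G)) (w : α) :
    mult G z w = 0 := by
  have : {e | G.IsLink e z w} = ∅ := by
    ext e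
    simp only [Set.mem_ofPred_eq, Set.mem_empty_iff_false, iff_false]
    exact fun h => hz h.left_mem
  simp [mult, this]

variable [Fintype α]

theorem energy (G : Graph α β) (f g : α → ℝ) :
    ∑ z, f z * ∑ w, (mult G z w : ℝ) * (g z - g w) =
      2⁻¹ * ∑ z, ∑ w, (mult G z w : ℝ) * ((f z - f w) * (g z - g w)) := by
  have h1 : ∑ z, f z * ∑ w, (mult G z w : ℝ) * (g z - g w) =
      ∑ z, ∑ w, (mult G z w : ℝ) * (f z * (g z - g w)) := by
    refine Finset.sum_congr rfl fun z _ => ?_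
    rw [Finset.mul_sum]
    exact Finset.sum_congr rfl fun w _ => by ring
  have h2 : ∑ z, ∑ w, (mult G z w : ℝ) * (f z * (g z - g w)) =
      ∑ z, ∑ w, (mult G z w : ℝ) * (-f w * (g z - g w)) := by
    rw [Finset.sum_comm]
    refine Finset.sum_congr rfl fun z _ => Finset.sum_congr rfl fun w _ => ?_
    rw [mult_comm G w z]
    ring
  have h3 : ∑ z, ∑ w, (mult G z w : ℝ) * ((f z - f w) * (g z - g w)) =
      ∑ z, ∑ w, (mult G z w : ℝ) * (f z * (g z - g w)) +
      ∑ z, ∑ w, (mult G z w : ℝ) * (-f w * (g z - g w)) := by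
    rw [← Finset.sum_add_distrib]
    refine Finset.sum_congr rfl fun z _ => ?_
    rw [← Finset.sum_add_distrib]
    exact Finset.sum_congr rfl fun w _ => by ring
  rw [h1, h3, ← h2]
  ring

theorem const_of_harmonic [Finite β] (G : Graph α β) (hG : IsConnected G) (f : α → ℝ)
    (hf : ∀ z ∈ V(G), ∑ w, (mult G z w : ℝ) * (f z - f w) = 0) :
    ∀ a ∈ V(G), ∀ b ∈ V(G), f a = f b := by
  have h0 : ∑ z, f z * ∑ w, (mult G z w : ℝ) * (f z - f w) = 0 := by
    refine Finset.sum_eq_zero fun z _ => ?_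
    by_cases hz : z ∈ V(G)
    · rw [hf z hz, mul_zero]
    · simp [mult_eq_zero_of_left G hz]
  rw [energy] at h0
  have hnn : ∀ z w, 0 ≤ (mult G z w : ℝ) * ((f z - f w) * (f z - f w)) := fun z w =>
    mul_nonneg (Nat.cast_nonneg _) (mul_self_nonneg _)
  have h1 : ∑ z, ∑ w, (mult G z w : ℝ) * ((f z - f w) * (f z - f w)) = 0 := by linarith
  have h2 : ∀ z w, (mult G z w : ℝ) * ((f z - f w) * (f z - f w)) = 0 := by
    intro z w
    have := (Finset.sum_eq_zero_iff_of_nonneg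
      (fun z _ => Finset.sum_nonneg fun w _ => hnn z w)).1 h1 z (Finset.mem_univ _)
    exact (Finset.sum_eq_zero_iff_of_nonneg (fun w _ => hnn z w)).1 this w (Finset.mem_univ _)
  have h3 : ∀ a b : V(G), G.toSimpleGraph.Adj a b → f a = f b := by
    rintro a b ⟨-, e, he⟩
    have hm : (mult G a b : ℝ) ≠ 0 := by
      have : mult G a b ≠ 0 := by
        unfold mult
        exact (Set.ncard_pos (Set.toFinite _)).2 ⟨e, he⟩ |>.ne'
      exact_mod_cast this
    have := (mul_eq_zero.1 (h2 a b)).resolve_left hm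
    have := mul_self_eq_zero.1 this
    linarith
  intro a ha b hb
  obtain ⟨p⟩ := hG.preconnected ⟨a, ha⟩ ⟨b, hb⟩
  have key : ∀ {u v : V(G)}, G.toSimpleGraph.Walk u v → f u = f v := by
    intro u v p
    induction p with
    | nil => rfl
    | cons h _ ih => exact (h3 _ _ h).trans ih
  exact key p

/-- Voltages exist on a finite connected graph. -/
theorem exists_isVoltage [Finite β] (G : Graph α β) (hG : IsConnected G) {x y : α}
    (hx : x ∈ V(G)) (hy : y ∈ V(G)) : ∃ φ, IsVoltage G x y φ := by
  classical
  let L : EuclideanSpace ℝ α →ₗ[ℝ] EuclideanSpace ℝ α :=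
    { toFun := fun f => WithLp.toLp 2 fun z => ∑ w, (mult G z w : ℝ) * (f z - f w)
      map_add' := by
        intro f g
        ext z
        simp only [PiLp.add_apply]
        rw [← Finset.sum_add_distrib]
        exact Finset.sum_congr rfl fun w _ => by ring
      map_smul' := by
        intro c f
        ext z
        simp only [PiLp.smul_apply, smul_eq_mul, RingHom.id_apply]
        rw [Finset.mul_sum]
        exact Finset.sum_congr rfl fun w _ => by ring }
  have hL : ∀ f z, L f z = ∑ w, (mult G z w : ℝ) * (f z - f w) := fun _ _ => rfl
  have hsymm : L.IsSymmetric := by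
    intro f g
    simp only [PiLp.inner_apply, RCLike.inner_apply, conj_trivial, hL]
    rw [energy]
    rw [show ∑ z, (∑ w, (mult G z w : ℝ) * (g z - g w)) * f z =
      ∑ z, f z * ∑ w, (mult G z w : ℝ) * (g z - g w) from
        Finset.sum_congr rfl fun z _ => mul_comm _ _, energy]
    congr 1
    exact Finset.sum_congr rfl fun z _ => Finset.sum_congr rfl fun w _ => by ring
  let b : EuclideanSpace ℝ α :=
    WithLp.toLp 2 fun z => (if z = x then (1 : ℝ) else 0) - (if z = y then 1 else 0)
  have hb : b ∈ LinearMap.range L := by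
    have h1 : LinearMap.range L = (LinearMap.ker L)ᗮ := by
      rw [← hsymm.orthogonal_range, Submodule.orthogonal_orthogonal]
    rw [h1, Submodule.mem_orthogonal]
    intro f hf
    have hf' : ∀ z, ∑ w, (mult G z w : ℝ) * (f z - f w) = 0 := by
      intro z
      rw [← hL, LinearMap.mem_ker.1 hf]
      rfl
    have := const_of_harmonic G hG f (fun z _ => hf' z) x hx y hy
    simp only [PiLp.inner_apply, RCLike.inner_apply, conj_trivial, b]
    simp [sub_mul, Finset.sum_sub_distrib, this]
  obtain ⟨φ, hφ⟩ := hb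
  refine ⟨φ, fun z _ => ?_⟩
  rw [← hL, hφ]

/-- The transfer impedance can be computed from any voltage function. -/
theorem transferImpedance_eq [Finite β] (G : Graph α β) (hG : IsConnected G) {x y : α}
    {φ : α → ℝ} (hφ : IsVoltage G x y φ) {z w : α} (hz : z ∈ V(G)) (hw : w ∈ V(G)) :
    transferImpedance G x y z w = φ z - φ w := by
  have h : ∃ φ, IsVoltage G x y φ := ⟨φ, hφ⟩
  rw [transferImpedance, dif_pos h]
  have hc := h.choose_spec
  have := const_of_harmonic G hG (fun a => h.choose a - φ a) (fun a ha => by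
    have h1 := hc a ha
    have h2 := hφ a ha
    rw [← sub_eq_zero, ← h2, ← Finset.sum_sub_distrib] at h1
    rw [← h1]
    exact Finset.sum_congr rfl fun b _ => by ring) z hz w hw
  linarith

theorem degStar_eq_sum [Finite β] (G : Graph α β) (x : α) :
    open Classical in
    degStar G x = ∑ y ∈ Finset.univ.erase x, mult G x y := by
  classical
  have := Fintype.ofFinite β
  have h1 : {e | G.IsNonloopAt e x} =
      ((Finset.univ.erase x).biUnion fun y => Finset.univ.filter fun e => G.IsLink e x y :
        Finset β) := by
    ext e
    simp [Graph.IsNonloopAt]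
  rw [degStar, h1, Set.ncard_coe_finset, Finset.card_biUnion]
  · refine Finset.sum_congr rfl fun y _ => ?_
    rw [mult, ← Set.ncard_coe_finset]
    congr 1
    ext e
    simp
  · intro a _ b _ hab
    rw [Function.onFun, Finset.disjoint_left]
    intro e he he'
    simp only [Finset.mem_filter, Finset.mem_univ, true_and] at he he'
    exact hab (he.right_unique he')

open Classical in
/-- Voltages are `D⁻¹ g` where `(I - A) g = δ_x - δ_y`. -/
theorem isVoltage_iff_green [Finite β] (G : Graph α β) (D : ℕ) (hD : 0 < D) (x y : α)
    (g : α → ℝ) :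
    IsVoltage G x y (fun z => (D : ℝ)⁻¹ * g z) ↔
      ∀ z ∈ V(G), g z - averaging G D g z =
        (if z = x then 1 else 0) - (if z = y then 1 else 0) := by
  have hD' : (D : ℝ) ≠ 0 := by exact_mod_cast hD.ne'
  have key : ∀ z, ∑ w, (mult G z w : ℝ) * ((D : ℝ)⁻¹ * g z - (D : ℝ)⁻¹ * g w) =
      g z - averaging G D g z := by
    intro z
    rw [← Finset.add_sum_erase _ _ (Finset.mem_univ z), averaging, degStar_eq_sum]
    push_cast
    have : ∑ w ∈ Finset.univ.erase z,
        (mult G z w : ℝ) * ((D : ℝ)⁻¹ * g z - (D : ℝ)⁻¹ * g w) =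
        (D : ℝ)⁻¹ * ((∑ w ∈ Finset.univ.erase z, (mult G z w : ℝ)) * g z) -
        (D : ℝ)⁻¹ * ∑ w ∈ Finset.univ.erase z, (mult G z w : ℝ) * g w := by
      rw [Finset.sum_mul, ← mul_sub, ← Finset.sum_sub_distrib, Finset.mul_sum]
      exact Finset.sum_congr rfl fun w _ => by ring
    rw [this]
    field_simp
    ring
  unfold IsVoltage
  exact forall₂_congr fun z _ => by rw [key z]

end WellDefined

end USTLimit

/-!
The truncation of a tree at height `r` is detected by counting. Number the vertices of the finite
tree `t` by `0, …, m` from the root upwards, and call an embedding of `t` into a rooted tree *exact*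
if the image contains all neighbours of the images of the `s` vertices of depth less than `r`. The
number of exact embeddings is a constant `c > 0`, depending on `t` only, if the truncation is
isomorphic to `t`, and `0` otherwise (`ncard_isExact`). So it suffices that the mean number of exact
embeddings into the random spanning tree converges to that for the limit tree; both are
`e⁻ˢ (m + 1 - s)` in the limit.

For the spanning tree, the transfer current theorem `ncard_spanningTrees_mul_det`, a consequence of
the weighted matrix-tree theorem `det_weighted_laplacian`, expresses the mean number of all
embeddings of a tree with `m + 1` vertices as a sum over `m`-tuples of edges of determinants of
transfer impedances. By the assumption on the degrees there are about `k ^ m` tuples, and by the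
assumption on the impedances every determinant is about `k ^ (-m)` times the Gram determinant of
the tree, which is `m + 1` (`det_treeGram`). Hence the mean tends to `m + 1`
(`tendsto_ustMean_card_embeddings`). An embedding is exact if no vertex outside of it is adjacent
to the images of the `s` inner vertices. By inclusion–exclusion, in the form of Bonferroni's
inequalities, the number of exact embeddings is an alternating sum of the numbers of embeddings of
the trees obtained from `t` by attaching `j` leaves to inner vertices, so that the mean tends to
`∑ j, (-s) ^ j / j! * (m + 1 + j) = e⁻ˢ (m + 1 - s)` (`tendsto_ustMean_exactCount`).

In the limit tree, an exact embedding is determined by the vertex `w` of depth `r` that is mapped to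
the point `x_r` of the infinite path, of which there are `m + 1 - s`, and by an ordering of the
`c_i` children outside of the path to `w`, for every inner vertex `i`. Each of these `∏ i, c_i!`
choices gives an exact embedding exactly when the `s` inner vertices have the right numbers of
offspring, which has probability `∏ i, e⁻¹ / c_i!` (`integral_ncard_isSinExact`).
-/

namespace USTLimit

/-! ### The weighted Cauchy–Binet formula -/

/-- The sum is over all maps `f`, not over the subsets with `|n|` elements, each of which is the range
of `|n|!` injective maps; the maps that are not injective contribute `0`. -/
theorem factorial_mul_det_mul_diagonal_mul_transpose {n E R : Type*} [Fintype n] [DecidableEq n]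
    [Fintype E] [DecidableEq E] [CommRing R] (B : Matrix n E R) (w : E → R) :
    (((Fintype.card n).factorial : ℕ) : R) * (B * Matrix.diagonal w * B.transpose).det =
      ∑ f : n → E, (∏ i, w (f i)) * (B.submatrix id f).det ^ 2 := by
  have h1 : (B * Matrix.diagonal w * B.transpose).det =
      ∑ f : n → E, (∏ i, B i (f i)) * ((∏ i, w (f i)) * (B.submatrix id f).det) := by
    have : (B * Matrix.diagonal w * B.transpose) =
        fun i => ∑ e, (B i e * w e) • (fun j => B j e) := by
      ext i j
      simp [Matrix.mul_apply, Matrix.diagonal_apply, Finset.sum_apply]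
    rw [this]
    have h := (Matrix.detRowAlternating (n := n) (R := R)).toMultilinearMap.map_sum
      (fun (i : n) (e : E) => (B i e * w e) • (fun j => B j e))
    refine h.trans (Finset.sum_congr rfl fun f _ => ?_)
    have h2 := (Matrix.detRowAlternating (n := n) (R := R)).toMultilinearMap.map_smul_univ
      (fun i => B i (f i) * w (f i)) (fun i => fun j => B j (f i))
    refine h2.trans ?_
    rw [smul_eq_mul, Finset.prod_mul_distrib, mul_assoc, ← Matrix.det_transpose (B.submatrix id f)]
    rfl
  have h2 : ∀ σ : Equiv.Perm n, (B * Matrix.diagonal w * B.transpose).det =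
      ∑ f : n → E, (((Equiv.Perm.sign σ : ℤ) : R) * ∏ i, B i (f (σ i))) *
        ((∏ i, w (f i)) * (B.submatrix id f).det) := by
    intro σ
    rw [h1, ← (Equiv.arrowCongr σ.symm (Equiv.refl E)).sum_comp]
    refine Finset.sum_congr rfl fun f _ => ?_
    have e1 : ∏ i, w (f (σ i)) = ∏ i, w (f i) := Equiv.prod_comp σ (fun i => w (f i))
    have e2 : (B.submatrix id (fun i => f (σ i))).det =
        ((Equiv.Perm.sign σ : ℤ) : R) * (B.submatrix id f).det := by
      rw [← Matrix.det_permute' σ]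
      rfl
    change (∏ i, B i (f (σ i))) * ((∏ i, w (f (σ i))) * (B.submatrix id (fun i => f (σ i))).det) = _
    rw [e1, e2]
    ring
  have h3 : (((Fintype.card n).factorial : ℕ) : R) * (B * Matrix.diagonal w * B.transpose).det =
      ∑ _σ : Equiv.Perm n, (B * Matrix.diagonal w * B.transpose).det := by
    rw [Finset.sum_const, Finset.card_univ, Fintype.card_perm, nsmul_eq_mul]
  rw [h3, Finset.sum_congr rfl fun σ _ => h2 σ, Finset.sum_comm]
  refine Finset.sum_congr rfl fun f _ => ?_
  rw [← Finset.sum_mul]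
  have : (B.submatrix id f).det =
      ∑ σ : Equiv.Perm n, ((Equiv.Perm.sign σ : ℤ) : R) * ∏ i, B i (f (σ i)) := by
    rw [← Matrix.det_transpose, Matrix.det_apply']
    rfl
  rw [← this]
  ring

/-! ### Incidence matrices and spanning trees -/

section MatrixTree

variable {α β : Type*}

open Classical in
/-- The column of the edge `e` in the incidence matrix of `G`, every edge being oriented from `s e`
to `t e`. It vanishes for self-edges. -/
noncomputable def incidence (R : Type*) [Ring R] (G : Graph α β) (s t : β → α) (e : β) (x : α) : R :=
  if e ∈ E(G) then (if x = s e then 1 else 0) - (if x = t e then 1 else 0) else 0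

/-- The vertices of `G` other than `v`. -/
abbrev NonRoot (G : Graph α β) (v : α) : Type _ := {x : α // x ∈ V(G) ∧ x ≠ v}

noncomputable instance (G : Graph α β) (v : α) : DecidableEq (NonRoot G v) := Classical.decEq _

noncomputable instance [Fintype α] (G : Graph α β) (v : α) : Fintype (NonRoot G v) :=
  Fintype.ofFinite _

/-- The incidence matrix without the row of the vertex `v`. -/
noncomputable def reducedIncidence (R : Type*) [Ring R] (G : Graph α β) (s t : β → α) (v : α) :
    Matrix (NonRoot G v) β R :=
  fun x e => incidence R G s t e x

/-- Extension by `0` of a function on the vertices other than `v`. -/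
noncomputable def extendZero {R : Type*} [Zero R] (G : Graph α β) (v : α)
    (u : NonRoot G v → R) (x : α) : R :=
  open Classical in if h : x ∈ V(G) ∧ x ≠ v then u ⟨x, h⟩ else 0

/-- The simple graph on the vertices of `G` in which two distinct vertices are adjacent when they
are joined by an edge in `T`. -/
def underlying (G : Graph α β) (T : Set β) : SimpleGraph V(G) := (G.restrict T).toSimpleGraph

theorem adj_restrict_iff (G : Graph α β) (T : Set β) (x y : V(G)) :
    (underlying G T).Adj x y ↔ x ≠ y ∧ ∃ e ∈ T, G.IsLink e x y := Iff.rfl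

theorem ncard_edgeSet_eq {W : Type*} {P : W → Prop} (H : SimpleGraph {x // P x}) :
    (Sym2.map Subtype.val '' H.edgeSet).ncard = Nat.card H.edgeSet := by
  rw [Set.ncard_image_of_injective _ (Sym2.map.injective Subtype.val_injective)]
  rfl

theorem exists_isLink_of_mult_ne_zero (G : Graph α β) {x y : α} (h : mult G x y ≠ 0) :
    ∃ e, G.IsLink e x y := by
  by_contra! h0
  have : {e | G.IsLink e x y} = ∅ := Set.eq_empty_iff_forall_notMem.2 h0
  exact h (by rw [mult, this, Set.ncard_empty])

theorem exists_orientation (G : Graph α β) (v : α) :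
    ∃ s t : β → α, ∀ e ∈ E(G), G.IsLink e (s e) (t e) := by
  have : ∀ e : β, ∃ p : α × α, e ∈ E(G) → G.IsLink e p.1 p.2 := by
    intro e
    by_cases he : e ∈ E(G)
    · obtain ⟨x, y, h⟩ := Graph.exists_isLink_of_mem_edgeSet he
      exact ⟨(x, y), fun _ => h⟩
    · exact ⟨(v, v), fun h => absurd h he⟩
  choose p hp using this
  exact ⟨fun e => (p e).1, fun e => (p e).2, hp⟩

variable [Fintype α]

open Classical in
theorem sum_mul_incidence {R : Type*} [CommRing R] (G : Graph α β) {s t : β → α}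
    (hst : ∀ e ∈ E(G), G.IsLink e (s e) (t e)) (v : α)
    (u : NonRoot G v → R) {e : β} (he : e ∈ E(G)) :
    ∑ x, u x * reducedIncidence R G s t v x e =
      extendZero G v u (s e) - extendZero G v u (t e) := by
  have key : ∀ y, y ∈ V(G) → ∑ x : NonRoot G v, u x * (if (x : α) = y then 1 else 0) =
      extendZero G v u y := by
    intro y hy
    unfold extendZero
    split_ifs with h
    · rw [Finset.sum_eq_single ⟨y, h⟩]
      · simp
      · intro b _ hb
        rw [if_neg (fun hh => hb (Subtype.ext hh)), mul_zero]
      · simp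
    · refine Finset.sum_eq_zero fun x _ => ?_
      rw [if_neg, mul_zero]
      rintro rfl
      exact h x.2
  simp only [reducedIncidence, incidence, if_pos he, mul_sub, Finset.sum_sub_distrib]
  rw [key _ (hst e he).left_mem, key _ (hst e he).right_mem]

/-- For every prime `p`, a vector in the left kernel modulo `p` is constant along the edges, hence
zero; so no prime divides the determinant. -/
theorem det_sq_of_connected (G : Graph α β) {s t : β → α}
    (hst : ∀ e ∈ E(G), G.IsLink e (s e) (t e)) (v : V(G))
    (f : NonRoot G v → β)
    (hc : (underlying G (Set.range f)).Connected) :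
    ((reducedIncidence ℤ G s t v).submatrix id f).det ^ 2 = 1 := by
  classical
  have hp : ∀ p : ℕ, p.Prime → ¬ (p : ℤ) ∣ ((reducedIncidence ℤ G s t v).submatrix id f).det := by
    intro p hp hdvd
    have := Fact.mk hp
    have h0 : ((reducedIncidence (ZMod p) G s t v).submatrix id f).det = 0 := by
      rw [← (ZMod.intCast_zmod_eq_zero_iff_dvd _ p)] at hdvd
      rw [← hdvd, Int.cast_det]
      congr 1
      ext x e
      simp only [reducedIncidence, incidence, Matrix.map_apply, Matrix.submatrix_apply, id_eq]
      split_ifs <;> simp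
    obtain ⟨u, hu0, hu⟩ := Matrix.exists_vecMul_eq_zero_iff.2 h0
    have hadj : ∀ a b : V(G), (underlying G (Set.range f)).Adj a b →
        extendZero G v u a = extendZero G v u b := by
      intro a b hab
      obtain ⟨-, e, ⟨i, rfl⟩, hl⟩ := (adj_restrict_iff _ _ _ _).1 hab
      have h1 := congrFun hu i
      have h2 : extendZero G v u (s (f i)) - extendZero G v u (t (f i)) = 0 := by
        rw [← sum_mul_incidence G hst v u hl.edge_mem]
        exact h1
      rcases (hst _ hl.edge_mem).eq_and_eq_or_eq_and_eq hl with ⟨h3, h4⟩ | ⟨h3, h4⟩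
      · rw [← h3, ← h4]
        exact sub_eq_zero.1 h2
      · rw [← h3, ← h4]
        exact (sub_eq_zero.1 h2).symm
    have hconst : ∀ a b : V(G), extendZero G v u a = extendZero G v u b := by
      intro a b
      obtain ⟨w⟩ := hc.preconnected a b
      have key : ∀ {a b : V(G)}, (underlying G (Set.range f)).Walk a b →
          extendZero G v u a = extendZero G v u b := by
        intro a b w
        induction w with
        | nil => rfl
        | cons h _ ih => exact (hadj _ _ h).trans ih
      exact key w
    apply hu0
    ext x
    have h1 := hconst ⟨x, x.2.1⟩ v
    have h2 : extendZero G v u (v : α) = 0 := by simp [extendZero]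
    rw [h2] at h1
    simpa [extendZero, x.2.1, x.2.2] using h1
  set d := ((reducedIncidence ℤ G s t v).submatrix id f).det
  have h1 : d.natAbs = 1 := by
    by_contra h
    obtain ⟨p, hpp, hpd⟩ := Nat.exists_prime_and_dvd h
    exact hp p hpp (Int.natCast_dvd.2 hpd)
  rw [← Int.natAbs_sq, h1]
  rfl

/-- The indicator of the vertices that are not connected to the root is in the left kernel. -/
theorem det_eq_zero_of_not_connected (G : Graph α β) {s t : β → α}
    (hst : ∀ e ∈ E(G), G.IsLink e (s e) (t e)) (v : V(G))
    (f : NonRoot G v → β)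
    (hc : ¬ (underlying G (Set.range f)).Connected) :
    ((reducedIncidence ℤ G s t v).submatrix id f).det = 0 := by
  classical
  set H := underlying G (Set.range f) with hH
  have hx : ∃ x : V(G), ¬ H.Reachable v x := by
    by_contra! h
    refine hc ((SimpleGraph.connected_iff _).2 ⟨fun a b => ?_, ⟨v⟩⟩)
    exact (h a).symm.trans (h b)
  obtain ⟨x, hx⟩ := hx
  have hxv : (x : α) ≠ v := fun h => hx (Subtype.ext h ▸ SimpleGraph.Reachable.refl _)
  apply Matrix.exists_vecMul_eq_zero_iff.1
  refine ⟨fun y => if H.Reachable v ⟨y, y.2.1⟩ then 0 else 1, fun h0 => ?_, ?_⟩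
  · have := congrFun h0 ⟨x, x.2, hxv⟩
    simp [hx] at this
  · ext i
    by_cases he : f i ∈ E(G)
    · have h1 := sum_mul_incidence G hst v
        (fun y : NonRoot G v => if H.Reachable v ⟨y, y.2.1⟩ then (0 : ℤ) else 1) he
      refine h1.trans ?_
      have key : ∀ y : V(G), extendZero G (v : α) (fun y : NonRoot G v =>
          if H.Reachable v ⟨y, y.2.1⟩ then (0 : ℤ) else 1) y = if H.Reachable v y then 0 else 1 := by
        intro y
        unfold extendZero
        by_cases hy : (y : α) = v
        · have hy' : y = v := Subtype.ext hy
          subst hy'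
          simp
        · simp [hy]
      have hl := hst _ he
      have e1 := key ⟨s (f i), hl.left_mem⟩
      have e2 := key ⟨t (f i), hl.right_mem⟩
      simp only at e1 e2
      rw [e1, e2]
      have : H.Reachable v ⟨s (f i), hl.left_mem⟩ ↔ H.Reachable v ⟨t (f i), hl.right_mem⟩ := by
        by_cases hne : (⟨s (f i), hl.left_mem⟩ : V(G)) = ⟨t (f i), hl.right_mem⟩
        · rw [hne]
        · have : H.Adj ⟨s (f i), hl.left_mem⟩ ⟨t (f i), hl.right_mem⟩ :=
            ⟨hne, f i, ⟨i, rfl⟩, hl⟩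
          exact ⟨fun h => h.trans this.reachable, fun h => h.trans this.symm.reachable⟩
      simp [this]
    · change ∑ x, _ * reducedIncidence ℤ G s t v x (f i) = 0
      simp [reducedIncidence, incidence, he]

omit [Fintype α] in
/-- Every edge of the simple graph underlying `G.restrict T` comes from an edge in `T`. -/
theorem edgeSet_restrict_subset (G : Graph α β) (T : Set β) {s t : β → α}
    (hst : ∀ e ∈ E(G), G.IsLink e (s e) (t e)) :
    Sym2.map Subtype.val '' (underlying G T).edgeSet ⊆
      (fun e => s(s e, t e)) '' {e | e ∈ T ∧ e ∈ E(G) ∧ s e ≠ t e} := by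
  rintro _ ⟨z, hz, rfl⟩
  induction z with
  | h x y =>
    rw [SimpleGraph.mem_edgeSet] at hz
    obtain ⟨hne, e, heT, hl⟩ := (adj_restrict_iff _ _ _ _).1 hz
    have := (hst e hl.edge_mem).isLink_iff_sym2_eq.1 hl
    refine ⟨e, ⟨heT, hl.edge_mem, fun h => hne (Subtype.ext ?_)⟩, this⟩
    rw [h, Sym2.eq_iff] at this
    rcases this with ⟨h1, h2⟩ | ⟨h1, h2⟩
    · exact h1.symm.trans h2
    · exact h2.symm.trans h1

theorem card_vertices (G : Graph α β) (v : V(G)) :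
    Nat.card V(G) = Nat.card (NonRoot G v) + 1 := by
  have h : {x : α | x ∈ V(G) ∧ x ≠ v} = V(G) \ {(v : α)} := by ext; simp
  have h1 : Nat.card (NonRoot G v) = (V(G) \ {(v : α)}).ncard := by
    rw [← h]; rfl
  rw [h1, Set.ncard_sdiff_singleton_add_one v.2]
  rfl

/-- A set of at most `|V| - 1` edges that connects the graph is a spanning tree. -/
theorem mem_spanningTrees_of_connected [Finite β] (G : Graph α β) (v : V(G)) (T : Set β)
    (hc : (underlying G T).Connected)
    (hT : T.ncard ≤ Nat.card (NonRoot G v)) :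
    T ∈ spanningTrees G ∧ T.ncard = Nat.card (NonRoot G v) := by
  obtain ⟨s, t, hst⟩ := exists_orientation G v
  set H := underlying G T with hH
  set T' : Set β := {e | e ∈ T ∧ e ∈ E(G) ∧ s e ≠ t e} with hT'
  have h1 : Nat.card (NonRoot G v) ≤ Nat.card H.edgeSet := by
    have h := hc.card_vert_le_card_edgeSet_add_one
    have h' := card_vertices G v
    change Nat.card V(G) ≤ _ at h
    omega
  have h2 := ncard_edgeSet_eq H
  have h3 : (Sym2.map Subtype.val '' H.edgeSet).ncard ≤ ((fun e => s(s e, t e)) '' T').ncard :=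
    Set.ncard_le_ncard (edgeSet_restrict_subset G T hst) (Set.toFinite _)
  have h4 : ((fun e => s(s e, t e)) '' T').ncard ≤ T'.ncard := Set.ncard_image_le (Set.toFinite _)
  have h5 : T' ⊆ T := fun e he => he.1
  have h6 : T'.ncard ≤ T.ncard := Set.ncard_le_ncard h5 (Set.toFinite _)
  have h7 : T' = T := Set.eq_of_subset_of_ncard_le h5 (by omega) (Set.toFinite _)
  have h8 : Set.InjOn (fun e => s(s e, t e)) T' :=
    (Set.ncard_image_iff (Set.toFinite _)).1 (by omega)
  have hcard : Nat.card H.edgeSet + 1 = Nat.card V(G) := by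
    rw [card_vertices G v]
    omega
  refine ⟨⟨fun e he => ?_, ?_, ?_⟩, by omega⟩
  · rw [← h7] at he
    exact he.2.1
  · refine { not_isLoopAt := ?_, eq_of_isLink := ?_ }
    · rintro e x ⟨he, hl⟩
      rw [← h7] at he
      apply he.2.2
      rcases (hst e he.2.1).eq_and_eq_or_eq_and_eq hl with ⟨a, b⟩ | ⟨a, b⟩ <;> rw [a, b]
    · rintro e f x y ⟨he, hle⟩ ⟨hf, hlf⟩
      rw [← h7] at he hf
      refine h8 he hf ?_
      change s(s e, t e) = s(s f, t f)
      rw [(hst e he.2.1).isLink_iff_sym2_eq.1 hle, (hst f hf.2.1).isLink_iff_sym2_eq.1 hlf]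
  · have : Finite V((G.restrict T)) := inferInstanceAs (Finite V(G))
    exact SimpleGraph.isTree_iff_connected_and_card.2 ⟨hc, hcard⟩

/-- A spanning tree has `|V| - 1` edges. -/
theorem ncard_of_mem_spanningTrees [Finite β] (G : Graph α β) (v : V(G)) {T : Set β}
    (hT : T ∈ spanningTrees G) : T.ncard = Nat.card (NonRoot G v) := by
  obtain ⟨s, t, hst⟩ := exists_orientation G v
  obtain ⟨hTE, hs, ht⟩ := hT
  have : Finite V((G.restrict T)) := inferInstanceAs (Finite V(G))
  have h1 := (SimpleGraph.isTree_iff_connected_and_card.1 ht).2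
  change Nat.card (underlying G T).edgeSet + 1 = Nat.card V(G) at h1
  rw [card_vertices G v] at h1
  have hinj : Set.InjOn (fun e => s(s e, t e)) T := by
    intro e he f hf hef
    have hle : (G.restrict T).IsLink e (s e) (t e) := ⟨he, hst e (hTE he)⟩
    have hlf : (G.restrict T).IsLink f (s e) (t e) := by
      refine ⟨hf, (hst f (hTE hf)).isLink_iff_sym2_eq.2 hef.symm⟩
    exact hs.eq_of_isLink hle hlf
  have himg : (fun e => s(s e, t e)) '' T =
      Sym2.map Subtype.val '' (underlying G T).edgeSet := by
    apply Set.Subset.antisymm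
    · rintro _ ⟨e, he, rfl⟩
      have hl := hst e (hTE he)
      refine ⟨s(⟨s e, hl.left_mem⟩, ⟨t e, hl.right_mem⟩), ?_, rfl⟩
      rw [SimpleGraph.mem_edgeSet]
      refine (adj_restrict_iff _ _ _ _).2 ⟨fun h => ?_, e, he, hl⟩
      have h' : s e = t e := congrArg Subtype.val h
      refine hs.not_isLoopAt e (s e) ⟨he, ?_⟩
      nth_rewrite 2 [h']
      exact hl
    · refine (edgeSet_restrict_subset G T hst).trans (Set.image_mono fun e he => he.1)
  have h2 := ncard_edgeSet_eq (underlying G T)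
  rw [← hinj.ncard_image, himg]
  omega

open Classical in
/-- The squared maximal minors of the reduced incidence matrix are the indicators of the spanning
trees. -/
theorem det_sq_eq [Finite β] (G : Graph α β) {s t : β → α}
    (hst : ∀ e ∈ E(G), G.IsLink e (s e) (t e)) (v : V(G)) (f : NonRoot G v → β) :
    ((reducedIncidence ℝ G s t v).submatrix id f).det ^ 2 =
      if Set.range f ∈ spanningTrees G then 1 else 0 := by
  have hcast : ((reducedIncidence ℝ G s t v).submatrix id f).det =
      ((((reducedIncidence ℤ G s t v).submatrix id f).det : ℤ) : ℝ) := by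
    rw [Int.cast_det]
    congr 1
    ext x e
    simp only [reducedIncidence, incidence, Matrix.map_apply, Matrix.submatrix_apply, id_eq]
    split_ifs <;> simp
  rw [hcast]
  by_cases hc : (underlying G (Set.range f)).Connected
  · have h1 := det_sq_of_connected G hst v f hc
    have h2 := mem_spanningTrees_of_connected G v (Set.range f) hc (by
      rw [← Nat.card_univ (α := NonRoot G v), ← Set.image_univ, Nat.card_coe_set_eq]
      exact Set.ncard_image_le (Set.toFinite _))
    rw [if_pos h2.1]
    exact_mod_cast h1
  · rw [det_eq_zero_of_not_connected G hst v f hc, if_neg fun h => hc h.2.2.connected]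
    simp

theorem injective_of_range_mem [Finite β] (G : Graph α β) (v : V(G)) {T : Set β}
    (hT : T ∈ spanningTrees G) {f : NonRoot G v → β} (hf : Set.range f = T) :
    Function.Injective f := by
  have hc := ncard_of_mem_spanningTrees G v hT
  rw [← hf, ← Set.image_univ, ← Set.ncard_univ] at hc
  exact Set.injOn_univ.1 ((Set.ncard_image_iff (Set.toFinite _)).1 hc)

open Classical in
/-- A spanning tree is the range of `|n|!` maps, where `|n|` is the number of its edges. -/
theorem card_range_eq [Fintype β] (G : Graph α β) (v : V(G)) {T : Set β}
    (hT : T ∈ spanningTrees G) :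
    (Finset.univ.filter fun f : NonRoot G v → β => Set.range f = T).card =
      (Fintype.card (NonRoot G v)).factorial := by
  have hc := ncard_of_mem_spanningTrees G v hT
  have e0 : Fintype.card (NonRoot G v) = Fintype.card T := by
    rw [← Nat.card_eq_fintype_card, ← Nat.card_eq_fintype_card, ← hc]
    rfl
  rw [← Fintype.card_equiv (Fintype.equivOfCardEq e0), ← Finset.card_univ]
  symm
  refine Finset.card_bij (fun σ _ x => (σ x : β)) ?_ ?_ ?_
  · intro σ _
    simp only [Finset.mem_filter, Finset.mem_univ, true_and]
    ext e
    constructor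
    · rintro ⟨x, rfl⟩
      exact (σ x).2
    · intro he
      exact ⟨σ.symm ⟨e, he⟩, by simp⟩
  · intro σ _ τ _ h
    ext x
    exact congrFun h x
  · intro f hf
    simp only [Finset.mem_filter, Finset.mem_univ, true_and] at hf
    have hinj := injective_of_range_mem G v hT hf
    refine ⟨(Equiv.ofInjective f hinj).trans (Equiv.setCongr hf), Finset.mem_univ _, ?_⟩
    ext x
    rfl

/-- Kirchhoff's theorem, with weighted edges. -/
theorem det_weighted_laplacian [Fintype β] [DecidableEq β] (G : Graph α β) {s t : β → α}
    (hst : ∀ e ∈ E(G), G.IsLink e (s e) (t e)) (v : V(G)) (w : β → ℝ) :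
    (reducedIncidence ℝ G s t v * Matrix.diagonal w * (reducedIncidence ℝ G s t v).transpose).det =
      ∑ T ∈ (Set.toFinite (spanningTrees G)).toFinset, ∏ e ∈ (Set.toFinite T).toFinset, w e := by
  classical
  have h := factorial_mul_det_mul_diagonal_mul_transpose (reducedIncidence ℝ G s t v) w
  have hn : (((Fintype.card (NonRoot G v)).factorial : ℕ) : ℝ) ≠ 0 := by
    exact_mod_cast Nat.factorial_ne_zero _
  apply mul_left_cancel₀ hn
  rw [h, Finset.mul_sum]
  simp_rw [det_sq_eq G hst v]
  have h2 : ∀ f : NonRoot G v → β, (∏ i, w (f i)) *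
      (if Set.range f ∈ spanningTrees G then (1 : ℝ) else 0) =
      ∑ T ∈ (Set.toFinite (spanningTrees G)).toFinset,
        if Set.range f = T then ∏ i, w (f i) else 0 := by
    intro f
    rw [Finset.sum_ite_eq]
    simp
  rw [Finset.sum_congr rfl fun f _ => h2 f, Finset.sum_comm]
  refine Finset.sum_congr rfl fun T hT => ?_
  have hT' : T ∈ spanningTrees G := by simpa using hT
  rw [← Finset.sum_filter, ← card_range_eq G v hT', ← nsmul_eq_mul]
  refine Finset.sum_eq_card_nsmul fun f hf => ?_
  simp only [Finset.mem_filter, Finset.mem_univ, true_and] at hf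
  have hinj := injective_of_range_mem G v hT' hf
  have : (Set.toFinite T).toFinset = Finset.univ.image f := by
    ext e
    simp [← hf]
  rw [this, Finset.prod_image fun x _ y _ hxy => hinj hxy]

/-! ### The transfer current theorem -/

/-- The graph Laplacian with the row and column of `v` removed. -/
noncomputable def reducedLaplacian [Fintype β] (G : Graph α β) (s t : β → α) (v : α) :
    Matrix (NonRoot G v) (NonRoot G v) ℝ :=
  reducedIncidence ℝ G s t v * (reducedIncidence ℝ G s t v).transpose

open Classical in
/-- The product of the incidence matrix and its transpose is the Laplacian. -/
theorem sum_incidence_mul_sub [Fintype β] (G : Graph α β) {s t : β → α}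
    (hst : ∀ e ∈ E(G), G.IsLink e (s e) (t e)) (φ : α → ℝ) (z : α) :
    ∑ e, incidence ℝ G s t e z * (if e ∈ E(G) then φ (s e) - φ (t e) else 0) =
      ∑ w, (mult G z w : ℝ) * (φ z - φ w) := by
  classical
  have h1 : ∀ w, (mult G z w : ℝ) * (φ z - φ w) =
      ∑ e, if G.IsLink e z w then φ z - φ w else 0 := by
    intro w
    rw [← Finset.sum_filter, Finset.sum_const, nsmul_eq_mul, mult, ← Set.ncard_coe_finset]
    simp
  rw [Finset.sum_congr rfl fun w _ => h1 w, Finset.sum_comm]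
  refine Finset.sum_congr rfl fun e _ => ?_
  by_cases he : e ∈ E(G)
  · have hl := hst e he
    simp only [incidence, if_pos he]
    by_cases hs : z = s e
    · have : ∀ w, G.IsLink e z w ↔ w = t e := fun w => by
        rw [hs]; exact hl.isLink_iff_eq
      simp only [this, Finset.sum_ite_eq', Finset.mem_univ, if_true]
      by_cases ht : z = t e
      · rw [← ht, ← hs]; simp
      · rw [if_pos hs, if_neg ht, hs]; simp
    · by_cases ht : z = t e
      · have : ∀ w, G.IsLink e z w ↔ w = s e := fun w => by
          rw [ht]; exact hl.symm.isLink_iff_eq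
        simp only [this, Finset.sum_ite_eq', Finset.mem_univ, if_true]
        rw [if_neg hs, if_pos ht, ht]; ring
      · rw [if_neg hs, if_neg ht, sub_zero, zero_mul]
        symm
        refine Finset.sum_eq_zero fun w _ => if_neg fun h => ?_
        rcases h.left_eq_or_eq hl with h | h
        · exact hs h
        · exact ht h
  · simp [he]

theorem reducedLaplacian_mulVec [Fintype β] (G : Graph α β) {s t : β → α}
    (hst : ∀ e ∈ E(G), G.IsLink e (s e) (t e)) (v : V(G)) (u : NonRoot G v → ℝ)
    (z : NonRoot G v) :
    (reducedLaplacian G s t v).mulVec u z =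
      ∑ w, (mult G z w : ℝ) * (extendZero G v u z - extendZero G v u w) := by
  classical
  rw [← sum_incidence_mul_sub G hst, reducedLaplacian, ← Matrix.mulVec_mulVec]
  change ∑ e, _ = _
  refine Finset.sum_congr rfl fun e _ => ?_
  by_cases he : e ∈ E(G)
  · rw [if_pos he, ← sum_mul_incidence G hst v u he]
    congr 1
    change ∑ x, _ = _
    exact Finset.sum_congr rfl fun x _ => mul_comm _ _
  · simp [reducedIncidence, incidence, he]

theorem sum_laplacian_eq_zero (G : Graph α β) (φ : α → ℝ) :
    ∑ z, ∑ w, (mult G z w : ℝ) * (φ z - φ w) = 0 := by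
  simpa using energy G (fun _ => 1) φ

/-- Kirchhoff's law at the root follows from that at all other vertices. -/
theorem laplacian_root (G : Graph α β) (v : V(G)) (φ : α → ℝ) :
    ∑ w, (mult G v w : ℝ) * (φ v - φ w) =
      - ∑ z : NonRoot G v, ∑ w, (mult G z w : ℝ) * (φ z - φ w) := by
  classical
  have h := sum_laplacian_eq_zero G φ
  rw [← Finset.add_sum_erase _ _ (Finset.mem_univ (v : α))] at h
  have h2 : ∑ z ∈ Finset.univ.erase (v : α), ∑ w, (mult G z w : ℝ) * (φ z - φ w) =
      ∑ z : NonRoot G v, ∑ w, (mult G z w : ℝ) * (φ z - φ w) := by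
    rw [← Finset.sum_subset (s₁ := Finset.univ.filter fun x => x ∈ V(G) ∧ x ≠ v)]
    · exact Finset.sum_subtype _ (by simp) _
    · intro x hx
      simp only [Finset.mem_filter, Finset.mem_univ, true_and] at hx
      simp [hx.2]
    · intro x hx hx'
      simp only [Finset.mem_erase, Finset.mem_univ, and_true] at hx
      simp only [Finset.mem_filter, Finset.mem_univ, true_and, not_and, not_not] at hx'
      refine Finset.sum_eq_zero fun w _ => ?_
      rw [mult_eq_zero_of_left G fun h => hx (hx' h)]
      simp
  linarith

theorem det_reducedLaplacian_ne_zero [Fintype β] (G : Graph α β) (hG : IsConnected G)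
    {s t : β → α} (hst : ∀ e ∈ E(G), G.IsLink e (s e) (t e)) (v : V(G)) :
    (reducedLaplacian G s t v).det ≠ 0 := by
  intro h0
  obtain ⟨u, hu0, hu⟩ := Matrix.exists_mulVec_eq_zero_iff.2 h0
  have hz : ∀ z : NonRoot G v,
      ∑ w, (mult G z w : ℝ) * (extendZero G v u z - extendZero G v u w) = 0 := by
    intro z
    rw [← reducedLaplacian_mulVec G hst v u z, hu]
    rfl
  have h := const_of_harmonic G hG (extendZero G v u) (by
    intro z hzG
    by_cases hzv : z = v
    · rw [hzv, laplacian_root, Finset.sum_eq_zero fun z _ => hz z, neg_zero]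
    · exact hz ⟨z, hzG, hzv⟩)
  apply hu0
  ext x
  have h1 := h x x.2.1 v v.2
  have h2 : extendZero G v u (v : α) = 0 := by simp [extendZero]
  rw [h2] at h1
  simpa [extendZero, x.2.1, x.2.2] using h1

/-- The columns of the incidence matrix, hit by the inverse Laplacian, are voltages. -/
theorem transferImpedance_eq_inv [Fintype β] (G : Graph α β) (hG : IsConnected G)
    {s t : β → α} (hst : ∀ e ∈ E(G), G.IsLink e (s e) (t e)) (v : V(G)) {e f : β}
    (he : e ∈ E(G)) (hf : f ∈ E(G)) :
    ((reducedIncidence ℝ G s t v).transpose * (reducedLaplacian G s t v)⁻¹ *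
      reducedIncidence ℝ G s t v) f e = transferImpedance G (s e) (t e) (s f) (t f) := by
  classical
  set b : NonRoot G v → ℝ := fun x => reducedIncidence ℝ G s t v x e with hb
  set u : NonRoot G v → ℝ := (reducedLaplacian G s t v)⁻¹.mulVec b with hu
  have hdet : IsUnit (reducedLaplacian G s t v).det :=
    (det_reducedLaplacian_ne_zero G hG hst v).isUnit
  have hLu : (reducedLaplacian G s t v).mulVec u = b := by
    rw [hu, Matrix.mulVec_mulVec, Matrix.mul_nonsing_inv _ hdet, Matrix.one_mulVec]
  have hbe : ∀ z : NonRoot G v, b z = (if (z : α) = s e then 1 else 0) -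
      (if (z : α) = t e then 1 else 0) := by
    intro z
    simp only [hb, reducedIncidence, incidence, if_pos he]
  have hrow : ∀ z : NonRoot G v, ∑ w, (mult G z w : ℝ) *
      (extendZero G v u z - extendZero G v u w) = (if (z : α) = s e then 1 else 0) -
      (if (z : α) = t e then 1 else 0) := by
    intro z
    rw [← reducedLaplacian_mulVec G hst v u z, hLu, hbe]
  have hl := hst e he
  have hvolt : IsVoltage G (s e) (t e) (extendZero G v u) := by
    intro z hz
    by_cases hzv : z = v
    · subst hzv
      rw [laplacian_root, Finset.sum_congr rfl fun z _ => hrow z, Finset.sum_sub_distrib]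
      have key : ∀ y ∈ V(G), ∑ z : NonRoot G v, (if (z : α) = y then (1 : ℝ) else 0) =
          1 - if (v : α) = y then 1 else 0 := by
        intro y hy
        by_cases h : (v : α) = y
        · rw [if_pos h, sub_self]
          exact Finset.sum_eq_zero fun z _ => if_neg fun hzy => z.2.2 (hzy.trans h.symm)
        · rw [if_neg h, sub_zero, Finset.sum_eq_single ⟨y, hy, fun hh => h hh.symm⟩]
          · simp
          · intro z _ hz
            exact if_neg fun hzy => hz (Subtype.ext hzy)
          · simp
      rw [key _ hl.left_mem, key _ hl.right_mem]
      ring_nf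
    · convert hrow ⟨z, hz, hzv⟩
  rw [transferImpedance_eq G hG hvolt (hst f hf).left_mem (hst f hf).right_mem,
    ← sum_mul_incidence G hst v u hf, Matrix.mul_assoc]
  change ∑ x, _ = _
  refine Finset.sum_congr rfl fun x _ => ?_
  rw [mul_comm]
  rfl

open Classical in
/-- Giving the edges `a i` the conductance `x` yields the generating function of the number of
these edges in a spanning tree. -/
theorem sum_pow_eq_det [Fintype β] (G : Graph α β) (hG : IsConnected G)
    {s t : β → α} (hst : ∀ e ∈ E(G), G.IsLink e (s e) (t e)) (v : V(G))
    {ι : Type*} [Fintype ι] [DecidableEq ι] (a : ι → β)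
    (ha : Function.Injective a) (c : ℝ) :
    ∑ T ∈ (Set.toFinite (spanningTrees G)).toFinset,
        c ^ (Finset.univ.filter fun i => a i ∈ T).card =
      (reducedLaplacian G s t v).det * (1 + (c - 1) •
        ((reducedIncidence ℝ G s t v).transpose * (reducedLaplacian G s t v)⁻¹ *
          reducedIncidence ℝ G s t v).submatrix a a).det := by
  set B := reducedIncidence ℝ G s t v with hB
  set L := reducedLaplacian G s t v with hL
  set A := B.submatrix id a with hA
  set w : β → ℝ := fun e => if e ∈ Set.range a then c else 1 with hw
  have hdet : IsUnit L.det := (det_reducedLaplacian_ne_zero G hG hst v).isUnit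
  have h1 : B * Matrix.diagonal w * B.transpose = L + (c - 1) • (A * A.transpose) := by
    ext i j
    have h0 : (B * Matrix.diagonal w * B.transpose) i j = ∑ e, B i e * w e * B j e := by
      rw [Matrix.mul_apply]
      simp only [Matrix.mul_diagonal, Matrix.transpose_apply]
    have h2 : ∀ e, B i e * w e * B j e =
        B i e * B j e + if e ∈ Finset.univ.image a then (c - 1) * (B i e * B j e) else 0 := by
      intro e
      by_cases he : e ∈ Set.range a
      · rw [if_pos (by simpa using he)]
        simp only [hw, if_pos he]
        ring
      · rw [if_neg (by simpa using he)]
        simp only [hw, if_neg he]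
        ring
    rw [h0, Finset.sum_congr rfl fun e _ => h2 e, Finset.sum_add_distrib, ← Finset.sum_filter,
      Finset.filter_mem_eq_inter, Finset.univ_inter, Finset.sum_image fun x _ y _ h => ha h,
      ← Finset.mul_sum]
    rfl
  have h3 : (L + (c - 1) • (A * A.transpose)).det =
      L.det * (1 + (c - 1) • (A.transpose * L⁻¹ * A)).det := by
    have : L + (c - 1) • (A * A.transpose) = L * (1 + (L⁻¹ * A) * ((c - 1) • A.transpose)) := by
      rw [Matrix.mul_add, Matrix.mul_one, ← Matrix.mul_assoc, ← Matrix.mul_assoc,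
        Matrix.mul_nonsing_inv _ hdet, Matrix.one_mul, Matrix.mul_smul]
    rw [this, Matrix.det_mul, Matrix.det_one_add_mul_comm, Matrix.smul_mul, Matrix.mul_assoc]
  have h4 : (B.transpose * L⁻¹ * B).submatrix a a = A.transpose * L⁻¹ * A := by
    ext i j
    simp [Matrix.mul_apply, hA]
  rw [h4, ← h3, ← h1, det_weighted_laplacian G hst v w]
  refine Finset.sum_congr rfl fun T _ => ?_
  rw [← Finset.prod_filter_mul_prod_filter_not _ (fun e => e ∈ Set.range a)]
  rw [Finset.prod_eq_pow_card (b := c) (fun e he => if_pos (Finset.mem_filter.1 he).2),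
    Finset.prod_eq_one (fun e he => if_neg (Finset.mem_filter.1 he).2), mul_one]
  congr 1
  rw [← Finset.card_image_of_injective _ ha]
  congr 1
  ext e
  simp only [Finset.mem_image, Finset.mem_filter, Finset.mem_univ, true_and,
    Set.Finite.mem_toFinset, Set.mem_range]
  constructor
  · rintro ⟨i, hi, rfl⟩
    exact ⟨hi, i, rfl⟩
  · rintro ⟨hi, i, rfl⟩
    exact ⟨i, hi, rfl⟩

theorem ncard_spanningTrees_ne_zero [Finite β] (G : Graph α β) (hG : IsConnected G) :
    (spanningTrees G).ncard ≠ 0 := by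
  have := Fintype.ofFinite β
  obtain ⟨v⟩ := hG.nonempty
  obtain ⟨s, t, hst⟩ := exists_orientation G (v : α)
  have h := sum_pow_eq_det G hG hst v (Fin.elim0 : Fin 0 → β) (fun i => i.elim0) 1
  simp only [one_pow, Finset.sum_const, nsmul_eq_mul, mul_one, Matrix.det_isEmpty] at h
  rw [Set.ncard_eq_toFinset_card _ (Set.toFinite _)]
  have h2 := det_reducedLaplacian_ne_zero G hG hst v
  rw [← h] at h2
  exact_mod_cast h2

/-- The transfer current theorem. -/
theorem ncard_spanningTrees_mul_det [Finite β] (G : Graph α β) (hG : IsConnected G)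
    {ι : Type*} [Fintype ι] [DecidableEq ι] (a : ι → β) (ha : Function.Injective a) (x y : ι → α)
    (hl : ∀ i, G.IsLink (a i) (x i) (y i)) :
    ({T ∈ spanningTrees G | ∀ i, a i ∈ T}.ncard : ℝ) = (spanningTrees G).ncard *
      (Matrix.of fun i j => transferImpedance G (x i) (y i) (x j) (y j)).det := by
  classical
  have := Fintype.ofFinite β
  obtain ⟨v⟩ := hG.nonempty
  obtain ⟨s₀, t₀, hst₀⟩ := exists_orientation G (v : α)
  set s := Function.extend a x s₀ with hs
  set t := Function.extend a y t₀ with ht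
  have hsa : ∀ i, s (a i) = x i := fun i => ha.extend_apply x s₀ i
  have hta : ∀ i, t (a i) = y i := fun i => ha.extend_apply y t₀ i
  have hst : ∀ e ∈ E(G), G.IsLink e (s e) (t e) := by
    intro e he
    by_cases h : ∃ i, a i = e
    · obtain ⟨i, rfl⟩ := h
      rw [hsa, hta]
      exact hl i
    · rw [hs, ht, Function.extend_apply' _ _ _ h, Function.extend_apply' _ _ _ h]
      exact hst₀ e he
  set 𝒯 := (Set.toFinite (spanningTrees G)).toFinset with h𝒯
  set K := ((reducedIncidence ℝ G s t v).transpose * (reducedLaplacian G s t v)⁻¹ *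
          reducedIncidence ℝ G s t v).submatrix a a with hK
  have hKM : K.transpose =
      Matrix.of fun i j => transferImpedance G (x i) (y i) (x j) (y j) := by
    ext i j
    rw [Matrix.transpose_apply, hK, Matrix.submatrix_apply,
      transferImpedance_eq_inv G hG hst v (hl i).edge_mem (hl j).edge_mem, hsa, hta, hsa, hta]
    rfl
  have hpow := sum_pow_eq_det G hG hst v a ha
  set d := (reducedLaplacian G s t v).det with hd
  have hd1 : d = (spanningTrees G).ncard := by
    have := hpow 1
    simp only [one_pow, Finset.sum_const, sub_self, zero_smul, add_zero, Matrix.det_one, mul_one,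
      nsmul_eq_mul] at this
    rw [← this, Set.ncard_eq_toFinset_card _ (Set.toFinite _)]
  -- Comparing the coefficients of the highest possible degree singles out the trees that contain
  -- all the edges `a i`.
  have hpoly : (∑ T ∈ 𝒯, Polynomial.X ^ (Finset.univ.filter fun i => a i ∈ T).card :
      Polynomial ℝ) = Polynomial.C d *
        ((Polynomial.X : Polynomial ℝ) • K.map Polynomial.C + (1 - K).map Polynomial.C).det := by
    refine Polynomial.funext fun c => ?_
    rw [Polynomial.eval_finsetSum, Polynomial.eval_mul, Polynomial.eval_C,
      ← Polynomial.coe_evalRingHom, RingHom.map_det]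
    simp only [Polynomial.coe_evalRingHom, Polynomial.eval_pow, Polynomial.eval_X]
    rw [hpow c, ← hK]
    congr 2
    ext i j
    by_cases hij : i = j
    · subst hij
      simp
      ring
    · simp [hij]
      ring
  have hcoeff := congrArg (fun p => p.coeff (Fintype.card ι)) hpoly
  simp only [Polynomial.coeff_C_mul, Polynomial.coeff_det_X_add_C_card] at hcoeff
  rw [← hKM, Matrix.det_transpose, ← hd1, ← hcoeff, Polynomial.finsetSum_coeff]
  simp only [Polynomial.coeff_X_pow]
  rw [Finset.sum_boole, Set.ncard_eq_toFinset_card _ (Set.toFinite _)]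
  congr 2
  ext T
  simp only [Set.Finite.mem_toFinset, Set.mem_sep_iff, Finset.mem_filter, h𝒯]
  refine and_congr_right fun _ => ?_
  rw [eq_comm, ← Finset.card_univ, Finset.card_filter_eq_iff]
  simp

end MatrixTree

/-! ### Asymptotics of transfer impedances -/

section Asymptotics

variable {α β : Type*} [Fintype α]

open Classical in
/-- The inner product of the coboundaries `δ_x - δ_y` and `δ_z - δ_w`, a signed version of
`|e ∩ f|` for the oriented edges `e = (x, y)` and `f = (z, w)`. -/
noncomputable def crossing {γ : Type*} (x y z w : γ) : ℝ :=
  (if x = z then 1 else 0) + (if y = w then 1 else 0) - (if x = w then 1 else 0) -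
    (if y = z then 1 else 0)

theorem crossing_eq_ncard {γ : Type*} {x y z w : γ} (hxy : x ≠ y) (hzw : z ≠ w) (hxw : x ≠ w)
    (hyz : y ≠ z) : (({x, y} ∩ {z, w} : Set γ).ncard : ℝ) = crossing x y z w := by
  by_cases hxz : x = z
  · subst hxz
    by_cases hyw : y = w
    · subst hyw
      rw [Set.inter_self, Set.ncard_pair hxy]
      simp [crossing, hxy, hxy.symm]
      norm_num
    · have : ({x, y} ∩ {x, w} : Set γ) = {x} := by
        ext a; simp only [Set.mem_inter_iff, Set.mem_insert_iff, Set.mem_singleton_iff]; grind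
      rw [this, Set.ncard_singleton]
      simp [crossing, hyw, hxw, hyz]
  · by_cases hyw : y = w
    · subst hyw
      have : ({x, y} ∩ {z, y} : Set γ) = {y} := by
        ext a; simp only [Set.mem_inter_iff, Set.mem_insert_iff, Set.mem_singleton_iff]; grind
      rw [this, Set.ncard_singleton]
      simp [crossing, hxw, hyz, hxz]
    · have : ({x, y} ∩ {z, w} : Set γ) = ∅ := by
        ext a
        simp only [Set.mem_inter_iff, Set.mem_insert_iff, Set.mem_singleton_iff,
          Set.mem_empty_iff_false]
        grind
      rw [this, Set.ncard_empty]
      simp [crossing, hyw, hxw, hyz, hxz]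

theorem crossing_swap {γ : Type*} (x y z w : γ) : crossing x y w z = -crossing x y z w := by
  unfold crossing; ring

theorem transferImpedance_swap (G : Graph α β) (x y z w : α) :
    transferImpedance G x y w z = -transferImpedance G x y z w := by
  unfold transferImpedance
  split_ifs
  · ring
  · simp

/-- The degrees and transfer impedances of `G` are within relative error `ε` of those in the
hypotheses of the limit theorem. -/
structure IsNear (G : Graph α β) (k : ℕ) (ε : ℝ) : Prop where
  deg : ∀ x ∈ V(G), |(degStar G x : ℝ) - k| ≤ ε * k
  imp : ∀ (e f : β) (x y z w : α), G.IsLink e x y → G.IsLink f z w → x ≠ y → z ≠ w → x ≠ w →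
    y ≠ z → |(k : ℝ) * transferImpedance G x y z w - ((({x, y} : Set α) ∩ {z, w}).ncard : ℝ)| ≤ ε

theorem IsNear.imp_crossing {G : Graph α β} {k : ℕ} {ε : ℝ} (h : IsNear G k ε) {e f : β}
    {x y z w : α} (he : G.IsLink e x y) (hf : G.IsLink f z w) (hxy : x ≠ y) (hzw : z ≠ w) :
    |(k : ℝ) * transferImpedance G x y z w - crossing x y z w| ≤ ε := by
  by_cases hc : x ≠ w ∧ y ≠ z
  · rw [← crossing_eq_ncard hxy hzw hc.1 hc.2]
    exact h.imp e f x y z w he hf hxy hzw hc.1 hc.2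
  · have h1 : x ≠ z := by
      rintro rfl
      exact hc ⟨hzw, hxy.symm⟩
    have h2 : y ≠ w := by
      rintro rfl
      exact hc ⟨hxy, hzw.symm⟩
    have := h.imp e f x y w z he hf.symm hxy hzw.symm h1 h2
    rw [crossing_eq_ncard hxy hzw.symm h1 h2, crossing_swap, transferImpedance_swap] at this
    rw [← abs_neg]
    convert this using 2
    ring

/-- Few edges are parallel: the current through the edges at `x`, when a unit current runs from
`x` to `y`, would exceed `1` otherwise. -/
theorem IsNear.mult_le [Finite β] {G : Graph α β} (hG : IsConnected G) {k : ℕ} {ε : ℝ}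
    (h : IsNear G k ε) (hε : 0 ≤ ε) (hε1 : ε ≤ 1) {x y : α} (hxy : x ≠ y) :
    (mult G x y : ℝ) ≤ 2 * ε * k := by
  classical
  have hk : (0 : ℝ) ≤ k := Nat.cast_nonneg k
  by_cases hm : mult G x y = 0
  · rw [hm, Nat.cast_zero]
    positivity
  obtain ⟨e, he⟩ := exists_isLink_of_mult_ne_zero G hm
  obtain ⟨φ, hφ⟩ := exists_isVoltage G hG he.left_mem he.right_mem
  have h1 := hφ x he.left_mem
  rw [if_pos rfl, if_neg hxy, sub_zero] at h1
  rw [← Finset.add_sum_erase _ _ (Finset.mem_univ x), sub_self, mul_zero, zero_add] at h1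
  have h2 : ∀ w ∈ Finset.univ.erase x,
      (mult G x w : ℝ) * (1 - ε) + (if w = y then (mult G x w : ℝ) else 0) ≤
        k * ((mult G x w : ℝ) * (φ x - φ w)) := by
    intro w hw
    have hwx : w ≠ x := (Finset.mem_erase.1 hw).1
    by_cases hm : mult G x w = 0
    · simp [hm]
    obtain ⟨f, hf⟩ := exists_isLink_of_mult_ne_zero G hm
    have h3 := h.imp_crossing he hf hxy hwx.symm
    rw [transferImpedance_eq G hG hφ hf.left_mem hf.right_mem] at h3
    have h4 : crossing x y x w = 1 + if w = y then 1 else 0 := by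
      simp [crossing, hwx.symm, hxy.symm, eq_comm]
    rw [h4] at h3
    have h5 := (abs_le.1 h3).1
    have h6 : (mult G x w : ℝ) * (1 - ε) + (if w = y then (mult G x w : ℝ) else 0) =
        (mult G x w : ℝ) * ((1 + if w = y then 1 else 0) - ε) := by
      split_ifs <;> ring
    rw [h6]
    have : (mult G x w : ℝ) * ((1 + if w = y then 1 else 0) - ε) ≤
        (mult G x w : ℝ) * (k * (φ x - φ w)) :=
      mul_le_mul_of_nonneg_left (by linarith) (Nat.cast_nonneg _)
    linarith
  have h3 := Finset.sum_le_sum h2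
  rw [← Finset.mul_sum, h1, Finset.sum_add_distrib, ← Finset.sum_mul, Finset.sum_ite_eq',
    if_pos (Finset.mem_erase.2 ⟨hxy.symm, Finset.mem_univ y⟩)] at h3
  have h4 : (∑ w ∈ Finset.univ.erase x, (mult G x w : ℝ)) = degStar G x := by
    rw [degStar_eq_sum]
    push_cast
    rfl
  rw [h4] at h3
  have h5 := (abs_le.1 (h.deg x he.left_mem)).1
  have h6 : (k * (1 - ε)) * (1 - ε) ≤ (degStar G x : ℝ) * (1 - ε) :=
    mul_le_mul_of_nonneg_right (by linarith) (by linarith)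
  nlinarith [mul_nonneg hk (mul_nonneg hε hε)]

/-! ### The Gram matrix of a tree -/

/-- The tree on the vertices `0, …, m` in which the parent of `i + 1` is `p i` has the Gram matrix
`crossing` of its oriented incidence vectors. -/
noncomputable def treeGram (p : ℕ → ℕ) (m : ℕ) : Matrix (Fin m) (Fin m) ℝ :=
  Matrix.of fun i j => crossing ((i : ℕ) + 1) (p i) ((j : ℕ) + 1) (p j)

/-- The Gram matrix of a tree is `Rᵀ (1 + J) R`, where `R` is the incidence matrix without the row of
the root, which is unitriangular, and `J` is the all-ones matrix, which accounts for that row as the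
columns of the incidence matrix have the sum zero. -/
theorem det_treeGram {p : ℕ → ℕ} (hp : ∀ i, p i ≤ i) (m : ℕ) : (treeGram p m).det = m + 1 := by
  let R : Matrix (Fin m) (Fin m) ℝ := Matrix.of fun a b =>
    (if a = b then 1 else 0) - (if (a : ℕ) + 1 = p b then 1 else 0)
  let N : Matrix (Fin m) (Fin m) ℝ :=
    1 + Matrix.replicateCol Unit (fun _ => (1 : ℝ)) * Matrix.replicateRow Unit (fun _ => (1 : ℝ))
  have hR : R.det = 1 := by
    rw [Matrix.det_of_isUpperTriangular]
    · refine Finset.prod_eq_one fun i _ => ?_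
      have := hp i
      simp only [R, Matrix.of_apply, if_true]
      rw [if_neg (by omega), sub_zero]
    · intro a b hab
      have hab' : (b : ℕ) < a := hab
      have := hp b
      simp only [R, Matrix.of_apply]
      rw [if_neg (by rintro rfl; omega), if_neg (by omega), sub_zero]
  have hN : N.det = m + 1 := by
    simp only [N]
    rw [Matrix.det_one_add_replicateCol_mul_replicateRow]
    simp [dotProduct, add_comm]
  have hind : ∀ q : ℕ, q ≤ m → ∀ f : ℕ → ℝ, ∑ a : Fin m, (if (a : ℕ) + 1 = q then f (a + 1) else 0)
      = if q = 0 then 0 else f q := by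
    intro q hq f
    rcases Nat.eq_zero_or_pos q with h | h
    · subst h; simp
    · rw [if_neg (by omega), Finset.sum_eq_single ⟨q - 1, by omega⟩]
      · simp [Nat.sub_add_cancel h]
      · intro b _ hb
        rw [if_neg]
        intro hh
        apply hb
        ext
        simp
        omega
      · simp
  have hcol : ∀ b : Fin m, ∑ a, R a b = if p b = 0 then 1 else 0 := by
    intro b
    have := hp b
    simp only [R, Matrix.of_apply, Finset.sum_sub_distrib]
    rw [hind (p b) (by omega) fun _ => 1]
    simp
    split_ifs <;> simp
  have hfac : treeGram p m = R.transpose * N * R := by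
    ext i j
    have e1 : (R.transpose * N * R) i j = ∑ a, R a i * R a j + (∑ a, R a i) * (∑ a, R a j) := by
      simp only [N, Matrix.mul_add, Matrix.add_mul, Matrix.mul_one, Matrix.add_apply]
      congr 1
      rw [← Matrix.mul_assoc, Matrix.mul_assoc]
      simp [Matrix.mul_apply]
    rw [e1, hcol, hcol]
    have hi := hp i
    have hj := hp j
    have e2 : ∀ a : Fin m, R a i * R a j =
        (if a = i then R a j else 0) -
          (if (a : ℕ) + 1 = p i then (if (a : ℕ) + 1 = (j : ℕ) + 1 then 1 else 0) -
            (if (a : ℕ) + 1 = p j then 1 else 0) else 0) := by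
      intro a
      simp only [R, Matrix.of_apply, Fin.ext_iff]
      split_ifs <;> first | omega | norm_num
    have e3 := hind (p i) (by omega) fun c => (if c = (j : ℕ) + 1 then 1 else 0) -
      (if c = p j then 1 else 0)
    rw [Finset.sum_congr rfl fun a _ => e2 a, Finset.sum_sub_distrib, e3]
    rw [Finset.sum_ite_eq' Finset.univ i fun a => R a j, if_pos (Finset.mem_univ i)]
    change crossing _ _ _ _ = (if i = j then (1 : ℝ) else 0) - (if (i : ℕ) + 1 = p j then 1 else 0) -
      _ + _
    simp only [crossing, Fin.ext_iff]
    clear e1 e2 e3 hcol hind hR hN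
    split_ifs <;> first | omega | norm_num
  rw [hfac, Matrix.det_mul, Matrix.det_mul, Matrix.det_transpose, hR, hN]
  ring

/-- Determinants are continuous. -/
theorem exists_det_near {m : ℕ} (C : Matrix (Fin m) (Fin m) ℝ) {ε : ℝ} (hε : 0 < ε) :
    ∃ δ > 0, ∀ M : Matrix (Fin m) (Fin m) ℝ, (∀ i j, |M i j - C i j| ≤ δ) →
      |M.det - C.det| ≤ ε := by
  have hc : Continuous fun M : Fin m → Fin m → ℝ => Matrix.det (Matrix.of M) :=
    Continuous.matrix_det continuous_id
  obtain ⟨δ, hδ, h⟩ := Metric.continuous_iff.1 hc C ε hε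
  refine ⟨δ / 2, by positivity, fun M hM => (h M ?_).le⟩
  refine lt_of_le_of_lt ((dist_pi_le_iff (by positivity)).2 fun i =>
    (dist_pi_le_iff (by positivity)).2 fun j => ?_) (half_lt_self hδ)
  rw [Real.dist_eq]
  exact hM i j

end Asymptotics

/-! ### Injective sequences and embeddings of trees -/

section Sequences

variable {W : Type*}

/-- `ψ` lists distinct elements `ψ 0 = v, …, ψ m`, and `ψ i = v` for `i > m` by convention. -/
def IsInjSeq (v : W) (m : ℕ) (ψ : ℕ → W) : Prop :=
  ψ 0 = v ∧ (∀ i, m < i → ψ i = v) ∧ Set.InjOn ψ (Set.Iic m)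

/-- `ψ` maps every edge `{i + 1, p i}`, `i < m`, of the tree with parent function `p` to an edge
of `H`. -/
def IsHom (H : SimpleGraph W) (p : ℕ → ℕ) (m : ℕ) (ψ : ℕ → W) : Prop :=
  ∀ i < m, H.Adj (ψ (i + 1)) (ψ (p i))

variable [Fintype W] [DecidableEq W]

/-- The elements that are not among `ψ 0, …, ψ m`. -/
def fresh (m : ℕ) (ψ : ℕ → W) : Finset W :=
  Finset.univ \ (Finset.range (m + 1)).image ψ

theorem mem_fresh {m : ℕ} {ψ : ℕ → W} {y : W} : y ∈ fresh m ψ ↔ ∀ i ≤ m, ψ i ≠ y := by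
  simp [fresh]

/-- The finite set of injective sequences with `m + 1` terms that start at `v`. -/
noncomputable def injSeq (v : W) : ℕ → Finset (ℕ → W)
  | 0 => {fun _ => v}
  | m + 1 => open Classical in
    (injSeq v m).biUnion fun ψ => (fresh m ψ).image (Function.update ψ (m + 1))

theorem mem_injSeq {v : W} {m : ℕ} {ψ : ℕ → W} : ψ ∈ injSeq v m ↔ IsInjSeq v m ψ := by
  classical
  induction m generalizing ψ with
  | zero =>
    simp only [injSeq, Finset.mem_singleton]
    constructor
    · rintro rfl
      refine ⟨rfl, fun _ _ => rfl, fun i hi j hj _ => ?_⟩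
      simp only [Set.mem_Iic] at hi hj
      omega
    · rintro ⟨h0, h1, -⟩
      ext i
      rcases Nat.eq_zero_or_pos i with rfl | h
      · exact h0
      · exact h1 i h
  | succ m ih =>
    simp only [injSeq, Finset.mem_biUnion, Finset.mem_image, mem_fresh]
    constructor
    · rintro ⟨ψ, hψ, y, hy, rfl⟩
      obtain ⟨h0, h1, h2⟩ := ih.1 hψ
      refine ⟨by simp [h0], fun i hi => ?_, fun i hi j hj hij => ?_⟩
      · rw [Function.update_of_ne (by omega), h1 i (by omega)]
      · simp only [Set.mem_Iic] at hi hj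
        by_cases hi' : i = m + 1 <;> by_cases hj' : j = m + 1
        · omega
        · subst hi'
          rw [Function.update_self, Function.update_of_ne hj'] at hij
          exact absurd hij.symm (hy j (by omega))
        · subst hj'
          rw [Function.update_self, Function.update_of_ne hi'] at hij
          exact absurd hij (hy i (by omega))
        · rw [Function.update_of_ne hi', Function.update_of_ne hj'] at hij
          exact h2 (Set.mem_Iic.2 (by omega)) (Set.mem_Iic.2 (by omega)) hij
    · rintro ⟨h0, h1, h2⟩
      refine ⟨Function.update ψ (m + 1) v, ih.2 ⟨by simp [h0], fun i hi => ?_, ?_⟩, ψ (m + 1), ?_, ?_⟩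
      · by_cases h : i = m + 1
        · rw [h, Function.update_self]
        · rw [Function.update_of_ne h, h1 i (by omega)]
      · intro i hi j hj hij
        simp only [Set.mem_Iic] at hi hj
        rw [Function.update_of_ne (by omega), Function.update_of_ne (by omega)] at hij
        exact h2 (Set.mem_Iic.2 (by omega)) (Set.mem_Iic.2 (by omega)) hij
      · intro i hi h
        rw [Function.update_of_ne (by omega)] at h
        have := h2 (Set.mem_Iic.2 (by omega)) (Set.mem_Iic.2 le_rfl) h
        omega
      · simp

theorem sum_injSeq_succ {M : Type*} [AddCommMonoid M] (v : W) (m : ℕ) (f : (ℕ → W) → M) :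
    ∑ ψ ∈ injSeq v (m + 1), f ψ =
      ∑ ψ ∈ injSeq v m, ∑ y ∈ fresh m ψ, f (Function.update ψ (m + 1) y) := by
  classical
  rw [injSeq, Finset.sum_biUnion]
  · refine Finset.sum_congr rfl fun ψ _ => ?_
    exact Finset.sum_image fun x _ y _ h => Function.update_injective ψ (m + 1) h
  · intro ψ hψ θ hθ hne
    rw [Function.onFun, Finset.disjoint_left]
    intro χ h1 h2
    obtain ⟨y, -, rfl⟩ := Finset.mem_image.1 h1
    obtain ⟨z, -, h⟩ := Finset.mem_image.1 h2
    apply hne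
    ext i
    by_cases hi : i = m + 1
    · subst hi
      rw [(mem_injSeq.1 hψ).2.1 _ (Nat.lt_succ_self m), (mem_injSeq.1 hθ).2.1 _ (Nat.lt_succ_self m)]
    · have := congrFun h i
      rwa [Function.update_of_ne hi, Function.update_of_ne hi, eq_comm] at this

omit [Fintype W] [DecidableEq W] in
theorem isHom_update_iff {H : SimpleGraph W} {p : ℕ → ℕ} (hp : ∀ i, p i ≤ i) {m : ℕ} {ψ : ℕ → W}
    {y : W} : IsHom H p (m + 1) (Function.update ψ (m + 1) y) ↔
      IsHom H p m ψ ∧ H.Adj y (ψ (p m)) := by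
  have key : ∀ i < m + 1, Function.update ψ (m + 1) y (p i) = ψ (p i) := fun i hi => by
    have := hp i
    rw [Function.update_of_ne (by omega)]
  constructor
  · intro h
    refine ⟨fun i hi => ?_, ?_⟩
    · have := h i (by omega)
      rwa [key i (by omega), Function.update_of_ne (by omega)] at this
    · have := h m (by omega)
      rwa [key m (by omega), Function.update_self] at this
  · rintro ⟨h1, h2⟩ i hi
    rw [key i hi]
    by_cases him : i = m
    · subst him
      rwa [Function.update_self]
    · rw [Function.update_of_ne (by omega)]
      exact h1 i (by omega)

open Classical in
/-- The embeddings of the tree with vertices `0, …, m` and parent function `p` into the graph `H`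
rooted at `v`. -/
noncomputable def embeddings (H : SimpleGraph W) (v : W) (p : ℕ → ℕ) (m : ℕ) : Finset (ℕ → W) :=
  (injSeq v m).filter (IsHom H p m)

theorem mem_embeddings {H : SimpleGraph W} {v : W} {p : ℕ → ℕ} {m : ℕ} {ψ : ℕ → W} :
    ψ ∈ embeddings H v p m ↔ IsInjSeq v m ψ ∧ IsHom H p m ψ := by
  classical
  exact Finset.mem_filter.trans (and_congr_left' mem_injSeq)

open Classical in
theorem sum_embeddings_succ {M : Type*} [AddCommMonoid M] (H : SimpleGraph W) (v : W)
    {p : ℕ → ℕ} (hp : ∀ i, p i ≤ i) (m : ℕ) (f : (ℕ → W) → M) :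
    ∑ ψ ∈ embeddings H v p (m + 1), f ψ =
      ∑ ψ ∈ embeddings H v p m, ∑ y ∈ (fresh m ψ).filter fun y => H.Adj y (ψ (p m)),
        f (Function.update ψ (m + 1) y) := by
  classical
  rw [embeddings, Finset.sum_filter, sum_injSeq_succ, embeddings, Finset.sum_filter]
  refine Finset.sum_congr rfl fun ψ _ => ?_
  simp only [isHom_update_iff hp]
  by_cases h : IsHom H p m ψ
  · simp [h, Finset.sum_filter]
  · simp [h]

end Sequences

/-! ### The expected number of embeddings into a random spanning tree -/

/-- Means with respect to weights of total mass tending to `1`. The values `g` are controlled only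
where the weight does not vanish. -/
theorem tendsto_sum_mul {ι : ℕ → Type*} (s : ∀ k, Finset (ι k)) (w g : ∀ k, ι k → ℝ) (c : ℝ)
    (hw : ∀ k, ∀ i ∈ s k, 0 ≤ w k i)
    (hsum : Tendsto (fun k => ∑ i ∈ s k, w k i) atTop (𝓝 1))
    (hg : ∀ η : ℝ, 0 < η → ∀ᶠ k in atTop, ∀ i ∈ s k, w k i ≠ 0 → |g k i - c| ≤ η) :
    Tendsto (fun k => ∑ i ∈ s k, w k i * g k i) atTop (𝓝 c) := by
  have h1 : Tendsto (fun k => ∑ i ∈ s k, w k i * (g k i - c)) atTop (𝓝 0) := by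
    rw [Metric.tendsto_nhds]
    intro ε hε
    filter_upwards [hg (ε / 4) (by positivity), hsum.eventually (gt_mem_nhds one_lt_two)]
      with k hk1 hk2
    rw [Real.dist_eq, sub_zero]
    calc |∑ i ∈ s k, w k i * (g k i - c)| ≤ ∑ i ∈ s k, |w k i * (g k i - c)| :=
          Finset.abs_sum_le_sum_abs _ _
      _ ≤ ∑ i ∈ s k, w k i * (ε / 4) := by
          refine Finset.sum_le_sum fun i hi => ?_
          rw [abs_mul, abs_of_nonneg (hw k i hi)]
          by_cases h0 : w k i = 0
          · simp [h0]
          · exact mul_le_mul_of_nonneg_left (hk1 i hi h0) (hw k i hi)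
      _ < ε := by
          rw [← Finset.sum_mul]
          nlinarith
  have h2 := h1.add (hsum.mul_const c)
  simp only [mul_sub, Finset.sum_sub_distrib, zero_add, one_mul] at h2
  refine h2.congr fun k => ?_
  rw [← Finset.sum_mul]
  ring

section Means

variable {α β : Type*} [Fintype α]

/-- The mean of `F` for the uniform random spanning tree of `G`. -/
noncomputable def ustMean [Finite β] (G : Graph α β) (F : Set β → ℝ) : ℝ :=
  (∑ T ∈ (Set.toFinite (spanningTrees G)).toFinset, F T) / (spanningTrees G).ncard

noncomputable instance (G : Graph α β) : Fintype V(G) := Fintype.ofFinite _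

noncomputable instance (G : Graph α β) : DecidableEq V(G) := Classical.decEq _

/-- The number of ways to choose edges of `G` between the vertices `ψ (i + 1)` and `ψ (p i)`. -/
noncomputable def edgeChoices (G : Graph α β) (p : ℕ → ℕ) (m : ℕ) (ψ : ℕ → V(G)) : ℝ :=
  ∏ i ∈ Finset.range m, (mult G (ψ (i + 1)) (ψ (p i)) : ℝ)

/-- The transfer impedance matrix of the edges between `ψ (i + 1)` and `ψ (p i)`. -/
noncomputable def impedanceMatrix (G : Graph α β) (p : ℕ → ℕ) (m : ℕ) (ψ : ℕ → V(G)) :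
    Matrix (Fin m) (Fin m) ℝ :=
  Matrix.of fun i j =>
    transferImpedance G (ψ (i + 1)) (ψ (p i)) (ψ (j + 1)) (ψ (p j))

open Classical in
/-- A homomorphic image of the tree in a spanning tree comes from a unique choice of edges, since a
spanning tree has no parallel edges. -/
theorem card_isHom_eq [Finite β] (G : Graph α β) (hG : IsConnected G) {p : ℕ → ℕ}
    (hp : ∀ i, p i ≤ i) {v : V(G)} {m : ℕ} {ψ : ℕ → V(G)} (hψ : IsInjSeq v m ψ) :
    (((Set.toFinite (spanningTrees G)).toFinset.filter
        fun T => IsHom (underlying G T) p m ψ).card : ℝ) =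
      (spanningTrees G).ncard * (edgeChoices G p m ψ * (impedanceMatrix G p m ψ).det) := by
  have := Fintype.ofFinite β
  let A : Finset (Fin m → β) := Fintype.piFinset fun i : Fin m =>
    Finset.univ.filter fun e => G.IsLink e (ψ (i + 1)) (ψ (p i))
  have hA : ∀ a : Fin m → β, a ∈ A ↔ ∀ i : Fin m, G.IsLink (a i) (ψ (i + 1)) (ψ (p i)) := by
    intro a
    simp [A, Fintype.mem_piFinset]
  have hne : ∀ i : Fin m, ψ (i + 1) ≠ ψ (p i) := by
    intro i h
    have h1 := hp i
    have := hψ.2.2 (Set.mem_Iic.2 (by omega)) (Set.mem_Iic.2 (by omega)) h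
    omega
  have hinj : ∀ a ∈ A, Function.Injective a := by
    intro a ha i j hij
    rw [hA] at ha
    have hi := ha i
    rw [hij] at hi
    have h1 := hp i
    have h2 := hp j
    have key : ∀ {a b : ℕ}, a ≤ m → b ≤ m → (ψ a : α) = ψ b → a = b := fun ha hb h =>
      hψ.2.2 (Set.mem_Iic.2 ha) (Set.mem_Iic.2 hb) (Subtype.ext h)
    rcases hi.eq_and_eq_or_eq_and_eq (ha j) with ⟨h, -⟩ | ⟨h, h'⟩
    · have := key (by omega) (by omega) h
      ext
      omega
    · have := key (by omega) (by omega) h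
      have := key (by omega) (by omega) h'
      omega
  have hcard : (A.card : ℝ) = edgeChoices G p m ψ := by
    rw [Fintype.card_piFinset, edgeChoices, Finset.prod_range]
    push_cast
    refine Finset.prod_congr rfl fun i _ => ?_
    rw [mult, ← Set.ncard_coe_finset]
    congr 2
    ext e
    simp
  have hU : (Set.toFinite (spanningTrees G)).toFinset.filter
      (fun T => IsHom (underlying G T) p m ψ) = A.biUnion fun a =>
        (Set.toFinite {T ∈ spanningTrees G | ∀ i, a i ∈ T}).toFinset := by
    ext T
    simp only [Finset.mem_filter, Set.Finite.mem_toFinset, Finset.mem_biUnion, Set.mem_sep_iff]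
    constructor
    · rintro ⟨hT, hh⟩
      have : ∀ i : Fin m, ∃ e ∈ T, G.IsLink e (ψ (i + 1)) (ψ (p i)) := fun i =>
        ((adj_restrict_iff _ _ _ _).1 (hh i i.2)).2
      choose a ha using this
      exact ⟨a, (hA a).2 fun i => (ha i).2, hT, fun i => (ha i).1⟩
    · rintro ⟨a, ha, hT, haT⟩
      exact ⟨hT, fun i hi => (adj_restrict_iff _ _ _ _).2
        ⟨hne ⟨i, hi⟩, a ⟨i, hi⟩, haT _, (hA a).1 ha ⟨i, hi⟩⟩⟩
  rw [hU, Finset.card_biUnion]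
  · push_cast
    rw [← hcard, Finset.sum_congr rfl (g := fun _ => ((spanningTrees G).ncard : ℝ) *
      (impedanceMatrix G p m ψ).det), Finset.sum_const, nsmul_eq_mul]
    · ring
    · intro a ha
      rw [← Set.ncard_eq_toFinset_card]
      exact ncard_spanningTrees_mul_det G hG a (hinj a ha) _ _ ((hA a).1 ha)
  · intro a ha b hb hab
    rw [Function.onFun, Finset.disjoint_left]
    intro T hTa hTb
    simp only [Set.Finite.mem_toFinset, Set.mem_sep_iff] at hTa hTb
    apply hab
    ext i
    exact hTa.1.2.1.eq_of_isLink ⟨hTa.2 i, (hA a).1 ha i⟩ ⟨hTb.2 i, (hA b).1 hb i⟩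

theorem ustMean_card_embeddings [Finite β] (G : Graph α β) (hG : IsConnected G) {p : ℕ → ℕ}
    (hp : ∀ i, p i ≤ i) (v : V(G)) (m : ℕ) :
    ustMean G (fun T => ((embeddings (underlying G T) v p m).card : ℝ)) =
      ∑ ψ ∈ injSeq v m, edgeChoices G p m ψ * (impedanceMatrix G p m ψ).det := by
  classical
  have := Fintype.ofFinite β
  have hne : ((spanningTrees G).ncard : ℝ) ≠ 0 :=
    Nat.cast_ne_zero.2 (ncard_spanningTrees_ne_zero G hG)
  rw [ustMean, div_eq_iff hne, Finset.sum_mul]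
  have h1 : ∀ T, ((embeddings (underlying G T) v p m).card : ℝ) =
      ∑ ψ ∈ injSeq v m, if IsHom (underlying G T) p m ψ then 1 else 0 := by
    intro T
    rw [embeddings, Finset.sum_boole]
  simp_rw [h1]
  rw [Finset.sum_comm]
  refine Finset.sum_congr rfl fun ψ hψ => ?_
  rw [Finset.sum_boole, card_isHom_eq G hG hp (mem_injSeq.1 hψ)]
  ring

theorem sum_mult_eq_degStar [Finite β] (G : Graph α β) (x : V(G)) :
    ∑ y ∈ Finset.univ.erase x, (mult G y x : ℝ) = degStar G x := by
  classical
  rw [degStar_eq_sum]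
  push_cast
  rw [← Finset.sum_subset (s₁ := (Finset.univ.erase x).map (Function.Embedding.subtype _))]
  · rw [Finset.sum_map]
    exact Finset.sum_congr rfl fun y _ => by rw [mult_comm]; rfl
  · intro y hy
    obtain ⟨z, hz, rfl⟩ := Finset.mem_map.1 hy
    exact Finset.mem_erase.2 ⟨fun h => (Finset.mem_erase.1 hz).1 (Subtype.ext h), Finset.mem_univ _⟩
  · intro y hy hy'
    rw [mult_comm, mult_eq_zero_of_left, Nat.cast_zero]
    intro hyG
    exact hy' (Finset.mem_map.2 ⟨⟨y, hyG⟩, Finset.mem_erase.2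
      ⟨fun h => (Finset.mem_erase.1 hy).1 (congrArg Subtype.val h), Finset.mem_univ _⟩, rfl⟩)

/-- As few edges are parallel, about `k` of the edges at `ψ a` lead to a new vertex. -/
theorem IsNear.sum_fresh [Finite β] {G : Graph α β} (hG : IsConnected G) {k : ℕ} {ε : ℝ}
    (h : IsNear G k ε) (hε : 0 ≤ ε) (hε1 : ε ≤ 1) (m : ℕ) (ψ : ℕ → V(G)) {a : ℕ} (ha : a ≤ m) :
    |∑ y ∈ fresh m ψ, (mult G y (ψ a) : ℝ) - k| ≤ (2 * m + 3) * ε * k := by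
  set x := ψ a
  set S := ((Finset.range (m + 1)).image ψ).erase x with hS
  have h1 : fresh m ψ = Finset.univ.erase x \ S := by
    ext y
    simp only [fresh, hS, Finset.mem_sdiff, Finset.mem_univ, true_and, Finset.mem_erase, and_true]
    constructor
    · intro hy
      refine ⟨?_, fun h => hy h.2⟩
      rintro rfl
      exact hy (Finset.mem_image_of_mem ψ (Finset.mem_range.2 (by omega)))
    · rintro ⟨hy, hy'⟩ hy''
      exact hy' ⟨hy, hy''⟩
  have h2 : S ⊆ Finset.univ.erase x := fun y hy =>
    Finset.mem_erase.2 ⟨(Finset.mem_erase.1 hy).1, Finset.mem_univ _⟩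
  have h3 := Finset.sum_sdiff (f := fun y : V(G) => (mult G y x : ℝ)) h2
  rw [← h1, sum_mult_eq_degStar] at h3
  have h4 : ∑ y ∈ S, (mult G y x : ℝ) ≤ (m + 1) * (2 * ε * k) := by
    have hc : (S.card : ℝ) ≤ m + 1 := by
      have : S.card ≤ m + 1 := (Finset.card_erase_le.trans Finset.card_image_le).trans (by simp)
      exact_mod_cast this
    calc ∑ y ∈ S, (mult G y x : ℝ) ≤ ∑ _y ∈ S, 2 * ε * k := Finset.sum_le_sum fun y hy =>
          h.mult_le hG hε hε1 fun hyx => (Finset.mem_erase.1 hy).1 (Subtype.ext hyx)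
      _ = S.card * (2 * ε * k) := by rw [Finset.sum_const, nsmul_eq_mul]
      _ ≤ (m + 1) * (2 * ε * k) := mul_le_mul_of_nonneg_right hc (by positivity)
  have h5 : 0 ≤ ∑ y ∈ S, (mult G y x : ℝ) := Finset.sum_nonneg fun _ _ => Nat.cast_nonneg _
  have h6 := abs_le.1 (h.deg x x.2)
  have h7 : 0 ≤ m * (ε * k) := by positivity
  rw [abs_le]
  constructor <;> nlinarith

omit [Fintype α] in
theorem edgeChoices_update (G : Graph α β) {p : ℕ → ℕ} (hp : ∀ i, p i ≤ i) (m : ℕ) (ψ : ℕ → V(G))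
    (y : V(G)) : edgeChoices G p (m + 1) (Function.update ψ (m + 1) y) =
      edgeChoices G p m ψ * mult G y (ψ (p m)) := by
  have hpm := hp m
  rw [edgeChoices, Finset.prod_range_succ, Function.update_self, Function.update_of_ne (by omega)]
  congr 1
  refine Finset.prod_congr rfl fun i hi => ?_
  have := hp i
  rw [Finset.mem_range] at hi
  rw [Function.update_of_ne (by omega), Function.update_of_ne (by omega)]

omit [Fintype α] in
theorem edgeChoices_nonneg (G : Graph α β) (p : ℕ → ℕ) (m : ℕ) (ψ : ℕ → V(G)) :
    0 ≤ edgeChoices G p m ψ :=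
  Finset.prod_nonneg fun _ _ => Nat.cast_nonneg _

theorem crossing_map {γ δ : Type*} (f : γ → δ) (s : Set γ) (hf : Set.InjOn f s) {x y z w : γ}
    (hx : x ∈ s) (hy : y ∈ s) (hz : z ∈ s) (hw : w ∈ s) :
    crossing (f x) (f y) (f z) (f w) = crossing x y z w := by
  unfold crossing
  congr! 4
  exacts [hf.eq_iff hx hz, hf.eq_iff hy hw, hf.eq_iff hx hw, hf.eq_iff hy hz]

end Means

section Limits

variable {V E : ℕ → Type*} [∀ k, Fintype (V k)] [∀ k, Finite (E k)] (G : ∀ k, Graph (V k) (E k))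

/-- There are about `k ^ m` ways to choose the edges of an embedded tree with `m` edges, one after the
other. -/
theorem tendsto_sum_edgeChoices (v : ∀ k, V((G k))) (hconn : ∀ k, IsConnected (G k))
    (hnear : ∀ ε : ℝ, 0 < ε → ∀ᶠ k : ℕ in atTop, IsNear (G k) k ε) {p : ℕ → ℕ}
    (hp : ∀ i, p i ≤ i) (m : ℕ) :
    Tendsto (fun k : ℕ => ∑ ψ ∈ injSeq (v k) m, edgeChoices (G k) p m ψ / (k : ℝ) ^ m) atTop
      (𝓝 1) := by
  induction m with
  | zero => simp [injSeq, edgeChoices]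
  | succ m ih =>
    have h := tendsto_sum_mul (fun k => injSeq (v k) m)
      (fun k ψ => edgeChoices (G k) p m ψ / (k : ℝ) ^ m)
      (fun k ψ => (∑ y ∈ fresh m ψ, (mult (G k) y (ψ (p m)) : ℝ)) / k) 1
      (fun k ψ _ => div_nonneg (edgeChoices_nonneg _ _ _ _) (by positivity)) ih ?_
    · refine h.congr fun k => ?_
      rw [sum_injSeq_succ]
      refine Finset.sum_congr rfl fun ψ _ => ?_
      simp only [edgeChoices_update _ hp, ← Finset.sum_div, ← Finset.mul_sum]
      rw [pow_succ, div_mul_div_comm]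
    · intro η hη
      have hη' : 0 < min 1 (η / (2 * m + 3)) := by positivity
      filter_upwards [hnear _ hη', eventually_gt_atTop 0] with k hk hk0 ψ _ _
      have h1 := hk.sum_fresh (hconn k) hη'.le (min_le_left _ _) m ψ (hp m)
      have hk0' : (0 : ℝ) < k := Nat.cast_pos.2 hk0
      rw [div_sub_one hk0'.ne', abs_div, abs_of_pos hk0', div_le_iff₀ hk0']
      refine h1.trans (mul_le_mul_of_nonneg_right ?_ hk0'.le)
      calc (2 * m + 3) * min 1 (η / (2 * m + 3)) ≤ (2 * m + 3) * (η / (2 * m + 3)) :=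
            mul_le_mul_of_nonneg_left (min_le_right _ _) (by positivity)
        _ = η := by field_simp

/-- The mean number of embeddings of a tree with `m + 1` vertices into the uniform spanning tree
tends to `m + 1`. -/
theorem tendsto_ustMean_card_embeddings (v : ∀ k, V((G k))) (hconn : ∀ k, IsConnected (G k))
    (hnear : ∀ ε : ℝ, 0 < ε → ∀ᶠ k : ℕ in atTop, IsNear (G k) k ε) {p : ℕ → ℕ}
    (hp : ∀ i, p i ≤ i) (m : ℕ) :
    Tendsto (fun k : ℕ => ustMean (G k) fun T =>
      ((embeddings (underlying (G k) T) (v k) p m).card : ℝ)) atTop (𝓝 (m + 1)) := by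
  have h := tendsto_sum_mul (fun k => injSeq (v k) m)
    (fun k ψ => edgeChoices (G k) p m ψ / (k : ℝ) ^ m)
    (fun k ψ => (k : ℝ) ^ m * (impedanceMatrix (G k) p m ψ).det) (m + 1)
    (fun k ψ _ => div_nonneg (edgeChoices_nonneg _ _ _ _) (by positivity))
    (tendsto_sum_edgeChoices G v hconn hnear hp m) ?_
  · refine h.congr' ?_
    filter_upwards [eventually_gt_atTop 0] with k hk0
    have hk0' : (0 : ℝ) < k := Nat.cast_pos.2 hk0
    rw [ustMean_card_embeddings (G k) (hconn k) hp]
    refine Finset.sum_congr rfl fun ψ _ => ?_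
    field_simp
  · intro η hη
    obtain ⟨δ, hδ, hdet⟩ := exists_det_near (treeGram p m) hη
    filter_upwards [hnear δ hδ] with k hk ψ hψ hne
    rw [← det_treeGram hp m]
    have h1 : (k : ℝ) ^ m * (impedanceMatrix (G k) p m ψ).det =
        ((k : ℝ) • impedanceMatrix (G k) p m ψ).det := by
      rw [Matrix.det_smul, Fintype.card_fin]
    rw [h1]
    have hinj := (mem_injSeq.1 hψ).2.2
    have hinj' : Set.InjOn (fun i => (ψ i : V k)) (Set.Iic m) := fun i hi j hj hij =>
      hinj hi hj (Subtype.ext hij)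
    have hlink : ∀ i : Fin m, ∃ e, (G k).IsLink e (ψ (i + 1)) (ψ (p i)) := by
      intro i
      apply exists_isLink_of_mult_ne_zero
      intro h0
      apply hne
      rw [edgeChoices, Finset.prod_eq_zero (Finset.mem_range.2 i.2) (by rw [h0, Nat.cast_zero]),
        zero_div]
    have hmem : ∀ i : Fin m, (i : ℕ) + 1 ∈ Set.Iic m := fun i => Set.mem_Iic.2 i.2
    have hmemp : ∀ i : Fin m, p i ∈ Set.Iic m := fun i =>
      Set.mem_Iic.2 ((hp i).trans i.2.le)
    have hne' : ∀ i : Fin m, (ψ (i + 1) : V k) ≠ ψ (p i) := fun i h => by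
      have h2 := hinj' (hmem i) (hmemp i) h
      have := hp i
      omega
    refine hdet _ fun i j => ?_
    obtain ⟨e, he⟩ := hlink i
    obtain ⟨f, hf⟩ := hlink j
    have := hk.imp_crossing he hf (hne' i) (hne' j)
    rwa [crossing_map (fun i => (ψ i : V k)) _ hinj' (hmem i) (hmemp i) (hmem j) (hmemp j)] at this

end Limits

/-! ### Rooted trees and the boundary of an embedded tree -/

/-- The graph `H` is a tree with root `v` in which the vertex `x` has depth `D x` and, if `x ≠ v`,
parent `par x`. -/
structure IsRootedTree {W : Type*} (H : SimpleGraph W) (v : W) (D : W → ℕ) (par : W → W) : Prop where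
  depth_root : D v = 0
  depth_par : ∀ x, x ≠ v → D x = D (par x) + 1
  adj_iff : ∀ x y, H.Adj x y ↔ (x ≠ v ∧ par x = y) ∨ (y ≠ v ∧ par y = x)

/-- As a finite tree has one edge less than vertices, all its edges are those to the parents. -/
theorem exists_isRootedTree {W : Type*} [Finite W] {H : SimpleGraph W} (hH : H.IsTree) (v : W) :
    ∃ par, IsRootedTree H v (fun x => H.dist x v) par := by
  classical
  have h1 : ∀ x, ∃ y, x ≠ v → H.Adj x y ∧ H.dist x v = H.dist y v + 1 := by
    intro x
    by_cases hx : x = v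
    · exact ⟨v, fun h => absurd hx h⟩
    · obtain ⟨w, hw⟩ := hH.connected.exists_walk_length_eq_dist x v
      cases w with
      | nil => exact absurd rfl hx
      | @cons _ y _ h q =>
        refine ⟨y, fun _ => ⟨h, ?_⟩⟩
        rw [SimpleGraph.Walk.length_cons] at hw
        have h2 := SimpleGraph.dist_le q
        have h3 : H.dist x v ≤ H.dist x y + H.dist y v := hH.connected.dist_triangle
        rw [SimpleGraph.dist_eq_one_iff_adj.2 h] at h3
        omega
  choose par hpar using h1
  have hinj : Set.InjOn (fun x => s(x, par x)) {x | x ≠ v} := by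
    intro x hx y hy hxy
    have h2 := (hpar x hx).2
    have h3 := (hpar y hy).2
    rcases Sym2.eq_iff.1 hxy with ⟨h, -⟩ | ⟨h, h'⟩
    · exact h
    · rw [h'] at h2
      rw [← h] at h3
      omega
  have hsub : (fun x => s(x, par x)) '' {x | x ≠ v} ⊆ H.edgeSet := by
    rintro _ ⟨x, hx, rfl⟩
    exact (hpar x hx).1
  have hcard := (SimpleGraph.isTree_iff_connected_and_card.1 hH).2
  have hv : {x : W | x ≠ v}.ncard + 1 = Nat.card W := by
    have : {x : W | x ≠ v} = Set.univ \ {v} := by ext; simp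
    rw [this, Set.ncard_sdiff_singleton_add_one (Set.mem_univ v), Set.ncard_univ]
  have heq : (fun x => s(x, par x)) '' {x | x ≠ v} = H.edgeSet := by
    refine Set.eq_of_subset_of_ncard_le hsub ?_ (Set.toFinite _)
    rw [hinj.ncard_image]
    change Nat.card H.edgeSet ≤ _
    omega
  refine ⟨par, SimpleGraph.dist_self, fun x hx => (hpar x hx).2, fun x y => ?_⟩
  rw [← SimpleGraph.mem_edgeSet, ← heq]
  constructor
  · rintro ⟨z, hz, h⟩
    rcases Sym2.eq_iff.1 h with ⟨h1, h2⟩ | ⟨h1, h2⟩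
    · exact Or.inl ⟨h1 ▸ hz, h1 ▸ h2⟩
    · exact Or.inr ⟨h1 ▸ hz, h1 ▸ h2⟩
  · rintro (⟨h1, h2⟩ | ⟨h1, h2⟩)
    · exact ⟨x, h1, by simp [h2]⟩
    · exact ⟨y, h1, by simp [h2, Sym2.eq_swap]⟩

section Rooted

variable {W : Type*} {H : SimpleGraph W} {v : W} {D : W → ℕ} {par : W → W}

/-- Embeddings of rooted trees take parents to parents. -/
theorem IsRootedTree.par_apply (hH : IsRootedTree H v D par) {p : ℕ → ℕ} (hp : ∀ i, p i ≤ i) {m : ℕ}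
    {ψ : ℕ → W} (hψ : IsInjSeq v m ψ) (hψ' : IsHom H p m ψ) {i : ℕ} (hi : i < m) :
    ψ (i + 1) ≠ v ∧ par (ψ (i + 1)) = ψ (p i) := by
  induction i using Nat.strong_induction_on with
  | _ i ih =>
    have hpi := hp i
    refine ⟨fun h => ?_, ?_⟩
    · rw [← hψ.1] at h
      have := hψ.2.2 (Set.mem_Iic.2 hi) (Set.mem_Iic.2 (Nat.zero_le _)) h
      omega
    · rcases (hH.adj_iff _ _).1 (hψ' i hi) with ⟨-, h⟩ | ⟨h1, h2⟩
      · exact h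
      · exfalso
        obtain ⟨q, hq⟩ : ∃ q, p i = q + 1 := by
          refine Nat.exists_eq_succ_of_ne_zero fun h0 => h1 ?_
          rw [h0, hψ.1]
        have hpq := hp q
        rw [hq, (ih q (by omega) (by omega)).2] at h2
        have := hψ.2.2 (Set.mem_Iic.2 (by omega)) (Set.mem_Iic.2 hi) h2
        omega

/-- A vertex outside of an embedded tree that is adjacent to it is a child. -/
theorem IsRootedTree.par_eq_of_adj (hH : IsRootedTree H v D par) {p : ℕ → ℕ} (hp : ∀ i, p i ≤ i)
    {m : ℕ} {ψ : ℕ → W} (hψ : IsInjSeq v m ψ) (hψ' : IsHom H p m ψ) {i : ℕ} (hi : i ≤ m) {y : W}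
    (hy : ∀ j ≤ m, ψ j ≠ y) (h : H.Adj y (ψ i)) : par y = ψ i := by
  rcases (hH.adj_iff _ _).1 h with ⟨-, h⟩ | ⟨h1, h2⟩
  · exact h
  · exfalso
    obtain ⟨q, rfl⟩ : ∃ q, i = q + 1 := by
      refine Nat.exists_eq_succ_of_ne_zero fun h0 => h1 ?_
      rw [h0, hψ.1]
    rw [(hH.par_apply hp hψ hψ' (Nat.lt_of_succ_le hi)).2] at h2
    exact hy _ ((hp q).trans (by omega)) h2

variable [Fintype W] [DecidableEq W]

open Classical in
/-- The vertices outside of the embedded tree that are adjacent to `ψ i` for some `i ∈ I`. -/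
noncomputable def boundary (H : SimpleGraph W) (I : Finset ℕ) (m : ℕ) (ψ : ℕ → W) : Finset W :=
  (fresh m ψ).filter fun y => ∃ i ∈ I, H.Adj y (ψ i)

/-- The number of embeddings of the trees that are obtained from the tree with vertices `0, …, m`
and parent function `p` by attaching `j` new leaves, one after the other, to vertices in `I`. -/
noncomputable def extensionCount (H : SimpleGraph W) (v : W) (I : Finset ℕ) :
    ℕ → (ℕ → ℕ) → ℕ → ℕ
  | 0, p, m => (embeddings H v p m).card
  | j + 1, p, m => ∑ x ∈ I, extensionCount H v I j (Function.update p m x) (m + 1)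

theorem embeddings_update (H : SimpleGraph W) (v : W) (p : ℕ → ℕ) (m x : ℕ) :
    embeddings H v (Function.update p m x) m = embeddings H v p m := by
  ext ψ
  rw [mem_embeddings, mem_embeddings]
  refine and_congr_right fun _ => forall₂_congr fun i hi => ?_
  rw [Function.update_of_ne (by omega)]

theorem update_le_self {p : ℕ → ℕ} (hp : ∀ i, p i ≤ i) {m x : ℕ} (hx : x ≤ m) (i : ℕ) :
    Function.update p m x i ≤ i := by
  by_cases h : i = m
  · subst h; simpa
  · rw [Function.update_of_ne h]; exact hp i

theorem card_boundary_update {I : Finset ℕ} {m : ℕ} (hI : ∀ x ∈ I, x ≤ m) {ψ : ℕ → W} {y : W}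
    (hy : y ∈ boundary H I m ψ) :
    (boundary H I (m + 1) (Function.update ψ (m + 1) y)).card = (boundary H I m ψ).card - 1 := by
  classical
  rw [← Finset.card_erase_of_mem hy]
  congr 1
  ext z
  simp only [boundary, Finset.mem_filter, Finset.mem_erase, mem_fresh]
  have h1 : (∃ i ∈ I, H.Adj z (Function.update ψ (m + 1) y i)) ↔ ∃ i ∈ I, H.Adj z (ψ i) := by
    refine exists_congr fun i => and_congr_right fun hi => ?_
    have := hI i hi
    rw [Function.update_of_ne (by omega)]
  have h2 : (∀ i ≤ m + 1, Function.update ψ (m + 1) y i ≠ z) ↔ z ≠ y ∧ ∀ i ≤ m, ψ i ≠ z := by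
    constructor
    · intro h
      refine ⟨fun hzy => h (m + 1) le_rfl (by simp [hzy]), fun i hi => ?_⟩
      have := h i (by omega)
      rwa [Function.update_of_ne (by omega)] at this
    · rintro ⟨h3, h4⟩ i hi
      by_cases him : i = m + 1
      · subst him
        rw [Function.update_self]
        exact h3.symm
      · rw [Function.update_of_ne him]
        exact h4 i (by omega)
  rw [h1, h2, and_assoc]

/-- The extensions by `j` leaves are the injections of `j` points into the boundary, as every
boundary vertex is the child of exactly one vertex of the embedded tree. -/
theorem IsRootedTree.extensionCount_eq (hH : IsRootedTree H v D par) (I : Finset ℕ) (j : ℕ)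
    {p : ℕ → ℕ} (hp : ∀ i, p i ≤ i) {m : ℕ} (hI : ∀ x ∈ I, x ≤ m) :
    extensionCount H v I j p m =
      ∑ ψ ∈ embeddings H v p m, (boundary H I m ψ).card.descFactorial j := by
  classical
  induction j generalizing p m with
  | zero => simp [extensionCount]
  | succ j ih =>
    have h1 : ∀ x ∈ I, extensionCount H v I j (Function.update p m x) (m + 1) =
        ∑ ψ ∈ embeddings H v p m, ∑ y ∈ (fresh m ψ).filter fun y => H.Adj y (ψ x),
          ((boundary H I m ψ).card - 1).descFactorial j := by
      intro x hx
      have hp' := update_le_self hp (hI x hx)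
      rw [ih hp' fun z hz => (hI z hz).trans (Nat.le_succ m), sum_embeddings_succ H v hp',
        embeddings_update]
      refine Finset.sum_congr rfl fun ψ _ => ?_
      rw [Function.update_self]
      refine Finset.sum_congr rfl fun y hy => ?_
      rw [card_boundary_update hI]
      rw [Finset.mem_filter] at hy
      exact Finset.mem_filter.2 ⟨hy.1, x, hx, hy.2⟩
    rw [extensionCount, Finset.sum_congr rfl h1, Finset.sum_comm]
    refine Finset.sum_congr rfl fun ψ hψ => ?_
    obtain ⟨hψ1, hψ2⟩ := mem_embeddings.1 hψ
    have h2 : boundary H I m ψ = I.biUnion fun x => (fresh m ψ).filter fun y => H.Adj y (ψ x) := by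
      ext y
      simp only [boundary, Finset.mem_filter, Finset.mem_biUnion]
      tauto
    simp only [Finset.sum_const, smul_eq_mul]
    rw [← Finset.sum_mul, ← Finset.card_biUnion, ← h2]
    · rcases Nat.eq_zero_or_pos (boundary H I m ψ).card with h | h
      · rw [h, zero_mul, Nat.zero_descFactorial_succ]
      · obtain ⟨n, hn⟩ := Nat.exists_eq_succ_of_ne_zero h.ne'
        rw [hn, Nat.succ_descFactorial_succ]
        rfl
    · intro x hx z hz hxz
      rw [Function.onFun, Finset.disjoint_left]
      intro y hy hy'
      rw [Finset.mem_filter, mem_fresh] at hy hy'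
      have h3 := hH.par_eq_of_adj hp hψ1 hψ2 (hI x hx) hy.1 hy.2
      have h4 := hH.par_eq_of_adj hp hψ1 hψ2 (hI z hz) hy'.1 hy'.2
      exact hxz (hψ1.2.2 (Set.mem_Iic.2 (hI x hx)) (Set.mem_Iic.2 (hI z hz)) (h3.symm.trans h4))

/-- The number of embeddings that cannot be extended at the vertices in `I`. -/
noncomputable def exactCount (H : SimpleGraph W) (v : W) (I : Finset ℕ) (p : ℕ → ℕ) (m : ℕ) : ℕ :=
  ((embeddings H v p m).filter fun ψ => boundary H I m ψ = ∅).card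

/-- Bonferroni's inequalities for the indicator of `N = 0`: the error of a partial sum of
`∑ j, (-1) ^ j * N.choose j` is at most the first omitted term. -/
theorem bonferroni (N J : ℕ) :
    |(if N = 0 then 1 else 0 : ℝ) -
      ∑ j ∈ Finset.range J, (-1) ^ j * ((N.descFactorial j : ℝ) / (j.factorial : ℝ))| ≤
      (N.descFactorial J : ℝ) / (J.factorial : ℝ) := by
  have h : ∀ j, (N.descFactorial j : ℝ) / (j.factorial : ℝ) = (N.choose j : ℝ) := by
    intro j
    rw [Nat.descFactorial_eq_factorial_mul_choose, Nat.cast_mul,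
      mul_div_cancel_left₀ _ (Nat.cast_ne_zero.2 (Nat.factorial_ne_zero j))]
  simp only [h]
  rcases J with _ | J
  · simp only [Finset.range_zero, Finset.sum_empty, sub_zero, Nat.choose_zero_right, Nat.cast_one]
    split_ifs <;> simp
  · rcases N with _ | N
    · rw [Finset.sum_range_succ']
      simp
    · have h2 := Int.alternating_sum_range_choose_eq_choose (n := N) (m := J)
      have h3 : (∑ j ∈ Finset.range (J + 1), (-1) ^ j * ((N + 1).choose j : ℝ)) =
          (-1) ^ J * (N.choose J : ℝ) := by
        exact_mod_cast congrArg (Int.cast : ℤ → ℝ) h2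
      rw [h3, if_neg (Nat.succ_ne_zero N), zero_sub, abs_neg, abs_mul, abs_pow, abs_neg, abs_one,
        one_pow, one_mul, abs_of_nonneg (Nat.cast_nonneg _), Nat.choose_succ_succ]
      push_cast
      linarith [Nat.cast_nonneg (α := ℝ) (N.choose (J + 1))]

/-- Bonferroni's inequalities, summed over all embeddings. -/
theorem IsRootedTree.abs_exactCount_sub_le (hH : IsRootedTree H v D par) (I : Finset ℕ)
    {p : ℕ → ℕ} (hp : ∀ i, p i ≤ i) {m : ℕ} (hI : ∀ x ∈ I, x ≤ m) (J : ℕ) :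
    |(exactCount H v I p m : ℝ) - ∑ j ∈ Finset.range J,
        (-1) ^ j * ((extensionCount H v I j p m : ℝ) / (j.factorial : ℝ))| ≤
      (extensionCount H v I J p m : ℝ) / (J.factorial : ℝ) := by
  classical
  have h1 : ∀ j, (extensionCount H v I j p m : ℝ) / (j.factorial : ℝ) =
      ∑ ψ ∈ embeddings H v p m,
        ((boundary H I m ψ).card.descFactorial j : ℝ) / (j.factorial : ℝ) := by
    intro j
    rw [hH.extensionCount_eq I j hp hI]
    push_cast
    rw [Finset.sum_div]
  have h2 : (exactCount H v I p m : ℝ) =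
      ∑ ψ ∈ embeddings H v p m, if (boundary H I m ψ).card = 0 then 1 else 0 := by
    rw [Finset.sum_boole, exactCount]
    simp only [Finset.card_eq_zero]
  simp only [h1, h2, Finset.mul_sum]
  rw [Finset.sum_comm, ← Finset.sum_sub_distrib]
  exact (Finset.abs_sum_le_sum_abs _ _).trans (Finset.sum_le_sum fun ψ _ => bonferroni _ _)

end Rooted

/-! ### The mean number of exact embeddings -/

section ExactLimit

theorem ustMean_sub {α β : Type*} [Fintype α] [Finite β] (G : Graph α β) (F F' : Set β → ℝ) :
    ustMean G (fun T => F T - F' T) = ustMean G F - ustMean G F' := by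
  rw [ustMean, Finset.sum_sub_distrib, sub_div]
  rfl

theorem ustMean_sum {α β ι : Type*} [Fintype α] [Finite β] (G : Graph α β) (s : Finset ι)
    (F : ι → Set β → ℝ) :
    ustMean G (fun T => ∑ i ∈ s, F i T) = ∑ i ∈ s, ustMean G (F i) := by
  rw [ustMean, Finset.sum_comm, Finset.sum_div]
  rfl

theorem ustMean_mul_left {α β : Type*} [Fintype α] [Finite β] (G : Graph α β) (c : ℝ)
    (F : Set β → ℝ) : ustMean G (fun T => c * F T) = c * ustMean G F := by
  rw [ustMean, ← Finset.mul_sum, mul_div_assoc]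
  rfl

theorem abs_ustMean_le {α β : Type*} [Fintype α] [Finite β] (G : Graph α β) {F F' : Set β → ℝ}
    (h : ∀ T ∈ spanningTrees G, |F T| ≤ F' T) : |ustMean G F| ≤ ustMean G F' := by
  rw [ustMean, ustMean, abs_div, abs_of_nonneg (Nat.cast_nonneg (α := ℝ) _)]
  refine div_le_div_of_nonneg_right ?_ (Nat.cast_nonneg _)
  exact (Finset.abs_sum_le_sum_abs _ _).trans
    (Finset.sum_le_sum fun T hT => h T (by simpa using hT))

variable {V E : ℕ → Type*} [∀ k, Fintype (V k)] [∀ k, Finite (E k)] (G : ∀ k, Graph (V k) (E k))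

theorem tendsto_ustMean_extensionCount (v : ∀ k, V((G k))) (hconn : ∀ k, IsConnected (G k))
    (hnear : ∀ ε : ℝ, 0 < ε → ∀ᶠ k : ℕ in atTop, IsNear (G k) k ε) (I : Finset ℕ) (j : ℕ)
    {p : ℕ → ℕ} (hp : ∀ i, p i ≤ i) {m : ℕ} (hI : ∀ x ∈ I, x ≤ m) :
    Tendsto (fun k : ℕ => ustMean (G k) fun T =>
      (extensionCount (underlying (G k) T) (v k) I j p m : ℝ)) atTop
      (𝓝 ((I.card : ℝ) ^ j * (m + 1 + j))) := by
  induction j generalizing p m with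
  | zero => simpa [extensionCount] using tendsto_ustMean_card_embeddings G v hconn hnear hp m
  | succ j ih =>
    have h := tendsto_finsetSum I fun x hx =>
      ih (update_le_self hp (hI x hx)) (m := m + 1) fun z hz => (hI z hz).trans (Nat.le_succ m)
    convert h using 2 with k
    · rw [← ustMean_sum]
      congr 1
      ext T
      rw [extensionCount]
      push_cast
      rfl
    · rw [Finset.sum_const, nsmul_eq_mul]
      push_cast
      ring

/-- Passage to the limit in Bonferroni's inequalities. -/
theorem tendsto_of_alternating (a : ℕ → ℝ) (b : ℕ → ℕ → ℝ) (c : ℕ → ℝ) (L : ℝ)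
    (hab : ∀ J k, |a k - ∑ j ∈ Finset.range J, (-1) ^ j * b j k| ≤ b J k)
    (hb : ∀ j, Tendsto (b j) atTop (𝓝 (c j)))
    (hc : HasSum (fun j => (-1) ^ j * c j) L) : Tendsto a atTop (𝓝 L) := by
  rw [Metric.tendsto_nhds]
  intro ε hε
  have h0 : Tendsto c atTop (𝓝 0) := by
    have := hc.summable.tendsto_atTop_zero.abs
    simp only [abs_mul, abs_pow, abs_neg, abs_one, one_pow, one_mul, abs_zero] at this
    exact squeeze_zero_norm (fun n => le_rfl) this
  obtain ⟨J, hJ1, hJ2⟩ := ((h0.eventually (gt_mem_nhds (show (0 : ℝ) < ε / 4 by positivity))).and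
    (Metric.tendsto_nhds.1 hc.tendsto_sum_nat (ε / 4) (by positivity))).exists
  have h1 : Tendsto (fun k => ∑ j ∈ Finset.range J, (-1) ^ j * b j k) atTop
      (𝓝 (∑ j ∈ Finset.range J, (-1) ^ j * c j)) :=
    tendsto_finsetSum _ fun j _ => (hb j).const_mul _
  filter_upwards [Metric.tendsto_nhds.1 h1 (ε / 4) (by positivity),
    (hb J).eventually (gt_mem_nhds hJ1)] with k hk1 hk2
  have h2 := hab J k
  rw [Real.dist_eq] at *
  calc |a k - L| = |(a k - ∑ j ∈ Finset.range J, (-1) ^ j * b j k) +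
        ((∑ j ∈ Finset.range J, (-1) ^ j * b j k - ∑ j ∈ Finset.range J, (-1) ^ j * c j) +
        (∑ j ∈ Finset.range J, (-1) ^ j * c j - L))| := by ring_nf
    _ ≤ _ := (abs_add_le _ _).trans (add_le_add le_rfl (abs_add_le _ _))
    _ < ε := by linarith

/-- The value at `n = m + 1` is the limit of the mean number of exact embeddings. -/
theorem hasSum_alternating (s n : ℝ) :
    HasSum (fun j : ℕ => (-1) ^ j * (s ^ j * (n + j) / (j.factorial : ℝ)))
      (Real.exp (-s) * (n - s)) := by
  have h1 : HasSum (fun j : ℕ => (-s) ^ j / (j.factorial : ℝ)) (Real.exp (-s)) := by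
    rw [Real.exp_eq_exp_ℝ]
    exact NormedSpace.expSeries_div_hasSum_exp (-s)
  have h2 : HasSum (fun j : ℕ => (-s) ^ j / (j.factorial : ℝ) * j) (-s * Real.exp (-s)) := by
    rw [← hasSum_nat_add_iff' 1]
    simp only [Finset.range_one, Finset.sum_singleton, Nat.cast_zero, mul_zero, sub_zero]
    refine (h1.mul_left (-s)).congr_fun fun j => ?_
    have : (j.factorial : ℝ) ≠ 0 := Nat.cast_ne_zero.2 (Nat.factorial_ne_zero j)
    have h' : ((j : ℝ) + 1) ≠ 0 := by positivity
    rw [Nat.factorial_succ, pow_succ]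
    push_cast
    field_simp
  have h3 := (h1.mul_right n).add h2
  rw [show Real.exp (-s) * (n - s) = Real.exp (-s) * n + -s * Real.exp (-s) by ring]
  refine h3.congr_fun fun j => ?_
  rw [neg_pow s j]
  ring

theorem tendsto_ustMean_exactCount (v : ∀ k, V((G k))) (hconn : ∀ k, IsConnected (G k))
    (hnear : ∀ ε : ℝ, 0 < ε → ∀ᶠ k : ℕ in atTop, IsNear (G k) k ε) (I : Finset ℕ)
    {p : ℕ → ℕ} (hp : ∀ i, p i ≤ i) {m : ℕ} (hI : ∀ x ∈ I, x ≤ m) :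
    Tendsto (fun k : ℕ => ustMean (G k) fun T =>
      (exactCount (underlying (G k) T) (v k) I p m : ℝ)) atTop
      (𝓝 (Real.exp (-I.card) * (m + 1 - I.card))) := by
  refine tendsto_of_alternating _ (fun j k => ustMean (G k) fun T =>
    (extensionCount (underlying (G k) T) (v k) I j p m : ℝ) / (j.factorial : ℝ))
    (fun j => (I.card : ℝ) ^ j * (m + 1 + j) / (j.factorial : ℝ)) _ (fun J k => ?_) (fun j => ?_)
    (hasSum_alternating _ _)
  · simp only [← ustMean_mul_left, ← ustMean_sum, ← ustMean_sub]
    refine abs_ustMean_le _ fun T hT => ?_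
    have : (underlying (G k) T).IsTree := hT.2.2
    obtain ⟨par, hpar⟩ := exists_isRootedTree this (v k)
    exact hpar.abs_exactCount_sub_le I hp hI J
  · simp only [div_eq_inv_mul, ustMean_mul_left]
    exact (tendsto_ustMean_extensionCount G v hconn hnear I j hp hI).const_mul _

end ExactLimit

/-! ### Truncations and exact embeddings -/

section Exact

/-- The embedding `ψ` of the tree with vertices `0, …, m` and parent function `p` hits all
neighbours of the vertices `ψ i` with `d i < r`. -/
def IsExact {W : Type*} (H : SimpleGraph W) (v : W) (p d : ℕ → ℕ) (r m : ℕ) (ψ : ℕ → W) : Prop :=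
  IsInjSeq v m ψ ∧ IsHom H p m ψ ∧ ∀ i ≤ m, d i < r → ∀ y, H.Adj y (ψ i) → ∃ j ≤ m, ψ j = y

/-- `d` gives the depths of the vertices `0, …, m` of the tree with parent function `p`, and these
are at most `r`. -/
structure IsDepth (p d : ℕ → ℕ) (r m : ℕ) : Prop where
  le_self : ∀ i, p i ≤ i
  zero : d 0 = 0
  succ : ∀ i < m, d (i + 1) = d (p i) + 1
  le : ∀ i ≤ m, d i ≤ r

/-- `e` numbers the vertices of the tree `t` with root `o` so that `p` is the parent function. -/
structure IsLabelling {U : Type*} (t : SimpleGraph U) (o : U) (p : ℕ → ℕ) (m : ℕ) (e : ℕ → U) :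
    Prop where
  inj : IsInjSeq o m e
  hom : IsHom t p m e
  surj : ∀ x, ∃ i ≤ m, e i = x

/-- The vertices are sorted by their depth. -/
theorem exists_labelling {n : ℕ} {t : SimpleGraph (Fin n)} (ht : t.IsTree) (o : Fin n) {r : ℕ}
    (hr : ∀ x, t.dist o x ≤ r) :
    ∃ (m : ℕ) (p d : ℕ → ℕ) (e : ℕ → Fin n), IsDepth p d r m ∧ IsLabelling t o p m e := by
  obtain ⟨par, hpar⟩ := exists_isRootedTree ht o
  set D : Fin n → ℕ := fun x => t.dist x o with hD
  obtain ⟨m, rfl⟩ : ∃ m, n = m + 1 := Nat.exists_eq_succ_of_ne_zero (by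
    rintro rfl; exact o.elim0)
  set σ := Tuple.sort D with hσ
  have hmono : Monotone (D ∘ σ) := Tuple.monotone_sort D
  have hlt : ∀ x y, D x < D y → σ.symm x < σ.symm y := by
    intro x y hxy
    by_contra h
    have := hmono (not_lt.1 h)
    simp only [Function.comp_apply, Equiv.apply_symm_apply] at this
    omega
  have hσ0 : σ 0 = o := by
    have h0 := hmono (Fin.zero_le (σ.symm o))
    simp only [Function.comp_apply, Equiv.apply_symm_apply] at h0
    rw [hpar.depth_root] at h0
    exact ht.connected.dist_eq_zero_iff.1 (Nat.le_zero.1 h0)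
  let e : ℕ → Fin (m + 1) := fun i => if h : i < m + 1 then σ ⟨i, h⟩ else o
  let p : ℕ → ℕ := fun i => if i < m then σ.symm (par (e (i + 1))) else 0
  have he : ∀ x : Fin (m + 1), e x = σ x := fun x => dif_pos x.2
  have hne : ∀ i < m, e (i + 1) ≠ o := by
    intro i hi h
    rw [show i + 1 = ((⟨i + 1, by omega⟩ : Fin (m + 1)) : ℕ) from rfl, he, ← hσ0] at h
    have := congrArg Fin.val (σ.injective h)
    simp at this
  have hp : ∀ i, p i ≤ i := by
    intro i
    simp only [p]
    split_ifs with h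
    · have h1 := hlt (par (e (i + 1))) (e (i + 1)) (by
        rw [hpar.depth_par _ (hne i h)]; exact Nat.lt_succ_self _)
      have h2 : σ.symm (e (i + 1)) = ⟨i + 1, by omega⟩ := by
        rw [Equiv.symm_apply_eq]
        exact dif_pos (by omega)
      rw [h2] at h1
      have h3 : (σ.symm (par (e (i + 1))) : ℕ) < i + 1 := h1
      omega
    · exact Nat.zero_le _
  have hep : ∀ i < m, e (p i) = par (e (i + 1)) := by
    intro i hi
    simp only [p, if_pos hi]
    rw [he, Equiv.apply_symm_apply]
  refine ⟨m, p, fun i => D (e i), e, ⟨hp, ?_, fun i hi => ?_, fun i _ => ?_⟩,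
    ⟨⟨?_, fun i hi => ?_, fun i hi j hj hij => ?_⟩, fun i hi => ?_, fun x => ?_⟩⟩
  · change D (e ((0 : Fin (m + 1)) : ℕ)) = 0
    rw [he, hσ0, hpar.depth_root]
  · rw [hep i hi, hpar.depth_par _ (hne i hi)]
  · change t.dist _ _ ≤ r
    rw [SimpleGraph.dist_comm]
    exact hr _
  · exact (he 0).trans hσ0
  · exact dif_neg (by omega)
  · simp only [Set.mem_Iic] at hi hj
    simp only [e, dif_pos (Nat.lt_succ_of_le hi), dif_pos (Nat.lt_succ_of_le hj)] at hij
    exact congrArg Fin.val (σ.injective hij)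
  · rw [hpar.adj_iff]
    exact Or.inl ⟨hne i hi, (hep i hi).symm⟩
  · exact ⟨σ.symm x, Nat.lt_succ_iff.1 (σ.symm x).2, by rw [he, Equiv.apply_symm_apply]⟩

variable {W : Type*} {H : SimpleGraph W} {v : W}

theorem IsHom.edist_le {p d : ℕ → ℕ} {r m : ℕ} (hd : IsDepth p d r m) {ψ : ℕ → W}
    (h0 : ψ 0 = v) (h : IsHom H p m ψ) {i : ℕ} (hi : i ≤ m) : H.edist v (ψ i) ≤ d i := by
  induction i using Nat.strong_induction_on with
  | _ i ih =>
    rcases i with _ | i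
    · rw [h0, SimpleGraph.edist_self]
      exact zero_le
    · have hpi := hd.le_self i
      have h1 := ih (p i) (by omega) (by omega)
      rw [hd.succ i (by omega)]
      calc H.edist v (ψ (i + 1)) ≤ H.edist v (ψ (p i)) + H.edist (ψ (p i)) (ψ (i + 1)) :=
            SimpleGraph.edist_triangle
        _ ≤ d (p i) + 1 := by
            gcongr
            exact (SimpleGraph.edist_eq_one_iff_adj.2 (h i (by omega)).symm).le
        _ = ((d (p i) + 1 : ℕ) : ℕ∞) := by push_cast; rfl

theorem IsRootedTree.adj_apply_iff {D : W → ℕ} {par : W → W} (hH : IsRootedTree H v D par)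
    {p : ℕ → ℕ} (hp : ∀ i, p i ≤ i) {m : ℕ} {ψ : ℕ → W} (hψ : IsInjSeq v m ψ)
    (hψ' : IsHom H p m ψ) {i j : ℕ} (hi : i ≤ m) (hj : j ≤ m) :
    H.Adj (ψ i) (ψ j) ↔ (∃ q, i = q + 1 ∧ p q = j) ∨ ∃ q, j = q + 1 ∧ p q = i := by
  have key : ∀ {i j : ℕ}, i ≤ m → j ≤ m →
      ((ψ i ≠ v ∧ par (ψ i) = ψ j) ↔ ∃ q, i = q + 1 ∧ p q = j) := by
    intro i j hi hj
    constructor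
    · rintro ⟨h1, h2⟩
      obtain ⟨q, rfl⟩ : ∃ q, i = q + 1 := by
        refine Nat.exists_eq_succ_of_ne_zero fun h0 => h1 ?_
        rw [h0, hψ.1]
      rw [(hH.par_apply hp hψ hψ' (Nat.lt_of_succ_le hi)).2] at h2
      exact ⟨q, rfl, hψ.2.2 (Set.mem_Iic.2 ((hp q).trans (by omega))) (Set.mem_Iic.2 hj) h2⟩
    · rintro ⟨q, rfl, rfl⟩
      exact hH.par_apply hp hψ hψ' (Nat.lt_of_succ_le hi)
  rw [hH.adj_iff, key hi hj, key hj hi]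

/-- The image of an exact embedding is the set of vertices at distance at most `r`. -/
theorem IsExact.setOf_edist_le {D : W → ℕ} {par : W → W} (hH : IsRootedTree H v D par)
    {p d : ℕ → ℕ} {r m : ℕ} (hd : IsDepth p d r m) {ψ : ℕ → W} (hψ : IsExact H v p d r m ψ) (x : W) :
    H.edist v x ≤ r ↔ ∃ i ≤ m, ψ i = x := by
  constructor
  · intro hx
    have hne : H.edist x v ≠ ⊤ := by
      rw [SimpleGraph.edist_comm]
      exact ne_top_of_le_ne_top (ENat.natCast_ne_top r) hx
    obtain ⟨w, hw⟩ := SimpleGraph.exists_walk_of_edist_ne_top hne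
    rw [SimpleGraph.edist_comm, ← hw, Nat.cast_le] at hx
    have key : ∀ {x u : W} (w : H.Walk x u), u = v → w.length ≤ r →
        ∃ i ≤ m, ψ i = x ∧ d i ≤ w.length := by
      intro x u w
      induction w with
      | nil =>
        rintro rfl -
        exact ⟨0, Nat.zero_le _, hψ.1.1, hd.zero.le⟩
      | @cons y z u h w ih =>
        intro hu hlen
        rw [SimpleGraph.Walk.length_cons] at hlen ⊢
        obtain ⟨i, hi, rfl, hdi⟩ := ih hu (by omega)
        obtain ⟨j, hj, rfl⟩ := hψ.2.2 i hi (by omega) y h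
        refine ⟨j, hj, rfl, ?_⟩
        rcases (hH.adj_apply_iff hd.le_self hψ.1 hψ.2.1 hj hi).1 h with ⟨q, rfl, rfl⟩ | ⟨q, rfl, rfl⟩
        · rw [hd.succ q hj]
          omega
        · have := hd.succ q hi
          omega
    obtain ⟨i, hi, h, -⟩ := key w rfl hx
    exact ⟨i, hi, h⟩
  · rintro ⟨i, hi, rfl⟩
    exact (hψ.2.1.edist_le hd hψ.1.1 hi).trans (Nat.cast_le.2 (hd.le i hi))

variable {U : Type*} {t : SimpleGraph U} {o : U}

theorem IsExact.truncIso {D : W → ℕ} {par : W → W} (hH : IsRootedTree H v D par)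
    {D' : U → ℕ} {par' : U → U} (ht : IsRootedTree t o D' par')
    {p d : ℕ → ℕ} {r m : ℕ} (hd : IsDepth p d r m) {e : ℕ → U} (he : IsLabelling t o p m e)
    {ψ : ℕ → W} (hψ : IsExact H v p d r m ψ) : TruncIso H v r t o := by
  choose idx hidx hidx' using he.surj
  have hball := hψ.setOf_edist_le hH hd
  let g : U → {x | H.edist v x ≤ r} := fun x => ⟨ψ (idx x), (hball _).2 ⟨_, hidx x, rfl⟩⟩
  have hg : Function.Bijective g := by
    constructor
    · intro x y hxy
      have h1 : ψ (idx x) = ψ (idx y) := congrArg Subtype.val hxy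
      have h2 := hψ.1.2.2 (Set.mem_Iic.2 (hidx x)) (Set.mem_Iic.2 (hidx y)) h1
      rw [← hidx' x, ← hidx' y, h2]
    · rintro ⟨y, hy⟩
      obtain ⟨i, hi, rfl⟩ := (hball y).1 hy
      refine ⟨e i, Subtype.ext ?_⟩
      change ψ (idx (e i)) = ψ i
      rw [he.inj.2.2 (Set.mem_Iic.2 (hidx (e i))) (Set.mem_Iic.2 hi) (hidx' (e i))]
  let f : t ≃g H.induce {x | H.edist v x ≤ r} :=
    { toEquiv := Equiv.ofBijective g hg
      map_rel_iff' := by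
        intro x y
        change H.Adj (ψ (idx x)) (ψ (idx y)) ↔ t.Adj x y
        rw [hH.adj_apply_iff hd.le_self hψ.1 hψ.2.1 (hidx x) (hidx y),
          ← ht.adj_apply_iff hd.le_self he.inj he.hom (hidx x) (hidx y), hidx', hidx'] }
  refine ⟨f.symm, ?_⟩
  change ψ (idx o) = v
  have : idx o = 0 := he.inj.2.2 (Set.mem_Iic.2 (hidx o)) (Set.mem_Iic.2 (Nat.zero_le _))
    ((hidx' o).trans he.inj.1.symm)
  rw [this, hψ.1.1]

/-- Exact embeddings take values in the truncation and only depend on it. -/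
theorem ncard_isExact_of_truncIso {p d : ℕ → ℕ} {r m : ℕ} (hd : IsDepth p d r m)
    (h : TruncIso H v r t o) :
    {ψ | IsExact H v p d r m ψ}.ncard = {θ | IsExact t o p d r m θ}.ncard := by
  obtain ⟨φ, hφ⟩ := h
  have hinj : Function.Injective fun (θ : ℕ → U) (i : ℕ) => (φ.symm (θ i) : W) := by
    intro θ θ' h
    ext i
    exact φ.symm.injective (Subtype.ext (congrFun h i))
  rw [← Set.ncard_image_of_injective _ hinj]
  congr 1
  ext ψ
  simp only [Set.mem_ofPred_eq, Set.mem_image]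
  constructor
  · intro hψ
    have hmem : ∀ i, H.edist v (ψ i) ≤ r := by
      intro i
      rcases le_or_gt i m with hi | hi
      · exact (hψ.2.1.edist_le hd hψ.1.1 hi).trans (Nat.cast_le.2 (hd.le i hi))
      · rw [hψ.1.2.1 i hi, SimpleGraph.edist_self]
        exact zero_le
    have ho : ∀ hv : H.edist v v ≤ r, φ ⟨v, hv⟩ = o := by
      intro hv
      rw [← φ.symm.injective.eq_iff]
      exact Subtype.ext (by simp [hφ])
    have hoe : ∀ i, ψ i = v → φ ⟨ψ i, hmem i⟩ = o := by
      intro i hi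
      have : (⟨ψ i, hmem i⟩ : {x | H.edist v x ≤ r}) = ⟨v, hi ▸ hmem i⟩ := Subtype.ext hi
      rw [this]
      exact ho _
    refine ⟨fun i => φ ⟨ψ i, hmem i⟩, ⟨⟨hoe 0 hψ.1.1, fun i hi => hoe i (hψ.1.2.1 i hi), ?_⟩, ?_, ?_⟩,
      ?_⟩
    · intro i hi j hj hij
      exact hψ.1.2.2 hi hj (congrArg Subtype.val (φ.injective hij))
    · intro i hi
      exact φ.map_rel_iff.2 (hψ.2.1 i hi)
    · intro i hi hir y hy
      have h1 : H.Adj (φ.symm y) (ψ i) := by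
        have := φ.symm.map_rel_iff.2 hy
        rw [RelIso.symm_apply_apply] at this
        exact this
      obtain ⟨j, hj, hjy⟩ := hψ.2.2 i hi hir _ h1
      refine ⟨j, hj, ?_⟩
      rw [← φ.symm.injective.eq_iff]
      exact Subtype.ext (by simp [hjy])
    · ext i
      simp
  · rintro ⟨θ, hθ, rfl⟩
    refine ⟨⟨?_, fun i hi => ?_, fun i hi j hj hij => ?_⟩, fun i hi => ?_, fun i hi hir y hy => ?_⟩
    · simp only [hθ.1.1, hφ]
    · simp only [hθ.1.2.1 i hi, hφ]
    · exact hθ.1.2.2 hi hj (φ.symm.injective (Subtype.ext hij))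
    · exact φ.symm.map_rel_iff.2 (hθ.2.1 i hi)
    · have hhom : IsHom H p m fun i => (φ.symm (θ i) : W) := fun i hi =>
        φ.symm.map_rel_iff.2 (hθ.2.1 i hi)
      have h1 := hhom.edist_le hd (v := v) (by simp only [hθ.1.1, hφ]) hi
      have h2 : H.edist v y ≤ r := by
        calc H.edist v y ≤ H.edist v (φ.symm (θ i)) + H.edist (φ.symm (θ i) : W) y :=
              SimpleGraph.edist_triangle
          _ ≤ d i + 1 := by
              gcongr
              exact (SimpleGraph.edist_eq_one_iff_adj.2 hy.symm).le
          _ = ((d i + 1 : ℕ) : ℕ∞) := by push_cast; rfl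
          _ ≤ r := Nat.cast_le.2 hir
      obtain ⟨j, hj, hjy⟩ := hθ.2.2 i hi hir (φ ⟨y, h2⟩) (by
        rw [← φ.symm.map_rel_iff, RelIso.symm_apply_apply]
        exact hy)
      exact ⟨j, hj, by simp [hjy]⟩

open Classical in
/-- The number of exact embeddings of `t` is the indicator of `H ∧ r ≅ t`, up to a positive
constant factor. -/
theorem ncard_isExact {D : W → ℕ} {par : W → W} (hH : IsRootedTree H v D par)
    {D' : U → ℕ} {par' : U → U} (ht : IsRootedTree t o D' par')
    {p d : ℕ → ℕ} {r m : ℕ} (hd : IsDepth p d r m) {e : ℕ → U} (he : IsLabelling t o p m e) :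
    {ψ | IsExact H v p d r m ψ}.ncard =
      if TruncIso H v r t o then {θ | IsExact t o p d r m θ}.ncard else 0 := by
  split_ifs with h
  · exact ncard_isExact_of_truncIso hd h
  · have : {ψ | IsExact H v p d r m ψ} = ∅ :=
      Set.eq_empty_iff_forall_notMem.2 fun ψ hψ => h (IsExact.truncIso hH ht hd he hψ)
    rw [this, Set.ncard_empty]

theorem finite_isInjSeq [Finite W] (v : W) (m : ℕ) : {ψ | IsInjSeq v m ψ}.Finite := by
  classical
  have := Fintype.ofFinite W
  exact (injSeq v m).finite_toSet.subset fun ψ hψ => mem_injSeq.2 hψ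

theorem IsLabelling.ncard_isExact_pos [Finite U] {p : ℕ → ℕ} {m : ℕ} {e : ℕ → U}
    (he : IsLabelling t o p m e) (d : ℕ → ℕ) (r : ℕ) :
    0 < {θ | IsExact t o p d r m θ}.ncard :=
  (Set.ncard_pos ((finite_isInjSeq o m).subset fun _ h => h.1)).2
    ⟨e, he.inj, he.hom, fun _ _ _ y _ => he.surj y⟩

/-- The vertices of depth less than `r`. -/
def innerVertices (d : ℕ → ℕ) (r m : ℕ) : Finset ℕ := (Finset.range (m + 1)).filter fun i => d i < r

theorem exactCount_eq [Fintype W] [DecidableEq W] (H : SimpleGraph W) (v : W) (p d : ℕ → ℕ)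
    (r m : ℕ) :
    exactCount H v (innerVertices d r m) p m = {ψ | IsExact H v p d r m ψ}.ncard := by
  classical
  rw [exactCount, ← Set.ncard_coe_finset]
  congr 1
  ext ψ
  simp only [Finset.coe_filter, Set.mem_ofPred_eq, mem_embeddings, IsExact, and_assoc]
  refine and_congr_right fun h1 => and_congr_right fun h2 => ?_
  simp only [boundary, Finset.filter_eq_empty_iff, mem_fresh, innerVertices, Finset.mem_filter,
    Finset.mem_range]
  constructor
  · intro h i hi hir y hy
    by_contra! hcon
    exact h hcon ⟨i, ⟨by omega, hir⟩, hy⟩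
  · rintro h y hy ⟨i, ⟨hi, hir⟩, hadj⟩
    obtain ⟨j, hj, hjy⟩ := h i (by omega) hir y hadj
    exact hy j hj hjy

end Exact

/-! ### The limit tree as a rooted tree -/

section SinTree

/-- The parent in the tree of all possible individuals: the vertex `(i, [])` of the path has the
parent `(i - 1, [])`. -/
def sinParent : ℕ × List ℕ → ℕ × List ℕ
  | (i, []) => (i - 1, [])
  | (i, _ :: u) => (i, u)

/-- The distance from `(0, [])` in the tree of all possible individuals. -/
def sinDepth (x : ℕ × List ℕ) : ℕ := x.1 + x.2.length

theorem sinDepth_parent {x : ℕ × List ℕ} (hx : x ≠ (0, [])) :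
    sinDepth x = sinDepth (sinParent x) + 1 := by
  rcases x with ⟨i, _ | ⟨j, u⟩⟩
  · have : i ≠ 0 := fun h => hx (by rw [h])
    simp only [sinDepth, sinParent, List.length_nil]
    omega
  · simp only [sinDepth, sinParent, List.length_cons]
    omega

/-- Every possible individual other than `(0, [])` has exactly one parent. -/
theorem step_iff (x y : ℕ × List ℕ) : Step x y ↔ y ≠ (0, []) ∧ sinParent y = x := by
  rcases x with ⟨i, u⟩
  rcases y with ⟨i', _ | ⟨j, u'⟩⟩
  · simp only [Step, sinParent, Prod.mk.injEq, reduceCtorEq, and_false, exists_false, or_false, ne_eq,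
      and_true]
    constructor
    · rintro ⟨rfl, rfl⟩
      exact ⟨by omega, by omega, rfl⟩
    · rintro ⟨h, h', rfl⟩
      exact ⟨rfl, by omega⟩
  · simp only [Step, sinParent, Prod.mk.injEq, reduceCtorEq, and_false, false_or, ne_eq,
      not_false_eq_true, true_and, List.cons.injEq]
    constructor
    · rintro ⟨_, rfl, rfl, rfl⟩
      exact ⟨rfl, rfl⟩
    · rintro ⟨rfl, rfl⟩
      exact ⟨j, rfl, rfl, rfl⟩

theorem born_parent {ξ : ℕ × List ℕ → ℕ} {x : ℕ × List ℕ} (hx : Born ξ x.1 x.2) :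
    Born ξ (sinParent x).1 (sinParent x).2 := by
  rcases x with ⟨i, _ | ⟨j, u⟩⟩
  · trivial
  · exact hx.1

theorem isRootedTree_sinTree (ξ : ℕ × List ℕ → ℕ) :
    IsRootedTree (sinTree ξ) (sinRoot ξ) (fun x => sinDepth x.1)
      (fun x => ⟨sinParent x.1, born_parent x.2⟩) where
  depth_root := rfl
  depth_par x hx := sinDepth_parent fun h => hx (Subtype.ext h)
  adj_iff x y := by
    have key : ∀ a b : {p : ℕ × List ℕ // Born ξ p.1 p.2}, Step a.1 b.1 ↔
        b ≠ sinRoot ξ ∧ (⟨sinParent b.1, born_parent b.2⟩ : {p : ℕ × List ℕ // Born ξ p.1 p.2}) = a := by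
      intro a b
      rw [step_iff, Subtype.ext_iff, ne_eq, ne_eq, Subtype.ext_iff]
      rfl
    rw [sinTree, SimpleGraph.fromRel_adj, key, key]
    constructor
    · rintro ⟨-, h | h⟩
      · exact Or.inr h
      · exact Or.inl h
    · intro h
      have hne : ∀ a b : {p : ℕ × List ℕ // Born ξ p.1 p.2}, (a ≠ sinRoot ξ ∧
          (⟨sinParent a.1, born_parent a.2⟩ : {p : ℕ × List ℕ // Born ξ p.1 p.2}) = b) → a ≠ b := by
        rintro a b ⟨h1, h2⟩ rfl
        have h3 := sinDepth_parent (x := a.1) fun h => h1 (Subtype.ext h)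
        have h4 : sinParent a.1 = a.1 := congrArg Subtype.val h2
        rw [h4] at h3
        omega
      rcases h with h | h
      · exact ⟨hne _ _ h, Or.inr h⟩
      · exact ⟨(hne _ _ h).symm, Or.inl h⟩

/-- The sequence `ψ` of possible individuals is an exact embedding into `sinTree ξ`. -/
structure IsSinExact (ξ : ℕ × List ℕ → ℕ) (p d : ℕ → ℕ) (r m : ℕ) (ψ : ℕ → ℕ × List ℕ) : Prop where
  inj : IsInjSeq (0, []) m ψ
  par : ∀ i < m, ψ (i + 1) ≠ (0, []) ∧ sinParent (ψ (i + 1)) = ψ (p i)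
  born : ∀ i ≤ m, Born ξ (ψ i).1 (ψ i).2
  exact : ∀ i ≤ m, d i < r → ∀ y : ℕ × List ℕ, Born ξ y.1 y.2 → y ≠ (0, []) → sinParent y = ψ i →
    ∃ j ≤ m, ψ j = y

theorem ncard_isExact_sinTree (ξ : ℕ × List ℕ → ℕ) {p d : ℕ → ℕ} {r m : ℕ} (hd : IsDepth p d r m) :
    {ψ | IsExact (sinTree ξ) (sinRoot ξ) p d r m ψ}.ncard = {ψ | IsSinExact ξ p d r m ψ}.ncard := by
  have hinj : Function.Injective fun (ψ : ℕ → {p : ℕ × List ℕ // Born ξ p.1 p.2}) (i : ℕ) =>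
      (ψ i : ℕ × List ℕ) := fun ψ ψ' h => by
    ext1 i
    exact Subtype.ext (congrFun h i)
  have hroot := isRootedTree_sinTree ξ
  rw [← Set.ncard_image_of_injective _ hinj]
  congr 1
  ext ψ
  simp only [Set.mem_ofPred_eq, Set.mem_image]
  constructor
  · rintro ⟨θ, hθ, rfl⟩
    refine ⟨⟨congrArg Subtype.val hθ.1.1, fun i hi => congrArg Subtype.val (hθ.1.2.1 i hi),
      fun i hi j hj hij => hθ.1.2.2 hi hj (Subtype.ext hij)⟩, fun i hi => ?_, fun i _ => (θ i).2,
      fun i hi hir y hy hy0 hpar => ?_⟩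
    · obtain ⟨h1, h2⟩ := hroot.par_apply hd.le_self hθ.1 hθ.2.1 hi
      exact ⟨fun h => h1 (Subtype.ext h), congrArg Subtype.val h2⟩
    · obtain ⟨j, hj, h⟩ := hθ.2.2 i hi hir ⟨y, hy⟩ ((hroot.adj_iff _ _).2
        (Or.inl ⟨fun h => hy0 (congrArg Subtype.val h), Subtype.ext hpar⟩))
      exact ⟨j, hj, congrArg Subtype.val h⟩
  · intro hψ
    have hb : ∀ i, Born ξ (ψ i).1 (ψ i).2 := by
      intro i
      rcases le_or_gt i m with h | h
      · exact hψ.born i h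
      · rw [hψ.inj.2.1 i h]
        trivial
    have h1 : IsInjSeq (sinRoot ξ) m fun i => ⟨ψ i, hb i⟩ :=
      ⟨Subtype.ext hψ.inj.1, fun i hi => Subtype.ext (hψ.inj.2.1 i hi),
        fun i hi j hj hij => hψ.inj.2.2 hi hj (congrArg Subtype.val hij)⟩
    have h2 : IsHom (sinTree ξ) p m fun i => ⟨ψ i, hb i⟩ := fun i hi => (hroot.adj_iff _ _).2
      (Or.inl ⟨fun h => (hψ.par i hi).1 (congrArg Subtype.val h), Subtype.ext (hψ.par i hi).2⟩)
    refine ⟨fun i => ⟨ψ i, hb i⟩, ⟨h1, h2, fun i hi hir y hy => ?_⟩, rfl⟩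
    by_contra! hcon
    have h3 := hroot.par_eq_of_adj hd.le_self h1 h2 hi hcon hy
    have h4 : y.1 ≠ (0, []) := fun h =>
      hcon 0 (Nat.zero_le _) (Subtype.ext (hψ.inj.1.trans h.symm))
    obtain ⟨j, hj, hjy⟩ := hψ.exact i hi hir y.1 y.2 h4 (congrArg Subtype.val h3)
    exact hcon j hj (Subtype.ext hjy)

end SinTree

/-! ### Enumerating the exact embeddings into the limit tree -/

section Enumeration

variable {p d : ℕ → ℕ} {r m : ℕ}

/-- The parent function, extended to the root. -/
def parentIndex (p : ℕ → ℕ) : ℕ → ℕ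
  | 0 => 0
  | i + 1 => p i

/-- The vertex `i` lies on the path from the root to the vertex `w` of depth `r`. -/
def OnSpine (p d : ℕ → ℕ) (r w i : ℕ) : Prop := (parentIndex p)^[r - d i] w = i

theorem IsDepth.parentIndex_le (hd : IsDepth p d r m) (i : ℕ) : parentIndex p i ≤ i := by
  rcases i with _ | i
  · exact le_rfl
  · exact (hd.le_self i).trans (Nat.le_succ i)

theorem IsDepth.depth_parentIndex (hd : IsDepth p d r m) {i : ℕ} (hi : i ≤ m) :
    d (parentIndex p i) = d i - 1 := by
  rcases i with _ | i
  · rw [parentIndex, hd.zero]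
  · rw [parentIndex, hd.succ i hi, Nat.add_sub_cancel]

theorem IsDepth.iterate (hd : IsDepth p d r m) {w : ℕ} (hw : w ≤ m) (n : ℕ) :
    (parentIndex p)^[n] w ≤ m ∧ d ((parentIndex p)^[n] w) = d w - n := by
  induction n with
  | zero => simpa
  | succ n ih =>
    rw [Function.iterate_succ_apply']
    refine ⟨(hd.parentIndex_le _).trans ih.1, ?_⟩
    rw [hd.depth_parentIndex ih.1, ih.2]
    omega

theorem IsDepth.eq_zero (hd : IsDepth p d r m) {i : ℕ} (hi : i ≤ m) (h : d i = 0) : i = 0 := by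
  rcases i with _ | i
  · rfl
  · rw [hd.succ i hi] at h
    omega

theorem IsDepth.onSpine_zero (hd : IsDepth p d r m) {w : ℕ} (hw : w ≤ m) (hwr : d w = r) :
    OnSpine p d r w 0 := by
  obtain ⟨h1, h2⟩ := hd.iterate hw (r - d 0)
  refine hd.eq_zero h1 ?_
  rw [h2, hwr, hd.zero]
  omega

theorem IsDepth.onSpine_parent (hd : IsDepth p d r m) {w i : ℕ} (hi : i < m)
    (h : OnSpine p d r w (i + 1)) : OnSpine p d r w (p i) := by
  have h1 := hd.succ i hi
  have h2 := hd.le (i + 1) hi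
  have h3 : r - d (p i) = (r - d (i + 1)) + 1 := by omega
  rw [OnSpine, h3, Function.iterate_succ_apply', h]
  rfl

theorem IsDepth.onSpine_child (hd : IsDepth p d r m) {w i : ℕ} (hw : w ≤ m) (hwr : d w = r)
    (hir : d i < r) (h : OnSpine p d r w i) :
    ∃ c < m, p c = i ∧ OnSpine p d r w (c + 1) := by
  obtain ⟨h1, h2⟩ := hd.iterate hw (r - d i - 1)
  have h3 : parentIndex p ((parentIndex p)^[r - d i - 1] w) = i := by
    rw [← Function.iterate_succ_apply' (parentIndex p), Nat.succ_eq_add_one,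
      Nat.sub_add_cancel (by omega)]
    exact h
  obtain ⟨c, hc⟩ : ∃ c, (parentIndex p)^[r - d i - 1] w = c + 1 := by
    refine Nat.exists_eq_succ_of_ne_zero fun h0 => ?_
    rw [h0, hd.zero] at h2
    omega
  rw [hc] at h1 h2 h3
  refine ⟨c, h1, h3, ?_⟩
  rw [OnSpine, h2, ← hc]
  congr 1
  omega

open Classical in
/-- The children of the vertex `i` outside of the path to `w`; the number `c` stands for the vertex
`c + 1`. -/
noncomputable def bushChildren (p d : ℕ → ℕ) (r m w i : ℕ) : Finset ℕ :=
  (Finset.range m).filter fun c => p c = i ∧ ¬ OnSpine p d r w (c + 1)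

theorem mem_bushChildren {w i c : ℕ} :
    c ∈ bushChildren p d r m w i ↔ c < m ∧ p c = i ∧ ¬ OnSpine p d r w (c + 1) := by
  simp [bushChildren]

theorem mem_innerVertices {i : ℕ} : i ∈ innerVertices d r m ↔ i ≤ m ∧ d i < r := by
  simp [innerVertices]

/-- An ordering of the children outside of the path to `w`, for every vertex of depth less than
`r`. -/
abbrev BushOrder (p d : ℕ → ℕ) (r m w : ℕ) : Type :=
  (i : innerVertices d r m) → bushChildren p d r m w i ≃ Fin (bushChildren p d r m w i).card

open Classical in
/-- The position of the vertex `c + 1` among its siblings. -/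
noncomputable def BushOrder.label {w : ℕ} (π : BushOrder p d r m w) (c : ℕ) : ℕ :=
  if h : p c ∈ innerVertices d r m ∧ c ∈ bushChildren p d r m w (p c) then π ⟨p c, h.1⟩ ⟨c, h.2⟩
  else 0

open Classical in
/-- The individual represented by a vertex, when the path to `w` is mapped to the infinite path and
the labels `ℓ` give the positions among the siblings. -/
noncomputable def individual (hp : ∀ i, p i ≤ i) (d : ℕ → ℕ) (r w : ℕ) (ℓ : ℕ → ℕ) :
    ℕ → ℕ × List ℕ
  | 0 => (0, [])
  | i + 1 =>
    if OnSpine p d r w (i + 1) then (d (i + 1), [])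
    else ((individual hp d r w ℓ (p i)).1, ℓ i :: (individual hp d r w ℓ (p i)).2)
  termination_by i => i
  decreasing_by all_goals exact Nat.lt_succ_of_le (hp i)

/-- The embedding given by the end `w` of the path and the orderings `π`. -/
noncomputable def bushSeq (hd : IsDepth p d r m) {w : ℕ} (π : BushOrder p d r m w) (i : ℕ) :
    ℕ × List ℕ :=
  if i ≤ m then individual hd.le_self d r w π.label i else (0, [])

section

variable (hd : IsDepth p d r m) {w : ℕ} (π : BushOrder p d r m w)

theorem bushSeq_zero : bushSeq hd π 0 = (0, []) := by
  rw [bushSeq, if_pos (Nat.zero_le m), individual]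

theorem bushSeq_spine {i : ℕ} (hi : i ≤ m) (h : OnSpine p d r w i) :
    bushSeq hd π i = (d i, []) := by
  rw [bushSeq, if_pos hi]
  rcases i with _ | i
  · rw [individual, hd.zero]
  · rw [individual, if_pos h]

theorem bushSeq_bush {i : ℕ} (hi : i < m) (h : ¬ OnSpine p d r w (i + 1)) :
    bushSeq hd π (i + 1) =
      ((bushSeq hd π (p i)).1, π.label i :: (bushSeq hd π (p i)).2) := by
  have := hd.le_self i
  rw [bushSeq, if_pos (Nat.succ_le_of_lt hi), individual, if_neg h, bushSeq, if_pos (by omega)]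

include hd in
theorem mem_of_not_onSpine {i : ℕ} (hi : i < m) (h : ¬ OnSpine p d r w (i + 1)) :
    p i ∈ innerVertices d r m ∧ i ∈ bushChildren p d r m w (p i) := by
  have h1 := hd.le_self i
  have h2 := hd.succ i hi
  have h3 := hd.le (i + 1) hi
  exact ⟨mem_innerVertices.2 ⟨by omega, by omega⟩, mem_bushChildren.2 ⟨hi, rfl, h⟩⟩

theorem label_eq {i : innerVertices d r m} (c : bushChildren p d r m w i) :
    π.label c = π i c := by
  obtain ⟨h1, h2, h3⟩ := mem_bushChildren.1 c.2
  rcases i with ⟨i, hi⟩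
  rcases c with ⟨c, hc⟩
  simp only at h1 h2 h3
  subst h2
  rw [BushOrder.label, dif_pos ⟨hi, hc⟩]

theorem onSpine_iff_bushSeq (hw : w ≤ m) (hwr : d w = r) {i : ℕ} (hi : i ≤ m) :
    OnSpine p d r w i ↔ (bushSeq hd π i).2 = [] := by
  constructor
  · intro h
    rw [bushSeq_spine hd π hi h]
  · intro h
    by_contra hn
    rcases i with _ | i
    · exact hn (hd.onSpine_zero hw hwr)
    · rw [bushSeq_bush hd π hi hn] at h
      exact List.cons_ne_nil _ _ h

theorem bushSeq_par {i : ℕ} (hi : i < m) :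
    bushSeq hd π (i + 1) ≠ (0, []) ∧ sinParent (bushSeq hd π (i + 1)) = bushSeq hd π (p i) := by
  have h1 := hd.le_self i
  by_cases h : OnSpine p d r w (i + 1)
  · rw [bushSeq_spine hd π hi h, bushSeq_spine hd π (by omega) (hd.onSpine_parent hi h),
      hd.succ i hi]
    exact ⟨by simp, rfl⟩
  · rw [bushSeq_bush hd π hi h]
    exact ⟨by simp, rfl⟩

end

theorem sinDepth_apply (hd : IsDepth p d r m) {ψ : ℕ → ℕ × List ℕ} (h0 : ψ 0 = (0, []))
    (h : ∀ i < m, ψ (i + 1) ≠ (0, []) ∧ sinParent (ψ (i + 1)) = ψ (p i)) {i : ℕ} (hi : i ≤ m) :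
    sinDepth (ψ i) = d i := by
  induction i using Nat.strong_induction_on with
  | _ i ih =>
    rcases i with _ | i
    · rw [h0, hd.zero]
      rfl
    · have h1 := hd.le_self i
      rw [sinDepth_parent (h i hi).1, (h i hi).2, ih (p i) (by omega) (by omega), hd.succ i hi]

section

variable (hd : IsDepth p d r m) {w : ℕ} (hw : w ≤ m) (hwr : d w = r) (π : BushOrder p d r m w)

include hw hwr in
theorem isInjSeq_bushSeq : IsInjSeq (0, []) m (bushSeq hd π) := by
  refine ⟨bushSeq_zero hd π, fun i hi => if_neg (by omega), ?_⟩
  have hdep := fun {i : ℕ} (hi : i ≤ m) =>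
    sinDepth_apply hd (bushSeq_zero hd π) (fun i hi => bushSeq_par hd π hi) hi
  have key : ∀ i ≤ m, ∀ j ≤ m, bushSeq hd π i = bushSeq hd π j → i = j := by
    intro i
    induction i using Nat.strong_induction_on with
    | _ i ih =>
      intro hi j hj hij
      have hdij : d i = d j := by rw [← hdep hi, ← hdep hj, hij]
      rcases i with _ | i
      · exact (hd.eq_zero hj (hdij ▸ hd.zero)).symm
      rcases j with _ | j
      · exact hd.eq_zero hi (hdij.trans hd.zero)
      have hpi := hd.le_self i
      have hpj := hd.le_self j
      by_cases hs : OnSpine p d r w (i + 1)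
      · have hs' := hs
        rw [onSpine_iff_bushSeq hd π hw hwr hi, hij, ← onSpine_iff_bushSeq hd π hw hwr hj] at hs'
        rw [← hs, ← hs', hdij]
      · have hs' := hs
        rw [onSpine_iff_bushSeq hd π hw hwr hi, hij, ← onSpine_iff_bushSeq hd π hw hwr hj] at hs'
        have hpar : p i = p j := ih (p i) (by omega) (by omega) (p j) (by omega) (by
          rw [← (bushSeq_par hd π hi).2, ← (bushSeq_par hd π hj).2, hij])
        rw [bushSeq_bush hd π hi hs, bushSeq_bush hd π hj hs'] at hij
        have hlab : π.label i = π.label j := (List.cons.inj (congrArg Prod.snd hij)).1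
        obtain ⟨hi1, hi2⟩ := mem_of_not_onSpine hd hi hs
        obtain ⟨-, hj2⟩ := mem_of_not_onSpine hd hj hs'
        rw [← hpar] at hj2
        have e1 := label_eq π (i := ⟨p i, hi1⟩) ⟨i, hi2⟩
        have e2 := label_eq π (i := ⟨p i, hi1⟩) ⟨j, hj2⟩
        simp only at e1 e2
        rw [e1, e2] at hlab
        have := congrArg Subtype.val ((π ⟨p i, hi1⟩).injective (Fin.ext hlab))
        simp only at this
        rw [this]
  exact fun i hi j hj hij => key i hi j hj hij

include hw hwr in
/-- The embedding `bushSeq` is exact if and only if the numbers of offspring are those of the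
embedded tree. -/
theorem isSinExact_bushSeq_iff (ξ : ℕ × List ℕ → ℕ) :
    IsSinExact ξ p d r m (bushSeq hd π) ↔
      ∀ i ∈ innerVertices d r m, ξ (bushSeq hd π i) = (bushChildren p d r m w i).card := by
  have hinj := isInjSeq_bushSeq hd hw hwr π
  have hchild : ∀ i (hi : i ∈ innerVertices d r m), ∀ j < (bushChildren p d r m w i).card,
      ∃ c < m, p c = i ∧ bushSeq hd π (c + 1) =
        ((bushSeq hd π i).1, j :: (bushSeq hd π i).2) := by
    intro i hi j hj
    obtain ⟨h1, h2, h3⟩ := mem_bushChildren.1 ((π ⟨i, hi⟩).symm ⟨j, hj⟩).2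
    have e := label_eq π ((π ⟨i, hi⟩).symm ⟨j, hj⟩)
    rw [Equiv.apply_symm_apply] at e
    refine ⟨_, h1, h2, ?_⟩
    rw [bushSeq_bush hd π h1 h3, e]
    simp only at h2
    rw [h2]
  constructor
  · intro h i hi
    obtain ⟨him, hir⟩ := mem_innerVertices.1 hi
    refine eq_of_forall_lt_iff fun j => ⟨fun hj => ?_, fun hj => ?_⟩
    · obtain ⟨k, hk, hkj⟩ := h.exact i him hir ((bushSeq hd π i).1, j :: (bushSeq hd π i).2)
        ⟨h.born i him, hj⟩ (by simp) rfl
      obtain ⟨c, rfl⟩ : ∃ c, k = c + 1 := by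
        refine Nat.exists_eq_succ_of_ne_zero fun h0 => ?_
        rw [h0, bushSeq_zero] at hkj
        simp at hkj
      have hns : ¬ OnSpine p d r w (c + 1) := by
        rw [onSpine_iff_bushSeq hd π hw hwr hk, hkj]
        exact List.cons_ne_nil _ _
      have hpc := hd.le_self c
      have hpar : p c = i := by
        refine hinj.2.2 (Set.mem_Iic.2 (by omega)) (Set.mem_Iic.2 him) ?_
        rw [← (bushSeq_par hd π hk).2, hkj]
        rfl
      rw [bushSeq_bush hd π hk hns] at hkj
      have hlab : π.label c = j := (List.cons.inj (congrArg Prod.snd hkj)).1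
      subst hpar
      have e := label_eq π (i := ⟨p c, hi⟩) ⟨c, (mem_of_not_onSpine hd hk hns).2⟩
      simp only at e
      rw [← hlab, e]
      exact Fin.is_lt _
    · obtain ⟨c, hc, -, hcj⟩ := hchild i hi j hj
      have := h.born (c + 1) hc
      rw [hcj] at this
      exact this.2
  · intro h
    refine ⟨hinj, fun i hi => bushSeq_par hd π hi, fun i => ?_, fun i hi hir y hy hy0 hpar => ?_⟩
    · induction i using Nat.strong_induction_on with
      | _ i ih =>
        intro hi
        by_cases hs : OnSpine p d r w i
        · rw [bushSeq_spine hd π hi hs]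
          trivial
        · rcases i with _ | i
          · exact absurd (hd.onSpine_zero hw hwr) hs
          · have hpi := hd.le_self i
            obtain ⟨h1, h2⟩ := mem_of_not_onSpine hd hi hs
            rw [bushSeq_bush hd π hi hs]
            refine ⟨ih (p i) (by omega) (by omega), ?_⟩
            have e := label_eq π (i := ⟨p i, h1⟩) ⟨i, h2⟩
            simp only at e
            change _ < ξ (bushSeq hd π (p i))
            rw [h _ h1, e]
            exact Fin.is_lt _
    · rcases y with ⟨a, _ | ⟨j, u⟩⟩
      · have hs : OnSpine p d r w i := by
          rw [onSpine_iff_bushSeq hd π hw hwr hi, ← hpar]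
          rfl
        obtain ⟨c, hc, hpc, hsc⟩ := hd.onSpine_child hw hwr hir hs
        refine ⟨c + 1, hc, ?_⟩
        rw [bushSeq_spine hd π hi hs] at hpar
        have h1 : a - 1 = d i := congrArg Prod.fst hpar
        have h2 : a ≠ 0 := fun h => hy0 (by rw [h])
        rw [bushSeq_spine hd π hc hsc, hd.succ c hc, hpc]
        simp only [Prod.mk.injEq, and_true]
        omega
      · have hpar' : (a, u) = bushSeq hd π i := hpar
        obtain ⟨c, hc, -, hcj⟩ := hchild i (mem_innerVertices.2 ⟨hi, hir⟩) j (by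
          rw [← h i (mem_innerVertices.2 ⟨hi, hir⟩), ← hpar']
          exact hy.2)
        refine ⟨c + 1, hc, ?_⟩
        rw [hcj, ← hpar']

theorem bushSeq_injective : Function.Injective (bushSeq hd (w := w)) := by
  intro π π' h
  ext i c
  obtain ⟨h1, h2, h3⟩ := mem_bushChildren.1 c.2
  rw [← label_eq π c, ← label_eq π' c]
  have := congrFun h (c + 1)
  rw [bushSeq_bush hd π h1 h3, bushSeq_bush hd π' h1 h3] at this
  exact (List.cons.inj (congrArg Prod.snd this)).1

end

theorem onSpine_self {w : ℕ} (hwr : d w = r) : OnSpine p d r w w := by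
  rw [OnSpine, hwr, Nat.sub_self]
  rfl

theorem IsSinExact.sinDepth_eq {ξ : ℕ × List ℕ → ℕ} (hd : IsDepth p d r m) {ψ : ℕ → ℕ × List ℕ}
    (h : IsSinExact ξ p d r m ψ) {i : ℕ} (hi : i ≤ m) : sinDepth (ψ i) = d i :=
  sinDepth_apply hd h.inj.1 h.par hi

/-- As the image of an exact embedding contains the infinite path up to height `r`, some vertex is
mapped to its point at height `r`. -/
theorem IsSinExact.exists_end {ξ : ℕ × List ℕ → ℕ} (hd : IsDepth p d r m) {ψ : ℕ → ℕ × List ℕ}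
    (h : IsSinExact ξ p d r m ψ) : ∃ w ≤ m, ψ w = (r, []) := by
  have key : ∀ a ≤ r, ∃ i ≤ m, ψ i = (a, []) := by
    intro a
    induction a with
    | zero => exact fun _ => ⟨0, Nat.zero_le _, h.inj.1⟩
    | succ a ih =>
      intro ha
      obtain ⟨i, hi, hia⟩ := ih (by omega)
      have hdi := h.sinDepth_eq hd hi
      rw [hia, sinDepth, List.length_nil] at hdi
      exact h.exact i hi (by simp only at hdi; omega) (a + 1, []) trivial (by simp) hia.symm
  exact key r le_rfl

theorem IsSinExact.onSpine_iff {ξ : ℕ × List ℕ → ℕ} (hd : IsDepth p d r m) {ψ : ℕ → ℕ × List ℕ}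
    (h : IsSinExact ξ p d r m ψ) {w : ℕ} (hw : w ≤ m) (hwr : ψ w = (r, [])) {i : ℕ} (hi : i ≤ m) :
    OnSpine p d r w i ↔ (ψ i).2 = [] := by
  have key : ∀ n, ψ ((parentIndex p)^[n] w) = (r - n, []) := by
    intro n
    induction n with
    | zero => exact hwr
    | succ n ih =>
      rw [Function.iterate_succ_apply']
      have hle := (hd.iterate hw n).1
      generalize (parentIndex p)^[n] w = k at ih hle
      rcases k with _ | j
      · rw [h.inj.1, Prod.mk.injEq] at ih
        rw [parentIndex, h.inj.1, Prod.mk.injEq]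
        exact ⟨by omega, rfl⟩
      · rw [parentIndex, ← (h.par j hle).2, ih]
        rfl
  constructor
  · intro hs
    rw [← hs, key]
  · intro hs
    have hdi := h.sinDepth_eq hd hi
    have h1 : ψ i = (d i, []) := by
      rw [sinDepth, hs, List.length_nil] at hdi
      exact Prod.ext hdi hs
    refine h.inj.2.2 (Set.mem_Iic.2 (hd.iterate hw _).1) (Set.mem_Iic.2 hi) ?_
    rw [key, h1, Nat.sub_sub_self (hd.le i hi)]

/-- Every exact embedding arises from the end of the path and the orderings of the children: the
latter are the addresses of the images. -/
theorem IsSinExact.exists_bushSeq {ξ : ℕ × List ℕ → ℕ} (hd : IsDepth p d r m)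
    {ψ : ℕ → ℕ × List ℕ} (h : IsSinExact ξ p d r m ψ) :
    ∃ w ≤ m, d w = r ∧ ∃ π : BushOrder p d r m w, bushSeq hd π = ψ := by
  obtain ⟨w, hw, hψw⟩ := h.exists_end hd
  have hwr : d w = r := by
    rw [← h.sinDepth_eq hd hw, hψw]
    rfl
  refine ⟨w, hw, hwr, ?_⟩
  let lab : ℕ → ℕ := fun c => (ψ (c + 1)).2.headD 0
  have hlab : ∀ c < m, ¬ OnSpine p d r w (c + 1) →
      ψ (c + 1) = ((ψ (p c)).1, lab c :: (ψ (p c)).2) := by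
    intro c hc hs
    rw [h.onSpine_iff hd hw hψw hc] at hs
    rw [← (h.par c hc).2]
    simp only [lab]
    rcases hx : ψ (c + 1) with ⟨a, _ | ⟨j, u⟩⟩
    · rw [hx] at hs
      exact absurd rfl hs
    · rfl
  have hlt : ∀ i, ∀ c : bushChildren p d r m w i, lab c < ξ (ψ i) := by
    rintro i ⟨c, hc⟩
    obtain ⟨hcm, rfl, hs⟩ := mem_bushChildren.1 hc
    have := h.born (c + 1) hcm
    rw [hlab c hcm hs] at this
    exact this.2
  let f : ∀ i, bushChildren p d r m w i → Fin (ξ (ψ i)) := fun i c => ⟨lab c, hlt i c⟩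
  have hf : ∀ i ∈ innerVertices d r m, Function.Bijective (f i) := by
    intro i hi
    obtain ⟨him, hir⟩ := mem_innerVertices.1 hi
    constructor
    · rintro ⟨c, hc⟩ ⟨c', hc'⟩ hcc
      obtain ⟨hcm, hpc, hs⟩ := mem_bushChildren.1 hc
      obtain ⟨hcm', hpc', hs'⟩ := mem_bushChildren.1 hc'
      have h1 : lab c = lab c' := congrArg Fin.val hcc
      have h2 := h.inj.2.2 (Set.mem_Iic.2 hcm) (Set.mem_Iic.2 hcm')
        (by rw [hlab c hcm hs, hlab c' hcm' hs', h1, hpc, hpc'])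
      exact Subtype.ext (Nat.succ_injective h2)
    · rintro ⟨j, hj⟩
      obtain ⟨k, hk, hkj⟩ := h.exact i him hir ((ψ i).1, j :: (ψ i).2) ⟨h.born i him, hj⟩
        (by simp) rfl
      obtain ⟨c, rfl⟩ : ∃ c, k = c + 1 := by
        refine Nat.exists_eq_succ_of_ne_zero fun h0 => ?_
        rw [h0, h.inj.1] at hkj
        simp at hkj
      have hs : ¬ OnSpine p d r w (c + 1) := by
        rw [h.onSpine_iff hd hw hψw hk, hkj]
        exact List.cons_ne_nil _ _
      have hle := hd.le_self c
      have hpc : p c = i := by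
        refine h.inj.2.2 (Set.mem_Iic.2 (by omega)) (Set.mem_Iic.2 him) ?_
        rw [← (h.par c hk).2, hkj]
        rfl
      refine ⟨⟨c, mem_bushChildren.2 ⟨hk, hpc, hs⟩⟩, Fin.ext ?_⟩
      change (ψ (c + 1)).2.headD 0 = j
      rw [hkj]
      rfl
  have hcard : ∀ i ∈ innerVertices d r m, ξ (ψ i) = (bushChildren p d r m w i).card := by
    intro i hi
    have := Fintype.card_congr (Equiv.ofBijective _ (hf i hi))
    rw [Fintype.card_coe, Fintype.card_fin] at this
    exact this.symm
  let π : BushOrder p d r m w := fun i =>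
    (Equiv.ofBijective _ (hf i.1 i.2)).trans (finCongr (hcard i.1 i.2))
  refine ⟨π, funext fun i => ?_⟩
  rcases lt_or_ge m i with hi | hi
  · rw [h.inj.2.1 i hi]
    exact if_neg (by omega)
  induction i using Nat.strong_induction_on with
  | _ i ih =>
    rcases i with _ | i
    · rw [bushSeq_zero, h.inj.1]
    · have hle := hd.le_self i
      by_cases hs : OnSpine p d r w (i + 1)
      · rw [bushSeq_spine hd π hi hs]
        have hdi := h.sinDepth_eq hd hi
        rw [h.onSpine_iff hd hw hψw hi] at hs
        rw [sinDepth, hs, List.length_nil] at hdi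
        exact (Prod.ext hdi hs).symm
      · obtain ⟨h1, h2⟩ := mem_of_not_onSpine hd hi hs
        have e := label_eq π (i := ⟨p i, h1⟩) ⟨i, h2⟩
        simp only at e
        rw [bushSeq_bush hd π hi hs, ih (p i) (by omega) (by omega), hlab i hi hs, e]
        rfl

/-- The possible ends of the path in the tree with depths `d`. -/
def deepVertices (d : ℕ → ℕ) (r m : ℕ) : Finset ℕ := (Finset.range (m + 1)).filter fun i => d i = r

theorem mem_deepVertices {i : ℕ} : i ∈ deepVertices d r m ↔ i ≤ m ∧ d i = r := by
  simp [deepVertices]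

theorem IsDepth.card_innerVertices_add (hd : IsDepth p d r m) :
    (innerVertices d r m).card + (deepVertices d r m).card = m + 1 := by
  rw [innerVertices, deepVertices, ← Finset.card_range (m + 1)]
  rw [Finset.filter_congr (q := fun i => ¬ d i < r) (p := fun i => d i = r) fun i hi => by
    have := hd.le i (by simpa using hi)
    omega]
  rw [Finset.card_range]
  simpa using Finset.card_filter_add_card_filter_not (s := Finset.range (m + 1)) fun i => d i < r

open Classical in
/-- The exact embeddings correspond to the pairs of an end `w` of the path and orderings `π` for which
the numbers of offspring are right. -/
theorem ncard_isSinExact (hd : IsDepth p d r m) (ξ : ℕ × List ℕ → ℕ) :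
    {ψ | IsSinExact ξ p d r m ψ}.ncard =
      ∑ w ∈ deepVertices d r m, ∑ π : BushOrder p d r m w,
        if ∀ i ∈ innerVertices d r m, ξ (bushSeq hd π i) = (bushChildren p d r m w i).card
        then 1 else 0 := by
  let g : (Σ w : deepVertices d r m, BushOrder p d r m w) → ℕ → ℕ × List ℕ := fun a => bushSeq hd a.2
  have hg : Function.Injective g := by
    rintro ⟨⟨w, hw⟩, π⟩ ⟨⟨w', hw'⟩, π'⟩ h
    obtain ⟨h1, h2⟩ := mem_deepVertices.1 hw
    obtain ⟨h1', h2'⟩ := mem_deepVertices.1 hw'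
    have h3 : bushSeq hd π = bushSeq hd π' := h
    have h4 : w = w' := by
      refine (isInjSeq_bushSeq hd h1 h2 π).2.2 (Set.mem_Iic.2 h1) (Set.mem_Iic.2 h1') ?_
      rw [bushSeq_spine hd π h1 (onSpine_self h2), h3, bushSeq_spine hd π' h1' (onSpine_self h2'),
        h2, h2']
    subst h4
    rw [bushSeq_injective hd h3]
  have himage : {ψ | IsSinExact ξ p d r m ψ} = g '' {a | ∀ i ∈ innerVertices d r m,
      ξ (bushSeq hd a.2 i) = (bushChildren p d r m a.1 i).card} := by
    ext ψ
    constructor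
    · intro h
      obtain ⟨w, hw, hwr, π, rfl⟩ := IsSinExact.exists_bushSeq hd h
      exact ⟨⟨⟨w, mem_deepVertices.2 ⟨hw, hwr⟩⟩, π⟩, (isSinExact_bushSeq_iff hd hw hwr π ξ).1 h, rfl⟩
    · rintro ⟨⟨⟨w, hw⟩, π⟩, h, rfl⟩
      obtain ⟨hw, hwr⟩ := mem_deepVertices.1 hw
      exact (isSinExact_bushSeq_iff hd hw hwr π ξ).2 h
  rw [himage, Set.ncard_image_of_injective _ hg, ← Finset.sum_coe_sort, ← Fintype.sum_sigma',
    Finset.sum_boole, Nat.cast_id, ← Set.ncard_coe_finset]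
  congr 1
  ext a
  simp

end Enumeration

/-! ### The law of the limit tree -/

section Law

instance : IsProbabilityMeasure offspringLaw := by
  unfold offspringLaw
  infer_instance

theorem measurableSet_forall_eq (I : Finset ℕ) (x : ℕ → ℕ × List ℕ) (c : ℕ → ℕ) :
    MeasurableSet {ξ : ℕ × List ℕ → ℕ | ∀ i ∈ I, ξ (x i) = c i} := by
  have : {ξ : ℕ × List ℕ → ℕ | ∀ i ∈ I, ξ (x i) = c i} =
      ⋂ i ∈ I, (fun ξ : ℕ × List ℕ → ℕ => ξ (x i)) ⁻¹' {c i} := by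
    ext ξ
    simp
  rw [this]
  exact I.measurableSet_biInter fun i _ => measurable_pi_apply _ (MeasurableSet.singleton _)

theorem offspringLaw_forall_eq (I : Finset ℕ) {x : ℕ → ℕ × List ℕ} (hx : Set.InjOn x I)
    (c : ℕ → ℕ) :
    offspringLaw.real {ξ | ∀ i ∈ I, ξ (x i) = c i} =
      ∏ i ∈ I, Real.exp (-1) / ((c i).factorial : ℝ) := by
  classical
  have h1 : {ξ : ℕ × List ℕ → ℕ | ∀ i ∈ I, ξ (x i) = c i} =
      Set.pi (I.image x : Finset (ℕ × List ℕ)) fun y => {n | ∀ i ∈ I, x i = y → n = c i} := by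
    ext ξ
    simp only [Set.mem_ofPred_eq, Set.mem_pi, Finset.mem_coe, Finset.mem_image]
    constructor
    · rintro h _ - i hi rfl
      exact h i hi
    · exact fun h i hi => h (x i) ⟨i, hi, rfl⟩ i hi rfl
  rw [measureReal_def, offspringLaw, h1, Measure.infinitePi_pi _ fun _ _ => MeasurableSet.of_discrete,
    Finset.prod_image hx, ENNReal.toReal_prod]
  refine Finset.prod_congr rfl fun i hi => ?_
  have h2 : {n | ∀ j ∈ I, x j = x i → n = c j} = {c i} := by
    ext n
    simp only [Set.mem_ofPred_eq, Set.mem_singleton_iff]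
    refine ⟨fun h => h i hi rfl, ?_⟩
    rintro rfl j hj hji
    rw [hx hj hi hji]
  rw [h2, ← measureReal_def, poissonMeasure_real_singleton]
  simp

theorem card_bushOrder (p d : ℕ → ℕ) (r m w : ℕ) [Fintype (BushOrder p d r m w)] :
    Fintype.card (BushOrder p d r m w) =
      ∏ i ∈ innerVertices d r m, (bushChildren p d r m w i).card.factorial := by
  classical
  rw [← Nat.card_eq_fintype_card, Nat.card_pi,
    ← Finset.prod_coe_sort _ fun i => (bushChildren p d r m w i).card.factorial]
  refine Finset.prod_congr rfl fun i _ => ?_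
  rw [Nat.card_eq_fintype_card, Fintype.card_equiv (Finset.equivFin _), Fintype.card_coe]

/-- The mean number of exact embeddings into the limit tree: for each of the `m + 1 - s` possible ends
`w` of the path, the number of orderings cancels the factorials in the Poisson weights. -/
theorem integral_ncard_isSinExact {p d : ℕ → ℕ} {r m : ℕ} (hd : IsDepth p d r m) :
    ∫ ξ, ({ψ | IsSinExact ξ p d r m ψ}.ncard : ℝ) ∂offspringLaw =
      Real.exp (-(innerVertices d r m).card) * (m + 1 - (innerVertices d r m).card) := by
  classical
  set I := innerVertices d r m with hI
  have hsum : ∀ ξ : ℕ × List ℕ → ℕ, ({ψ | IsSinExact ξ p d r m ψ}.ncard : ℝ) =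
      ∑ w ∈ deepVertices d r m, ∑ π : BushOrder p d r m w,
        {ξ : ℕ × List ℕ → ℕ | ∀ i ∈ I, ξ (bushSeq hd π i) =
          (bushChildren p d r m w i).card}.indicator 1 ξ := by
    intro ξ
    rw [ncard_isSinExact hd]
    push_cast
    refine Finset.sum_congr rfl fun w _ => Finset.sum_congr (by congr!) fun π _ => ?_
    simp only [Set.indicator_apply, Set.mem_ofPred_eq, Pi.one_apply]
    congr
  simp only [hsum]
  have hmeas := fun w (π : BushOrder p d r m w) =>
    measurableSet_forall_eq I (bushSeq hd π) fun i => (bushChildren p d r m w i).card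
  have hint : ∀ w (π : BushOrder p d r m w), Integrable
      ({ξ : ℕ × List ℕ → ℕ | ∀ i ∈ I, ξ (bushSeq hd π i) =
        (bushChildren p d r m w i).card}.indicator (1 : (ℕ × List ℕ → ℕ) → ℝ)) offspringLaw := fun w π =>
    (integrable_const (1 : ℝ)).indicator (hmeas w π)
  rw [integral_finsetSum _ fun w _ => integrable_finsetSum _ fun π _ => hint w π]
  have hw : ∀ w ∈ deepVertices d r m, ∫ ξ, ∑ π : BushOrder p d r m w,
      {ξ : ℕ × List ℕ → ℕ | ∀ i ∈ I, ξ (bushSeq hd π i) =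
        (bushChildren p d r m w i).card}.indicator (1 : (ℕ × List ℕ → ℕ) → ℝ) ξ ∂offspringLaw =
      Real.exp (-I.card) := by
    intro w hw
    obtain ⟨h1, h2⟩ := mem_deepVertices.1 hw
    rw [integral_finsetSum _ fun π _ => hint w π]
    have hterm : ∀ π : BushOrder p d r m w, ∫ ξ,
        {ξ : ℕ × List ℕ → ℕ | ∀ i ∈ I, ξ (bushSeq hd π i) =
          (bushChildren p d r m w i).card}.indicator (1 : (ℕ × List ℕ → ℕ) → ℝ) ξ ∂offspringLaw =
        ∏ i ∈ I, Real.exp (-1) / ((bushChildren p d r m w i).card.factorial : ℝ) := by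
      intro π
      rw [integral_indicator_one (hmeas w π)]
      refine offspringLaw_forall_eq I ((isInjSeq_bushSeq hd h1 h2 π).2.2.mono fun i hi => ?_) _
      exact (mem_innerVertices.1 hi).1
    rw [Finset.sum_congr rfl fun π _ => hterm π, Finset.sum_const, Finset.card_univ, card_bushOrder,
      nsmul_eq_mul, Nat.cast_prod, ← hI, ← Finset.prod_mul_distrib]
    rw [Finset.prod_congr rfl fun i _ => mul_div_cancel₀ (Real.exp (-1))
      (Nat.cast_ne_zero.2 (Nat.factorial_ne_zero _)), Finset.prod_const, ← Real.exp_nat_mul]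
    congr 1
    ring
  rw [Finset.sum_congr rfl hw, Finset.sum_const, nsmul_eq_mul, mul_comm]
  congr 1
  have hcard := congrArg (Nat.cast (R := ℝ)) hd.card_innerVertices_add
  push_cast at hcard
  linarith

/-- The mean number of exact embeddings in terms of the law of the truncation. The event is
measurable since it is a finite union of cylinders. -/
theorem mul_offspringLaw_truncIso {U : Type*} {t : SimpleGraph U} {o : U} {D : U → ℕ} {par : U → U}
    (ht : IsRootedTree t o D par) {p d : ℕ → ℕ} {r m : ℕ} (hd : IsDepth p d r m) {e : ℕ → U}
    (he : IsLabelling t o p m e) (hpos : 0 < {θ | IsExact t o p d r m θ}.ncard) :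
    ({θ | IsExact t o p d r m θ}.ncard : ℝ) *
        offspringLaw.real {ξ | TruncIso (sinTree ξ) (sinRoot ξ) r t o} =
      Real.exp (-(innerVertices d r m).card) * (m + 1 - (innerVertices d r m).card) := by
  classical
  rw [← integral_ncard_isSinExact hd]
  have h1 : ∀ ξ, ({ψ | IsSinExact ξ p d r m ψ}.ncard : ℝ) =
      ({θ | IsExact t o p d r m θ}.ncard : ℝ) *
        {ξ | TruncIso (sinTree ξ) (sinRoot ξ) r t o}.indicator 1 ξ := by
    intro ξ
    rw [← ncard_isExact_sinTree ξ hd, ncard_isExact (isRootedTree_sinTree ξ) ht hd he,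
      Set.indicator_apply]
    simp only [Set.mem_ofPred_eq, Pi.one_apply, mul_ite, mul_one, mul_zero, Nat.cast_ite,
      Nat.cast_zero]
  have h2 : MeasurableSet {ξ | TruncIso (sinTree ξ) (sinRoot ξ) r t o} := by
    have : {ξ | TruncIso (sinTree ξ) (sinRoot ξ) r t o} =
        ⋃ w ∈ deepVertices d r m, ⋃ π : BushOrder p d r m w,
          {ξ | ∀ i ∈ innerVertices d r m, ξ (bushSeq hd π i) = (bushChildren p d r m w i).card} := by
      ext ξ
      have h3 : TruncIso (sinTree ξ) (sinRoot ξ) r t o ↔ {ψ | IsSinExact ξ p d r m ψ}.ncard ≠ 0 := by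
        rw [← ncard_isExact_sinTree ξ hd, ncard_isExact (isRootedTree_sinTree ξ) ht hd he]
        simp [hpos.ne']
      rw [Set.mem_ofPred_eq, h3, ncard_isSinExact hd, ne_eq, Finset.sum_eq_zero_iff]
      simp
    rw [this]
    exact Finset.measurableSet_biUnion _ fun w _ => MeasurableSet.iUnion fun π =>
      measurableSet_forall_eq _ _ _
  simp only [h1]
  rw [integral_const_mul, integral_indicator_one h2]

end Law

/-! ### The limit theorem -/

/-- The mean number of exact embeddings in terms of the law of the truncation of the random spanning
tree. -/
theorem mul_ustProb_truncIso {α β : Type*} [Fintype α] [Finite β] (G : Graph α β) (v : V(G))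
    {U : Type*} {t : SimpleGraph U} {o : U} {D : U → ℕ} {par : U → U}
    (ht : IsRootedTree t o D par) {p d : ℕ → ℕ} {r m : ℕ} (hd : IsDepth p d r m) {e : ℕ → U}
    (he : IsLabelling t o p m e) :
    ustMean G (fun T => (exactCount (underlying G T) v (innerVertices d r m) p m : ℝ)) =
      ({θ | IsExact t o p d r m θ}.ncard : ℝ) *
        ustProb G {T | TruncIso (G.restrict T).toSimpleGraph v r t o} := by
  classical
  have h1 : ∀ T ∈ (Set.toFinite (spanningTrees G)).toFinset,
      (exactCount (underlying G T) v (innerVertices d r m) p m : ℝ) =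
        ({θ | IsExact t o p d r m θ}.ncard : ℝ) *
          if TruncIso (underlying G T) v r t o then 1 else 0 := by
    intro T hT
    have hT' : (underlying G T).IsTree := ((Set.Finite.mem_toFinset _).1 hT).2.2
    obtain ⟨par', hpar⟩ := exists_isRootedTree hT' v
    rw [exactCount_eq, ncard_isExact hpar ht hd he]
    simp
  rw [ustMean, Finset.sum_congr rfl h1, ← Finset.mul_sum, Finset.sum_boole, mul_div_assoc, ustProb]
  congr 3
  rw [← Set.ncard_coe_finset]
  congr 1
  ext T
  rw [Finset.mem_coe, Finset.mem_filter, Set.Finite.mem_toFinset]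
  rfl

end USTLimit

theorem theorem5p3 {V E : ℕ → Type*} [∀ k, Fintype (V k)] [∀ k, Finite (E k)]
    (G : ∀ k, Graph (V k) (E k)) (v : ∀ k, V((G k)))
    (hconn : ∀ k, USTLimit.IsConnected (G k))
    (hdeg : ∀ ε : ℝ, 0 < ε → ∀ᶠ k : ℕ in atTop, ∀ x ∈ V((G k)),
      |(USTLimit.degStar (G k) x : ℝ) - k| ≤ ε * k)
    (hM : ∀ ε : ℝ, 0 < ε → ∀ᶠ k : ℕ in atTop, ∀ (e f : E k) (x y z w : V k),
      (G k).IsLink e x y → (G k).IsLink f z w → x ≠ y → z ≠ w → x ≠ w → y ≠ z →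
      |(k : ℝ) * USTLimit.transferImpedance (G k) x y z w
        - ((({x, y} : Set (V k)) ∩ {z, w}).ncard : ℝ)| ≤ ε)
    (r n : ℕ) (t : SimpleGraph (Fin n)) (o : Fin n) (ht : t.IsTree)
    (hr : ∀ x, t.dist o x ≤ r) :
    Tendsto
      (fun k => USTLimit.ustProb (G k)
        {T | USTLimit.TruncIso ((G k).restrict T).toSimpleGraph (v k) r t o})
      atTop
      (𝓝 (USTLimit.offspringLaw.real
        {ξ | USTLimit.TruncIso (USTLimit.sinTree ξ) (USTLimit.sinRoot ξ) r t o})) := by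
  obtain ⟨m, p, d, e, hd, he⟩ := USTLimit.exists_labelling ht o hr
  obtain ⟨par, hpar⟩ := USTLimit.exists_isRootedTree ht o
  have hpos := he.ncard_isExact_pos d r
  have hne : ({θ | USTLimit.IsExact t o p d r m θ}.ncard : ℝ) ≠ 0 := Nat.cast_ne_zero.2 hpos.ne'
  have hlim := USTLimit.tendsto_ustMean_exactCount G v hconn
    (fun ε hε => by
      filter_upwards [hdeg ε hε, hM ε hε] with k h1 h2
      exact ⟨h1, h2⟩)
    (USTLimit.innerVertices d r m) hd.le_self fun x hx => (USTLimit.mem_innerVertices.1 hx).1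
  simp only [USTLimit.mul_ustProb_truncIso _ _ hpar hd he,
    ← USTLimit.mul_offspringLaw_truncIso hpar hd he hpos] at hlim
  have := hlim.const_mul ({θ | USTLimit.IsExact t o p d r m θ}.ncard : ℝ)⁻¹
  simpa only [inv_mul_cancel_left₀ hne] using this
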